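/- Let $\mu>1$, $A>0$, and let $\nu$ be determined by $\frac1\mu+\frac1\nu=1$. There is a constant $C=C(A,\mu)>0$, depending only on $A$ and $\mu$, with the following property. Let $(M,g)$ be a smooth Riemannian manifold without boundary, of any dimension, and let $\sigma\ge 0$ be a continuous function on $M$. Let $R_0>0$, $m>0$, and let $\rho>0$ be a proper Lipschitz function on $M$ such that $$\tfrac12\le|\nabla\rho|\le 1\quad\text{and}\quad \Delta\rho\le\frac m\rho$$ in the weak sense for $\rho\ge R_0$ (the first almost everywhere on $\{\rho\ge R_0\}$, the second tested against nonnegative smooth functions with compact support in $\{\rho>R_0\}$). Write $D(r)=\{\rho<r\}$, $\Sigma(r)=\{\rho=r\}$ and $V(r)=\mathrm{Vol}(D(r))$, the volume and all integrals being taken with respect to the Riemannian measure. Suppose that the scaling invariant Sobolev inequality with exponent $\mu$ and constant $A$ holds: $$\Big(\frac1{V(R)}\int_{D(R)}|\phi|^{2\mu}\Big)^{1/\mu}\le A R^2 \frac1{V(R)}\int_{D(R)}\big(|\nabla\phi|^2+\sigma\phi^2\big)\qquad\text{for all } R\ge R_0,\ \phi\in C_0^\infty(D(R)).$$ Then for every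 $0<\theta\le1$, every $R\ge4R_0$ and every positive function $u$ that is $C^2$ and satisfies $\Delta u\ge\sigma u$ on $D(2R)\setminus D(R_0)$ (it suffices that this holds on the open set $\{R_0<\rho<2R\}$), $$\sup_{\Sigma(R)}u\le\frac{C}{\theta^{2\nu}\,V(2R)}\int_{D((1+\theta)R)\setminus D(R/4)}u ,$$ where the integral may be $+\infty$. In particular, $M$ has the mean value property $(\mathcal M)$: there are constants $A_0>0$ and $\nu'>1$ such that for all $0<\theta\le1$ and $R\ge4R_0$, $$\sup_{\Sigma(R)}u\le\frac{A_0}{\theta^{2\nu'}}\,\frac1{V((1+\theta)R)}\int_{D((1+\theta)R)\setminus D(R_0)}u$$ for every positive $C^2$ function $u$ with $\Delta u\ge\sigma u$ on $D(2R)\setminus D(R_0)$ (again only required on $\{R_0<\rho<2R\}$). -/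

import Mathlib

open scoped Manifold ContDiff ENNReal
open Bundle MeasureTheory

/-! ### Riemannian geometry in the preferred charts

Throughout, `M` is a smooth manifold without boundary modelled on `ℝⁿ`, with a smooth Riemannian
metric given by Mathlib's `RiemannianBundle` structure on its tangent bundle. -/

section Riemannian

variable {n : ℕ} {M : Type*} [TopologicalSpace M] [ChartedSpace (EuclideanSpace ℝ (Fin n)) M]
  [RiemannianBundle (fun x : M ↦ TangentSpace (𝓡 n) x)]

/-- The coordinate vector field `∂/∂xⁱ` of the chart centred at `p`, at the point of `M` with
coordinates `y`. -/
noncomputable def coordVector (p : M) (y : EuclideanSpace ℝ (Fin n)) (i : Fin n) :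
    TangentSpace (𝓡 n) ((extChartAt (𝓡 n) p).symm y) :=
  mfderiv (𝓡 n) (𝓡 n) (extChartAt (𝓡 n) p).symm y
    ((NormedSpace.fromTangentSpace y).symm (EuclideanSpace.single i (1 : ℝ)))

/-- The matrix `g_{ij} = g(∂/∂xⁱ, ∂/∂xʲ)` of the metric in the chart centred at `p`. -/
noncomputable def gramMatrix (p : M) (y : EuclideanSpace ℝ (Fin n)) : Matrix (Fin n) (Fin n) ℝ :=
  Matrix.of fun i j ↦ inner ℝ (coordVector p y i) (coordVector p y j)

/-- The density `√(det g_{ij})` of the Riemannian volume in the chart centred at `p`. -/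
noncomputable def volumeDensity (p : M) (y : EuclideanSpace ℝ (Fin n)) : ℝ :=
  Real.sqrt (gramMatrix p y).det

/-- The measure `√(det g_{ij}) dx¹ ⋯ dxⁿ` on the domain of the chart centred at `p`, extended by
zero to the rest of `M`. -/
noncomputable def chartVolume [MeasurableSpace M] (p : M) : Measure M :=
  ((volume.restrict (extChartAt (𝓡 n) p).target).withDensity
    fun y ↦ ENNReal.ofReal (volumeDensity p y)).map (extChartAt (𝓡 n) p).symm

variable (n M) in
/-- The Riemannian volume measure. The measures `chartVolume p` agree on the overlaps of the
chart domains, so their supremum is the measure which restricts to each of them. -/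
noncomputable def riemannianVolume [MeasurableSpace M] : Measure M :=
  ⨆ p : M, chartVolume (n := n) p

/-- The gradient `∇f` with respect to the Riemannian metric: `g(∇f, v) = df(v)`. -/
noncomputable def riemannianGradient (f : M → ℝ) (x : M) : TangentSpace (𝓡 n) x :=
  haveI : FiniteDimensional ℝ (TangentSpace (𝓡 n) x) :=
    inferInstanceAs (FiniteDimensional ℝ (EuclideanSpace ℝ (Fin n)))
  haveI : CompleteSpace (TangentSpace (𝓡 n) x) := FiniteDimensional.complete ℝ _
  (InnerProductSpace.toDual ℝ (TangentSpace (𝓡 n) x)).symm (mvfderiv (𝓡 n) f x)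

theorem inner_riemannianGradient (f : M → ℝ) (x : M) (v : TangentSpace (𝓡 n) x) :
    inner ℝ (riemannianGradient (n := n) f x) v = mvfderiv (𝓡 n) f x v := by
  have : FiniteDimensional ℝ (TangentSpace (𝓡 n) x) :=
    inferInstanceAs (FiniteDimensional ℝ (EuclideanSpace ℝ (Fin n)))
  have : CompleteSpace (TangentSpace (𝓡 n) x) := FiniteDimensional.complete ℝ _
  exact InnerProductSpace.toDual_symm_apply

/-- The Laplace--Beltrami operator on twice differentiable functions,
`Δu = (1/√g) ∑ᵢ ∂ᵢ (√g ∑ⱼ gⁱʲ ∂ⱼ u)`, computed at `x` in the chart centred at `x`. -/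
noncomputable def laplaceBeltrami (u : M → ℝ) (x : M) : ℝ :=
  (volumeDensity x (extChartAt (𝓡 n) x x))⁻¹ *
    ∑ i : Fin n, fderiv ℝ (fun y : EuclideanSpace ℝ (Fin n) ↦ volumeDensity x y *
        ∑ j : Fin n, (gramMatrix x y)⁻¹ i j *
          fderiv ℝ (u ∘ (extChartAt (𝓡 n) x).symm) y (EuclideanSpace.single j 1))
      (extChartAt (𝓡 n) x x) (EuclideanSpace.single i 1)

end Riemannian

/-! ### The function `ρ`, the Sobolev inequality and the mean value property -/

/-- The sublevel set `D(r) = {ρ < r}`. -/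
def sublevel {M : Type*} (ρ : M → ℝ) (r : ℝ) : Set M := {x | ρ x < r}

/-- The level set `Σ(r) = {ρ = r}`. -/
def levelSet {M : Type*} (ρ : M → ℝ) (r : ℝ) : Set M := {x | ρ x = r}

section Analysis

variable (n : ℕ) {M : Type*} [EMetricSpace M] [ChartedSpace (EuclideanSpace ℝ (Fin n)) M]
  [RiemannianBundle (fun x : M ↦ TangentSpace (𝓡 n) x)] [MeasurableSpace M]

/-- The volume `V(r)` of `D(r)`. -/
noncomputable def volumeSublevel (ρ : M → ℝ) (r : ℝ) : ℝ :=
  (riemannianVolume n M).real (sublevel ρ r)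

/-- `ρ` is a positive proper Lipschitz function with `1/2 ≤ |∇ρ| ≤ 1` almost everywhere on
`{ρ ≥ R₀}` and `Δρ ≤ m / ρ` weakly on `{ρ > R₀}`. As `ρ` is Lipschitz, it is differentiable almost
everywhere, and its weak gradient is its almost everywhere defined gradient. -/
structure IsDistanceLike (ρ : M → ℝ) (m R₀ : ℝ) : Prop where
  pos : ∀ x, 0 < ρ x
  proper : IsProperMap ρ
  lipschitz : ∃ K, LipschitzWith K ρ
  gradient_bounds : ∀ᵐ x ∂(riemannianVolume n M), R₀ ≤ ρ x →
    1 / 2 ≤ ‖riemannianGradient (n := n) ρ x‖ ∧ ‖riemannianGradient (n := n) ρ x‖ ≤ 1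
  laplacian_le : ∀ φ : M → ℝ, ContMDiff (𝓡 n) 𝓘(ℝ, ℝ) ∞ φ → (∀ x, 0 ≤ φ x) →
    HasCompactSupport φ → tsupport φ ⊆ {x | R₀ < ρ x} →
    -∫ x, inner ℝ (riemannianGradient (n := n) ρ x) (riemannianGradient (n := n) φ x)
        ∂(riemannianVolume n M) ≤
      ∫ x, m / ρ x * φ x ∂(riemannianVolume n M)

/-- The scaling invariant Sobolev inequality on the sets `D(R)`, `R ≥ R₀`, with exponent `μ` and
constant `A`. -/
def SobolevInequality (ρ σ : M → ℝ) (R₀ A μ : ℝ) : Prop :=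
  ∀ R, R₀ ≤ R → ∀ φ : M → ℝ, ContMDiff (𝓡 n) 𝓘(ℝ, ℝ) ∞ φ → HasCompactSupport φ →
    tsupport φ ⊆ sublevel ρ R →
    (⨍ x in sublevel ρ R, |φ x| ^ (2 * μ) ∂(riemannianVolume n M)) ^ (1 / μ) ≤
      A * R ^ 2 * ⨍ x in sublevel ρ R,
        (‖riemannianGradient (n := n) φ x‖ ^ 2 + σ x * φ x ^ 2) ∂(riemannianVolume n M)

/-- `u` is a positive `C²` function with `Δu ≥ σu` on the open set `U`. -/
structure IsPositiveSubsolutionOn (σ u : M → ℝ) (U : Set M) : Prop where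
  contMDiffOn : ContMDiffOn (𝓡 n) 𝓘(ℝ, ℝ) 2 u U
  pos : ∀ x ∈ U, 0 < u x
  le_laplacian : ∀ x ∈ U, σ x * u x ≤ laplaceBeltrami (n := n) u x

/-- The supremum of `u` over `S`, in `[0, ∞]`, for a function `u` that is positive there. -/
noncomputable def supOn {M : Type*} (u : M → ℝ) (S : Set M) : ℝ≥0∞ :=
  ⨆ x ∈ S, ENNReal.ofReal (u x)

/-- The integral of `u` over `S`, in `[0, ∞]`, for a function `u` that is positive there. -/
noncomputable def integralOn (u : M → ℝ) (S : Set M) : ℝ≥0∞ :=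
  ∫⁻ x in S, ENNReal.ofReal (u x) ∂(riemannianVolume n M)

/-- The mean value property with constants `A₀` and `ν`. Subsolutions are only required to be such
in the open part `{R₀ < ρ < 2R}` of `D(2R) \ D(R₀)`. -/
def MeanValuePropertyWith (ρ σ : M → ℝ) (R₀ A₀ ν : ℝ) : Prop :=
  ∀ θ R : ℝ, 0 < θ → θ ≤ 1 → 4 * R₀ ≤ R → ∀ u : M → ℝ,
    IsPositiveSubsolutionOn n σ u {x | R₀ < ρ x ∧ ρ x < 2 * R} →
    supOn u (levelSet ρ R) ≤
      ENNReal.ofReal (A₀ / θ ^ (2 * ν) * (1 / volumeSublevel n ρ ((1 + θ) * R))) *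
        integralOn n u (sublevel ρ ((1 + θ) * R) \ sublevel ρ R₀)

/-- The mean value property `(M)`. -/
def MeanValueProperty (ρ σ : M → ℝ) (R₀ : ℝ) : Prop :=
  ∃ A₀ ν : ℝ, 0 < A₀ ∧ 1 < ν ∧ MeanValuePropertyWith n ρ σ R₀ A₀ ν

end Analysis

/-!
# A mean value inequality from a Sobolev inequality

The proof is a Moser iteration on annuli, arranged so that it ends with the `L¹` norm of `u`.

For a positive subsolution `u` and a cutoff `χ`, testing `Δu ≥ σu` with `χ² u²ᵏ⁻¹` bounds the energy
`∫ |∇(χuᵏ)|² + σ(χuᵏ)²` by `∫ u²ᵏ |∇χ|²` (`IsPositiveSubsolutionOn.integral_energy_le`). The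
Sobolev inequality turns this into a bound for the norm of `χuᵏ` in `L ^ (2μ)`. The cutoffs are
powers of a single function `φ = η((ρ - R) / s)`, with
`s = θR / 2`, which equals `1` on `Σ(R)`, is supported in the annulus `|ρ - R| ≤ s`, and satisfies
`|∇φ| ≤ K / s` because `|∇ρ| ≤ 1`. For `χ = φ ^ (2νk - (ν - 1))` the relation `1/μ + 1/ν = 1` makes
the exponents match: the integrals `I_k` of `(φ ^ (2ν) u) ^ (2k) φ ^ (-2ν)`, divided by `V(2R)`,
satisfy `I_{kμ} ^ (1/μ) ≤ B k² I_k`, where `B` is a constant times `θ ^ (-2)`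
(`IsPositiveSubsolutionOn.integral_rpow_le`). Iterating over `k = μ ^ j`, and using that
`φ ^ (2ν) u` is at least half its maximum `W` on a set of positive volume, gives
`(W / 2)² ≤ C B ^ ν I_1` (`sq_le_of_le_rpow_of_rpow_mul_le`). Since `I_1` is the normalized integral
of `φ ^ (2ν) u²`, it is at most `W` times that of `u` over the annulus, and one factor `W` cancels
(`IsPositiveSubsolutionOn.le_integral`). The power `θ ^ (-2ν)` is the one contained in `B ^ ν`.

As `ρ` is only Lipschitz, so are the cutoffs, while the Sobolev inequality is given for smooth
functions and Green's formula has to be derived from the definition of `Δ` in charts. The class of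
test functions used here is that of the functions which are Lipschitz in charts
(`ChartLipschitzAt`); it contains the functions which are Lipschitz for the Riemannian distance,
and is stable under products and composition with `C¹` functions. A partition of unity and
mollification in charts approximate such a function, if it has compact support, by smooth functions
with uniformly bounded gradients converging almost everywhere (`exists_isSmoothApprox`), so that
dominated convergence extends both inequalities. Green's formula for smooth test functions is
integration by parts in a chart; it also shows that the Laplacian computed in a chart
does not depend on the chart (`chartLaplacian_eq`), which a definition pointwise in the preferred
chart leaves open.
-/


/-! ### Mollification of Lipschitz functions -/

section Mollification

open Filter Topology Set
open scoped Convolution NNReal Pointwise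

variable {E : Type*} [NormedAddCommGroup E] [InnerProductSpace ℝ E] [FiniteDimensional ℝ E]
  [MeasurableSpace E] [BorelSpace E]

/-- Derivatives of a mollified Lipschitz function are mollified directional derivatives. -/
theorem LipschitzWith.fderiv_normed_convolution_apply {f : E → ℝ} {K : ℝ≥0}
    (hf : LipschitzWith K f) (φ : ContDiffBump (0 : E)) (x v : E) :
    fderiv ℝ (φ.normed volume ⋆[ContinuousLinearMap.lsmul ℝ ℝ, volume] f : E → ℝ) x v =
      (φ.normed volume ⋆[ContinuousLinearMap.lsmul ℝ ℝ, volume] fun y ↦ lineDeriv ℝ f y v) x := by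
  set k := φ.normed (volume : Measure E) with hk
  have hkc : Continuous k := φ.continuous_normed
  have hks : HasCompactSupport k := φ.hasCompactSupport_normed
  set F : E → ℝ := (k ⋆[ContinuousLinearMap.lsmul ℝ ℝ, volume] f : E → ℝ) with hF
  have hcd : ContDiff ℝ ∞ F :=
    hks.contDiff_convolution_left _ φ.contDiff_normed hf.continuous.locallyIntegrable
  have hFx : ∀ x, F x = ∫ t, f t * k (x - t) := by
    intro x
    rw [hF, convolution_eq_swap]
    simp [mul_comm]
  have hint : ∀ (x : E) (s : ℝ), Integrable fun t ↦ f (t + s • v) * k (x - t) := by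
    intro x s
    refine Continuous.integrable_of_hasCompactSupport
      ((hf.continuous.comp (by fun_prop)).mul (hkc.comp (by fun_prop))) ?_
    exact (hks.comp_homeomorph (Homeomorph.subLeft x)).mul_left
  have hgi : Integrable fun t ↦ k (x - t) :=
    Continuous.integrable_of_hasCompactSupport (hkc.comp (by fun_prop))
      (hks.comp_homeomorph (Homeomorph.subLeft x))
  have h1 := hf.integral_inv_smul_sub_mul_tendsto_integral_lineDeriv_mul hgi v
  have h2 : Tendsto (fun t : ℝ ↦ t⁻¹ • (F (x + t • v) - F x)) (𝓝[>] 0) (𝓝 (fderiv ℝ F x v)) := by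
    have := (hcd.differentiable (by simp) x).hasFDerivAt.hasLineDerivAt v
    exact this.tendsto_slope_zero_right
  have h3 : ∀ t : ℝ, t⁻¹ • (F (x + t • v) - F x) =
      ∫ y, (t⁻¹ • (f (y + t • v) - f y)) * k (x - y) := by
    intro t
    have e1 : F (x + t • v) = ∫ y, f (y + t • v) * k (x - y) := by
      rw [hFx, ← integral_add_right_eq_self _ (t • v)]
      refine integral_congr_ae (Eventually.of_forall fun y ↦ ?_)
      simp
    rw [e1, hFx, ← integral_sub (hint x t) (by simpa using hint x 0), ← integral_smul]
    refine integral_congr_ae (Eventually.of_forall fun y ↦ ?_)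
    simp only [smul_eq_mul]
    ring
  simp_rw [h3] at h2
  rw [tendsto_nhds_unique h2 h1, convolution_eq_swap]
  simp [mul_comm]

/-- A Lipschitz function with compact support in an open set is the limit of smooth functions which
are uniformly Lipschitz, have their supports in a common compact subset of the open set, and whose
derivatives converge almost everywhere. -/
theorem LipschitzWith.exists_contDiff_approx {f : E → ℝ} {K : ℝ≥0} (hf : LipschitzWith K f)
    (hc : HasCompactSupport f) {T : Set E} (hT : IsOpen T) (hfT : tsupport f ⊆ T) :
    ∃ (Q : Set E) (F : ℕ → E → ℝ) (C : ℝ), IsCompact Q ∧ Q ⊆ T ∧ (∀ j, ContDiff ℝ ∞ (F j)) ∧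
      (∀ j, tsupport (F j) ⊆ Q) ∧ (∀ j, LipschitzWith K (F j)) ∧ (∀ j x, |F j x| ≤ C) ∧
      (∀ x, Tendsto (fun j ↦ F j x) atTop (𝓝 (f x))) ∧
      ∀ᵐ x, DifferentiableAt ℝ f x ∧
        ∀ v, Tendsto (fun j ↦ fderiv ℝ (F j) x v) atTop (𝓝 (fderiv ℝ f x v)) := by
  obtain ⟨δ, hδ, hδT⟩ := hc.isCompact.exists_cthickening_subset_open hT hfT
  have hr : ∀ j : ℕ, 0 < δ / (j + 1) := fun j ↦ by positivity
  let φ : ℕ → ContDiffBump (0 : E) := fun j ↦ ⟨δ / (j + 1) / 2, δ / (j + 1), half_pos (hr j),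
    half_lt_self (hr j)⟩
  have hout : ∀ j, (φ j).rOut = δ / (j + 1) := fun j ↦ rfl
  have hlim : Tendsto (fun j ↦ (φ j).rOut) atTop (𝓝 0) :=
    (tendsto_const_nhds (x := δ)).div_atTop
      (tendsto_natCast_atTop_atTop.atTop_add (tendsto_const_nhds (x := (1 : ℝ))))
  have hle : ∀ j, (φ j).rOut ≤ δ := fun j ↦ by
    rw [hout]; exact div_le_self hδ.le (by linarith [Nat.cast_nonneg (α := ℝ) j])
  obtain ⟨C, hC⟩ := hc.exists_bound_of_continuous hf.continuous
  refine ⟨Metric.cthickening δ (tsupport f),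
    fun j ↦ ((φ j).normed volume ⋆[ContinuousLinearMap.lsmul ℝ ℝ, volume] f : E → ℝ),
    C + K * δ, hc.isCompact.cthickening, hδT, ?_, ?_, ?_, ?_, ?_, ?_⟩
  · exact fun j ↦ (φ j).hasCompactSupport_normed.contDiff_convolution_left _ (φ j).contDiff_normed
      hf.continuous.locallyIntegrable
  · intro j
    refine closure_minimal ?_ Metric.isClosed_cthickening
    refine (support_convolution_subset _).trans ?_
    rintro _ ⟨a, ha, b, hb, rfl⟩
    rw [(φ j).support_normed_eq, mem_ball_zero_iff] at ha
    refine Metric.mem_cthickening_of_dist_le _ b _ _ (subset_tsupport f hb) ?_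
    simpa using ha.le.trans (hle j)
  · intro j
    refine LipschitzWith.of_dist_le_mul fun x y ↦ ?_
    have hint : ∀ x, Integrable fun t ↦ (φ j).normed volume t * f (x - t) := fun x ↦
      Continuous.integrable_of_hasCompactSupport
        ((φ j).continuous_normed.mul (hf.continuous.comp (by fun_prop)))
        (φ j).hasCompactSupport_normed.mul_right
    simp only [convolution_def, ContinuousLinearMap.lsmul_apply, smul_eq_mul]
    rw [Real.dist_eq, ← integral_sub (hint x) (hint y), ← Real.norm_eq_abs]
    have : (K : ℝ) * dist x y = ∫ t, (φ j).normed volume t * (K * dist x y) := by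
      rw [integral_mul_const, (φ j).integral_normed, one_mul]
    rw [this]
    refine norm_integral_le_of_norm_le ((φ j).integrable_normed.mul_const _)
      (Eventually.of_forall fun t ↦ ?_)
    rw [← mul_sub, norm_mul, Real.norm_of_nonneg ((φ j).nonneg_normed t)]
    gcongr
    · exact (φ j).nonneg_normed t
    · have := hf.dist_le_mul (x - t) (y - t)
      rwa [dist_sub_right, Real.dist_eq] at this
  · intro j x
    have := (φ j).dist_normed_convolution_le (μ := volume) (g := f) (x₀ := x) (ε := K * δ)
      hf.continuous.aestronglyMeasurable fun y hy ↦ (hf.dist_le_mul y x).trans (by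
        gcongr; exact (Metric.mem_ball.1 hy).le.trans (hle j))
    rw [Real.dist_eq] at this
    have h2 := hC x
    rw [Real.norm_eq_abs] at h2
    have h3 := abs_sub_abs_le_abs_sub
      (((φ j).normed volume ⋆[ContinuousLinearMap.lsmul ℝ ℝ, volume] f : E → ℝ) x) (f x)
    linarith
  · exact fun x ↦ ContDiffBump.convolution_tendsto_right_of_continuous hlim hf.continuous x
  -- Lebesgue's differentiation theorem applies to the finitely many directions of a basis
  · let b := Module.finBasis ℝ E
    have hb : ∀ i, ∀ᵐ x, Tendsto (fun j ↦
        ((φ j).normed volume ⋆[ContinuousLinearMap.lsmul ℝ ℝ, volume]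
          fun y ↦ lineDeriv ℝ f y (b i)) x) atTop (𝓝 (lineDeriv ℝ f x (b i))) := fun i ↦
      ContDiffBump.ae_convolution_tendsto_right_of_locallyIntegrable (K := 2) hlim
        (Eventually.of_forall fun j ↦ by
          show (φ j).rOut ≤ 2 * ((φ j).rOut / 2); linarith) (hf.locallyIntegrable_lineDeriv _)
    filter_upwards [ae_all_iff.2 hb, hf.ae_differentiableAt] with x hx hd
    refine ⟨hd, fun v ↦ ?_⟩
    have hsum : ∀ L : E →L[ℝ] ℝ, L v = ∑ i, b.repr v i * L (b i) := fun L ↦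
      calc L v = L (∑ i, b.repr v i • b i) := by rw [b.sum_repr]
        _ = _ := by simp only [map_sum, map_smul, smul_eq_mul]
    simp_rw [hsum]
    refine tendsto_finsetSum _ fun i _ ↦ Tendsto.const_mul _ ?_
    rw [← hd.lineDeriv_eq_fderiv]
    simp_rw [hf.fderiv_normed_convolution_apply]
    exact hx i

end Mollification

/-! ### The metric in coordinates -/

section Coordinates

open Filter Topology Set

variable {n : ℕ} {M : Type*} [TopologicalSpace M] [ChartedSpace (EuclideanSpace ℝ (Fin n)) M]

/-- The derivative of the inverse of the chart centred at `p`, at the point with coordinates `y`, as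
an endomorphism of the model space. -/
noncomputable def chartSymmDeriv (p : M) (y : EuclideanSpace ℝ (Fin n)) :
    EuclideanSpace ℝ (Fin n) →L[ℝ] EuclideanSpace ℝ (Fin n) :=
  mfderiv (𝓡 n) (𝓡 n) (extChartAt (𝓡 n) p).symm y

/-- The transition map from the chart centred at `p` to the chart centred at `q`. -/
noncomputable def chartTransition (p q : M) (y : EuclideanSpace ℝ (Fin n)) :
    EuclideanSpace ℝ (Fin n) :=
  extChartAt (𝓡 n) q ((extChartAt (𝓡 n) p).symm y)

theorem mdifferentiableAt_chart_symm [IsManifold (𝓡 n) ∞ M] (p : M)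
    {y : EuclideanSpace ℝ (Fin n)} (hy : y ∈ (extChartAt (𝓡 n) p).target) :
    MDifferentiableAt (𝓡 n) (𝓡 n) (extChartAt (𝓡 n) p).symm y :=
  ((contMDiffOn_extChartAt_symm (n := ∞) p).contMDiffAt
    ((isOpen_extChartAt_target p).mem_nhds hy)).mdifferentiableAt (by simp)

theorem mdifferentiableAt_chart [IsManifold (𝓡 n) ∞ M] (p : M)
    {x : M} (hx : x ∈ (extChartAt (𝓡 n) p).source) :
    MDifferentiableAt (𝓡 n) (𝓡 n) (extChartAt (𝓡 n) p) x :=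
  mdifferentiableAt_extChartAt (by simpa using hx)

theorem contDiffAt_chartTransition [IsManifold (𝓡 n) ∞ M] (p q : M)
    {y : EuclideanSpace ℝ (Fin n)} (hy : y ∈ (extChartAt (𝓡 n) p).target)
    (hq : (extChartAt (𝓡 n) p).symm y ∈ (extChartAt (𝓡 n) q).source) :
    ContDiffAt ℝ ∞ (chartTransition p q) y := by
  rw [← contMDiffAt_iff_contDiffAt]
  exact ((contMDiffOn_extChartAt (n := ∞) (I := 𝓡 n) (x := q)).contMDiffAt
    ((chartAt _ q).open_source.mem_nhds (by simpa using hq))).comp y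
    ((contMDiffOn_extChartAt_symm (n := ∞) p).contMDiffAt
    ((isOpen_extChartAt_target p).mem_nhds hy))

/-- Points close to `y` stay in the overlap of the charts centred at `p` and `q`. -/
theorem eventually_mem_chart_overlap (p q : M)
    {y : EuclideanSpace ℝ (Fin n)} (hy : y ∈ (extChartAt (𝓡 n) p).target)
    (hq : (extChartAt (𝓡 n) p).symm y ∈ (extChartAt (𝓡 n) q).source) :
    ∀ᶠ z in 𝓝 y, z ∈ (extChartAt (𝓡 n) p).target ∧
      (extChartAt (𝓡 n) p).symm z ∈ (extChartAt (𝓡 n) q).source := by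
  have h1 := (isOpen_extChartAt_target (I := 𝓡 n) p).mem_nhds hy
  have h2 : ContinuousAt (extChartAt (𝓡 n) p).symm y :=
    (continuousOn_extChartAt_symm p).continuousAt h1
  filter_upwards [h1, h2.preimage_mem_nhds ((isOpen_extChartAt_source q).mem_nhds hq)] with z a b
  exact ⟨a, b⟩

theorem chartSymmDeriv_eq_comp [IsManifold (𝓡 n) ∞ M] (p q : M)
    {y : EuclideanSpace ℝ (Fin n)} (hy : y ∈ (extChartAt (𝓡 n) p).target)
    (hq : (extChartAt (𝓡 n) p).symm y ∈ (extChartAt (𝓡 n) q).source) :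
    chartSymmDeriv p y =
      (chartSymmDeriv q (chartTransition p q y)).comp (fderiv ℝ (chartTransition p q) y) := by
  have h1 : (extChartAt (𝓡 n) p).symm =ᶠ[𝓝 y]
      (extChartAt (𝓡 n) q).symm ∘ chartTransition p q := by
    filter_upwards [eventually_mem_chart_overlap p q hy hq] with z hz
    exact ((extChartAt (𝓡 n) q).left_inv hz.2).symm
  have h2 : MDifferentiableAt (𝓡 n) (𝓡 n) (chartTransition p q) y :=
    ((contDiffAt_chartTransition p q hy hq).differentiableAt (by simp)).mdifferentiableAt
  have h3 := mfderiv_comp y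
    (mdifferentiableAt_chart_symm q ((extChartAt (𝓡 n) q).map_source hq)) h2
  have h4 := h1.mfderiv_eq (I := 𝓡 n) (I' := 𝓡 n)
  have h5 : mfderiv (𝓡 n) (𝓡 n) (chartTransition p q) y = fderiv ℝ (chartTransition p q) y :=
    mfderiv_eq_fderiv
  unfold chartSymmDeriv
  rw [← h5]
  exact h4.trans h3

theorem injective_chartSymmDeriv [IsManifold (𝓡 n) ∞ M] (p : M)
    {y : EuclideanSpace ℝ (Fin n)} (hy : y ∈ (extChartAt (𝓡 n) p).target) :
    Function.Injective (chartSymmDeriv p y) := by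
  have h := isInvertible_mfderivWithin_extChartAt_symm (I := 𝓡 n) hy
  rw [show range (𝓡 n) = univ from ModelWithCorners.range_eq_univ _, mfderivWithin_univ] at h
  exact h.injective

theorem mdifferentiableAt_iff_differentiableAt_chart [IsManifold (𝓡 n) ∞ M] (p : M)
    {y : EuclideanSpace ℝ (Fin n)} (hy : y ∈ (extChartAt (𝓡 n) p).target) (f : M → ℝ) :
    MDifferentiableAt (𝓡 n) 𝓘(ℝ, ℝ) f ((extChartAt (𝓡 n) p).symm y) ↔
      DifferentiableAt ℝ (f ∘ (extChartAt (𝓡 n) p).symm) y := by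
  constructor
  · intro h
    exact (h.comp y (mdifferentiableAt_chart_symm p hy)).differentiableAt
  · intro h
    have hx := (extChartAt (𝓡 n) p).map_target hy
    have h1 : MDifferentiableAt (𝓡 n) 𝓘(ℝ, ℝ) (f ∘ (extChartAt (𝓡 n) p).symm)
        (extChartAt (𝓡 n) p ((extChartAt (𝓡 n) p).symm y)) := by
      rw [(extChartAt (𝓡 n) p).right_inv hy]
      exact h.mdifferentiableAt
    refine (h1.comp _ (mdifferentiableAt_chart p hx)).congr_of_eventuallyEq ?_
    filter_upwards [(isOpen_extChartAt_source (I := 𝓡 n) p).mem_nhds hx] with z hz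
    exact congrArg f ((extChartAt (𝓡 n) p).left_inv hz).symm

/-- Both sides vanish where `f` is not differentiable. -/
theorem mvfderiv_chartSymmDeriv [IsManifold (𝓡 n) ∞ M] (p : M)
    {y : EuclideanSpace ℝ (Fin n)} (hy : y ∈ (extChartAt (𝓡 n) p).target) (f : M → ℝ)
    (v : EuclideanSpace ℝ (Fin n)) :
    mvfderiv (𝓡 n) f ((extChartAt (𝓡 n) p).symm y) (chartSymmDeriv p y v) =
      fderiv ℝ (f ∘ (extChartAt (𝓡 n) p).symm) y v := by
  by_cases h : MDifferentiableAt (𝓡 n) 𝓘(ℝ, ℝ) f ((extChartAt (𝓡 n) p).symm y)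
  · have h1 := mfderiv_comp y h (mdifferentiableAt_chart_symm p hy)
    have h2 : mfderiv (𝓡 n) 𝓘(ℝ, ℝ) (f ∘ (extChartAt (𝓡 n) p).symm) y =
      fderiv ℝ (f ∘ (extChartAt (𝓡 n) p).symm) y := mfderiv_eq_fderiv
    rw [← h2]
    exact (congrArg (fun L ↦ L v) h1).symm
  · have h' := mt (mdifferentiableAt_iff_differentiableAt_chart p hy f).2 h
    rw [fderiv_zero_of_not_differentiableAt h', mvfderiv, mfderiv_zero_of_not_mdifferentiableAt h]
    rw [ContinuousLinearMap.comp_zero]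
    rfl

variable [RiemannianBundle (fun x : M ↦ TangentSpace (𝓡 n) x)]

/-- The inner product of `T_x M`, as a function on the model space. -/
noncomputable def metricForm (x : M) (v w : EuclideanSpace ℝ (Fin n)) : ℝ :=
  inner ℝ (show TangentSpace (𝓡 n) x from v) (show TangentSpace (𝓡 n) x from w)

theorem gramMatrix_apply (p : M) (y : EuclideanSpace ℝ (Fin n)) (i j : Fin n) :
    gramMatrix p y i j = metricForm ((extChartAt (𝓡 n) p).symm y)
      (chartSymmDeriv p y (EuclideanSpace.single i 1))
      (chartSymmDeriv p y (EuclideanSpace.single j 1)) := rfl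

theorem metricForm_sum_sum (x : M) (L : EuclideanSpace ℝ (Fin n) →L[ℝ] EuclideanSpace ℝ (Fin n))
    (v w : EuclideanSpace ℝ (Fin n)) :
    metricForm x (L v) (L w) = ∑ i, ∑ j, v i * w j *
      metricForm x (L (EuclideanSpace.single i 1)) (L (EuclideanSpace.single j 1)) := by
  have key : ∀ v : EuclideanSpace ℝ (Fin n), (show TangentSpace (𝓡 n) x from L v) =
      ∑ i, v i • (show TangentSpace (𝓡 n) x from L (EuclideanSpace.single i 1)) := by
    intro v
    have h1 : L v = ∑ i, v i • L (EuclideanSpace.single i 1) := by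
      conv_lhs => rw [← (EuclideanSpace.basisFun (Fin n) ℝ).sum_repr v]
      simp only [map_sum, map_smul]
      simp
    exact h1
  have h2 : metricForm x (L v) (L w) =
      inner ℝ (∑ i, v i • (show TangentSpace (𝓡 n) x from L (EuclideanSpace.single i 1)))
       (∑ i, w i • (show TangentSpace (𝓡 n) x from L (EuclideanSpace.single i 1))) := by
    rw [← key v, ← key w]; rfl
  rw [h2, sum_inner]
  refine Finset.sum_congr rfl fun i _ ↦ ?_
  rw [inner_sum]
  refine Finset.sum_congr rfl fun j _ ↦ ?_
  rw [real_inner_smul_left, real_inner_smul_right, mul_assoc]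
  rfl

/-- The transformation law `g = Jᵀ g' J` of the metric coefficients, `J` being the Jacobian matrix
of the change of charts. -/
theorem gramMatrix_eq_conj [IsManifold (𝓡 n) ∞ M] (p q : M)
    {y : EuclideanSpace ℝ (Fin n)} (hy : y ∈ (extChartAt (𝓡 n) p).target)
    (hq : (extChartAt (𝓡 n) p).symm y ∈ (extChartAt (𝓡 n) q).source) :
    gramMatrix p y = (LinearMap.toMatrix (EuclideanSpace.basisFun (Fin n) ℝ).toBasis
        (EuclideanSpace.basisFun (Fin n) ℝ).toBasis
        (fderiv ℝ (chartTransition p q) y : EuclideanSpace ℝ (Fin n) →ₗ[ℝ] _)).transpose *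
      gramMatrix q (chartTransition p q y) *
      LinearMap.toMatrix (EuclideanSpace.basisFun (Fin n) ℝ).toBasis
        (EuclideanSpace.basisFun (Fin n) ℝ).toBasis
        (fderiv ℝ (chartTransition p q) y : EuclideanSpace ℝ (Fin n) →ₗ[ℝ] _) := by
  ext i j
  have hz : (extChartAt (𝓡 n) q).symm (chartTransition p q y) = (extChartAt (𝓡 n) p).symm y :=
    (extChartAt (𝓡 n) q).left_inv hq
  simp only [Matrix.mul_apply, Matrix.transpose_apply, gramMatrix_apply, hz]
  rw [chartSymmDeriv_eq_comp p q hy hq]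
  simp only [ContinuousLinearMap.comp_apply]
  rw [metricForm_sum_sum]
  simp only [LinearMap.toMatrix_apply, Finset.sum_mul]
  rw [Finset.sum_comm]
  refine Finset.sum_congr rfl fun k _ ↦ Finset.sum_congr rfl fun l _ ↦ ?_
  simp
  ring

theorem volumeDensity_eq_mul [IsManifold (𝓡 n) ∞ M] (p q : M)
    {y : EuclideanSpace ℝ (Fin n)} (hy : y ∈ (extChartAt (𝓡 n) p).target)
    (hq : (extChartAt (𝓡 n) p).symm y ∈ (extChartAt (𝓡 n) q).source) :
    volumeDensity p y = |(fderiv ℝ (chartTransition p q) y).det| *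
      volumeDensity q (chartTransition p q y) := by
  unfold volumeDensity
  rw [gramMatrix_eq_conj p q hy hq, Matrix.det_mul, Matrix.det_mul, Matrix.det_transpose,
    LinearMap.det_toMatrix]
  rw [mul_right_comm, ← sq, Real.sqrt_mul (sq_nonneg _), Real.sqrt_sq_eq_abs]

theorem posDef_gramMatrix [IsManifold (𝓡 n) ∞ M] (p : M)
    {y : EuclideanSpace ℝ (Fin n)} (hy : y ∈ (extChartAt (𝓡 n) p).target) :
    (gramMatrix p y).PosDef := by
  refine Matrix.PosDef.of_dotProduct_mulVec_pos ?_ fun v hv ↦ ?_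
  · ext i j
    simp only [Matrix.conjTranspose_apply, star_trivial, gramMatrix_apply]
    exact real_inner_comm _ _
  · set w : EuclideanSpace ℝ (Fin n) := WithLp.toLp 2 v with hw
    have h1 : star v ⬝ᵥ (gramMatrix p y).mulVec v =
        metricForm ((extChartAt (𝓡 n) p).symm y) (chartSymmDeriv p y w) (chartSymmDeriv p y w) := by
      rw [metricForm_sum_sum]
      simp only [dotProduct, Matrix.mulVec, Finset.mul_sum, gramMatrix_apply]
      refine Finset.sum_congr rfl fun k _ ↦ Finset.sum_congr rfl fun l _ ↦ ?_
      simp [hw]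
      ring
    rw [h1]
    have h2 : chartSymmDeriv p y w ≠ 0 := by
      rw [Ne, ← map_zero (chartSymmDeriv p y), (injective_chartSymmDeriv p hy).eq_iff]
      intro h
      exact hv (by simpa [hw] using h)
    exact real_inner_self_pos.2 h2

theorem volumeDensity_pos [IsManifold (𝓡 n) ∞ M] (p : M)
    {y : EuclideanSpace ℝ (Fin n)} (hy : y ∈ (extChartAt (𝓡 n) p).target) :
    0 < volumeDensity p y :=
  Real.sqrt_pos.2 (posDef_gramMatrix p hy).det_pos

/-- The inner product of two gradients is `gⁱʲ ∂ᵢf ∂ⱼh` in coordinates. -/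
theorem inner_riemannianGradient_eq_sum [IsManifold (𝓡 n) ∞ M] (p : M)
    {y : EuclideanSpace ℝ (Fin n)} (hy : y ∈ (extChartAt (𝓡 n) p).target) (f h : M → ℝ) :
    inner ℝ (riemannianGradient (n := n) f ((extChartAt (𝓡 n) p).symm y))
      (riemannianGradient (n := n) h ((extChartAt (𝓡 n) p).symm y)) =
      ∑ i, fderiv ℝ (f ∘ (extChartAt (𝓡 n) p).symm) y (EuclideanSpace.single i 1) *
        ∑ j, (gramMatrix p y)⁻¹ i j *
          fderiv ℝ (h ∘ (extChartAt (𝓡 n) p).symm) y (EuclideanSpace.single j 1) := by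
  set x := (extChartAt (𝓡 n) p).symm y with hx
  have hsurj : Function.Surjective (chartSymmDeriv p y) :=
    (LinearMap.injective_iff_surjective
      (f := (chartSymmDeriv p y : EuclideanSpace ℝ (Fin n) →ₗ[ℝ] _))).1
      (injective_chartSymmDeriv p hy)
  obtain ⟨b, hb⟩ := hsurj (riemannianGradient (n := n) h x)
  have hform : ∀ f : M → ℝ, ∀ w, fderiv ℝ (f ∘ (extChartAt (𝓡 n) p).symm) y w =
      inner ℝ (riemannianGradient (n := n) f x)
        (show TangentSpace (𝓡 n) x from chartSymmDeriv p y w) := fun f w ↦ by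
    rw [← mvfderiv_chartSymmDeriv p hy f w, inner_riemannianGradient]
  have hh : (fun j ↦ fderiv ℝ (h ∘ (extChartAt (𝓡 n) p).symm) y (EuclideanSpace.single j 1)) =
      (gramMatrix p y).mulVec b := by
    ext j
    rw [hform]
    have h1 : inner ℝ (riemannianGradient (n := n) h x)
        (show TangentSpace (𝓡 n) x from chartSymmDeriv p y (EuclideanSpace.single j 1)) =
        metricForm x (chartSymmDeriv p y (EuclideanSpace.single j 1)) (chartSymmDeriv p y b) := by
      rw [hb, real_inner_comm]; rfl
    rw [h1, metricForm_sum_sum]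
    simp [Matrix.mulVec, dotProduct, gramMatrix_apply]
    refine Finset.sum_congr rfl fun l _ ↦ ?_
    rw [mul_comm]
    rfl
  have hinv : ∀ i, ∑ j, (gramMatrix p y)⁻¹ i j *
      fderiv ℝ (h ∘ (extChartAt (𝓡 n) p).symm) y (EuclideanSpace.single j 1) = b i := by
    intro i
    have : (gramMatrix p y)⁻¹.mulVec ((gramMatrix p y).mulVec b) = b := by
      rw [Matrix.mulVec_mulVec,
        Matrix.nonsing_inv_mul _ (posDef_gramMatrix p hy).det_pos.ne'.isUnit, Matrix.one_mulVec]
    rw [← hh] at this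
    exact congrFun this i
  simp_rw [hinv]
  have h2 : inner ℝ (riemannianGradient (n := n) f x) (riemannianGradient (n := n) h x) =
      fderiv ℝ (f ∘ (extChartAt (𝓡 n) p).symm) y b := by
    rw [hform, hb]
  rw [h2]
  conv_lhs => rw [← (EuclideanSpace.basisFun (Fin n) ℝ).sum_repr b]
  simp [mul_comm]

end Coordinates

/-! ### Regularity of the metric coefficients -/

section Regularity

open Filter Topology Set

theorem ContDiffOn.matrix_det {E ι : Type*} [NormedAddCommGroup E] [NormedSpace ℝ E]
    [Fintype ι] [DecidableEq ι] {A : E → Matrix ι ι ℝ} {s : Set E}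
    (hA : ∀ i j, ContDiffOn ℝ ∞ (fun y ↦ A y i j) s) :
    ContDiffOn ℝ ∞ (fun y ↦ (A y).det) s := by
  simp_rw [Matrix.det_apply]
  exact ContDiffOn.sum fun σ _ ↦ (contDiffOn_prod fun i _ ↦ hA _ _).const_smul (Equiv.Perm.sign σ)

variable {n : ℕ} {M : Type*} [TopologicalSpace M] [ChartedSpace (EuclideanSpace ℝ (Fin n)) M]
  [IsManifold (𝓡 n) ∞ M]

theorem contMDiffOn_coordVector (p : M) (i : Fin n) :
    ContMDiffOn (𝓡 n) ((𝓡 n).prod 𝓘(ℝ, EuclideanSpace ℝ (Fin n))) ∞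
      (fun y ↦ (⟨(extChartAt (𝓡 n) p).symm y, coordVector p y i⟩ :
        TotalSpace (EuclideanSpace ℝ (Fin n)) (fun x : M ↦ TangentSpace (𝓡 n) x)))
      (extChartAt (𝓡 n) p).target := by
  have hT := isOpen_extChartAt_target (I := 𝓡 n) p
  have h1 := (contMDiffOn_extChartAt_symm (n := ∞) (I := 𝓡 n) p).contMDiffOn_tangentMapWithin
    (m := ∞) (by simp) hT.uniqueMDiffOn
  have h2 : ContMDiff (𝓡 n) (𝓡 n).tangent ∞
      (fun y : EuclideanSpace ℝ (Fin n) ↦ (⟨y, (NormedSpace.fromTangentSpace y).symm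
        (EuclideanSpace.single i (1 : ℝ))⟩ : TangentBundle (𝓡 n) (EuclideanSpace ℝ (Fin n)))) :=
    contMDiff_vectorSpace_iff_contDiff.2 contDiff_const
  have h3 := h1.comp h2.contMDiffOn (s := (extChartAt (𝓡 n) p).target) (fun y hy ↦ hy)
  refine h3.congr fun y hy ↦ ?_
  simp only [Function.comp, tangentMapWithin, coordVector]
  rw [mfderivWithin_of_isOpen hT hy]

variable [RiemannianBundle (fun x : M ↦ TangentSpace (𝓡 n) x)]
  [IsContMDiffRiemannianBundle (𝓡 n) ∞ (EuclideanSpace ℝ (Fin n))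
          (fun x : M ↦ TangentSpace (𝓡 n) x)]

theorem contDiffOn_gramMatrix (p : M) (i j : Fin n) :
    ContDiffOn ℝ ∞ (fun y ↦ gramMatrix p y i j) (extChartAt (𝓡 n) p).target := by
  rw [← contMDiffOn_iff_contDiffOn]
  exact ContMDiffOn.inner_bundle (contMDiffOn_coordVector p i) (contMDiffOn_coordVector p j)

theorem contDiffOn_volumeDensity (p : M) :
    ContDiffOn ℝ ∞ (volumeDensity (n := n) p) (extChartAt (𝓡 n) p).target :=
  (ContDiffOn.matrix_det (contDiffOn_gramMatrix p)).sqrt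
    fun _ hy ↦ (posDef_gramMatrix p hy).det_pos.ne'

/-- The coefficients `gⁱʲ` are smooth, by Cramer's rule. -/
theorem contDiffOn_gramMatrix_inv (p : M) (i j : Fin n) :
    ContDiffOn ℝ ∞ (fun y ↦ (gramMatrix p y)⁻¹ i j) (extChartAt (𝓡 n) p).target := by
  have h1 : (fun y ↦ (gramMatrix (n := n) p y)⁻¹ i j) = fun y ↦
      (gramMatrix p y).det⁻¹ * ((gramMatrix p y).updateRow j (Pi.single i 1)).det := by
    ext y
    rw [Matrix.inv_def, Matrix.smul_apply, Matrix.adjugate_apply, Ring.inverse_eq_inv', smul_eq_mul]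
  rw [h1]
  refine ((ContDiffOn.matrix_det (contDiffOn_gramMatrix p)).inv
    fun _ hy ↦ (posDef_gramMatrix p hy).det_pos.ne').mul (ContDiffOn.matrix_det fun k l ↦ ?_)
  by_cases hk : k = j
  · subst hk; simpa using contDiffOn_const
  · simpa [Matrix.updateRow_ne hk] using contDiffOn_gramMatrix p k l

end Regularity

/-! ### The Riemannian volume in a chart -/

section Volume

open Filter Topology Set

variable {n : ℕ} {M : Type*} [TopologicalSpace M] [ChartedSpace (EuclideanSpace ℝ (Fin n)) M]

theorem measurableSet_chart_target (p : M) :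
    MeasurableSet (extChartAt (𝓡 n) p).target :=
  (isOpen_extChartAt_target p).measurableSet

variable [MeasurableSpace M] [BorelSpace M]

theorem measurableSet_chart_source (p : M) : MeasurableSet (extChartAt (𝓡 n) p).source :=
  (isOpen_extChartAt_source p).measurableSet

theorem aemeasurable_chart_symm (p : M) :
    AEMeasurable (extChartAt (𝓡 n) p).symm
      (volume.restrict (extChartAt (𝓡 n) p).target) :=
  (continuousOn_extChartAt_symm p).aemeasurable (measurableSet_chart_target p)

theorem measurableSet_chart_target_inter_preimage (p : M) {B : Set M} (hB : MeasurableSet B) :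
    MeasurableSet ((extChartAt (𝓡 n) p).target ∩ (extChartAt (𝓡 n) p).symm ⁻¹' B) := by
  classical
  have hg : Measurable ((extChartAt (𝓡 n) p).target.piecewise (extChartAt (𝓡 n) p).symm
      fun _ ↦ p) :=
    (continuousOn_extChartAt_symm p).measurable_piecewise continuousOn_const
      (measurableSet_chart_target p)
  convert! (measurableSet_chart_target (n := n) p).inter (hg hB) using 1
  ext y
  simp only [mem_inter_iff, mem_preimage, and_congr_right_iff]
  intro hy
  rw [piecewise_eq_of_mem _ _ _ hy]

theorem measurableSet_chart_source_inter_preimage (p : M) {Z : Set (EuclideanSpace ℝ (Fin n))}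
    (hZ : MeasurableSet Z) :
    MeasurableSet ((extChartAt (𝓡 n) p).source ∩ extChartAt (𝓡 n) p ⁻¹' Z) := by
  classical
  have hg : Measurable ((extChartAt (𝓡 n) p).source.piecewise (extChartAt (𝓡 n) p)
      fun _ ↦ 0) :=
    (continuousOn_extChartAt p).measurable_piecewise continuousOn_const
      (measurableSet_chart_source p)
  convert! (measurableSet_chart_source (n := n) p).inter (hg hZ) using 1
  ext y
  simp only [mem_inter_iff, mem_preimage, and_congr_right_iff]
  intro hy
  rw [piecewise_eq_of_mem _ _ _ hy]

variable [RiemannianBundle (fun x : M ↦ TangentSpace (𝓡 n) x)]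

theorem chartVolume_apply (p : M) {B : Set M} (hB : MeasurableSet B) :
    chartVolume (n := n) p B =
      ∫⁻ y in (extChartAt (𝓡 n) p).target ∩ (extChartAt (𝓡 n) p).symm ⁻¹' B,
        ENNReal.ofReal (volumeDensity p y) := by
  unfold chartVolume
  rw [Measure.map_apply_of_aemeasurable ((aemeasurable_chart_symm p).mono_ac
    (withDensity_absolutelyContinuous _ _)) hB, withDensity_apply',
    Measure.restrict_restrict' (measurableSet_chart_target p), inter_comm]

theorem chartVolume_inter_source (p : M) {B : Set M} (hB : MeasurableSet B) :
    chartVolume (n := n) p (B ∩ (extChartAt (𝓡 n) p).source) = chartVolume (n := n) p B := by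
  rw [chartVolume_apply p hB, chartVolume_apply p (hB.inter (measurableSet_chart_source p))]
  congr 2
  ext y
  simp only [mem_inter_iff, mem_preimage, and_congr_right_iff, and_iff_left_iff_imp]
  exact fun hy _ ↦ (extChartAt (𝓡 n) p).map_target hy

/-- The measures defined by two charts agree on the overlap, by the change of variables formula. -/
theorem chartVolume_eq_of_subset [IsManifold (𝓡 n) ∞ M] (p q : M) {B : Set M}
    (hB : MeasurableSet B)
    (hp : B ⊆ (extChartAt (𝓡 n) p).source) (hq : B ⊆ (extChartAt (𝓡 n) q).source) :
    chartVolume (n := n) p B = chartVolume (n := n) q B := by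
  rw [chartVolume_apply p hB, chartVolume_apply q hB]
  set s := (extChartAt (𝓡 n) p).target ∩ (extChartAt (𝓡 n) p).symm ⁻¹' B with hs
  have himg : (extChartAt (𝓡 n) q).target ∩ (extChartAt (𝓡 n) q).symm ⁻¹' B =
      chartTransition p q '' s := by
    ext z
    constructor
    · rintro ⟨hz, hzB⟩
      refine ⟨chartTransition q p z, ⟨(extChartAt (𝓡 n) p).map_source (hp hzB), ?_⟩, ?_⟩
      · simp only [mem_preimage, chartTransition, (extChartAt (𝓡 n) p).left_inv (hp hzB)]
        exact hzB
      · simp only [chartTransition, (extChartAt (𝓡 n) p).left_inv (hp hzB),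
          (extChartAt (𝓡 n) q).right_inv hz]
    · rintro ⟨y, ⟨hy, hyB⟩, rfl⟩
      refine ⟨(extChartAt (𝓡 n) q).map_source (hq hyB), ?_⟩
      simp only [mem_preimage, chartTransition, (extChartAt (𝓡 n) q).left_inv (hq hyB)]
      exact hyB
  have hinj : InjOn (chartTransition p q) s := by
    intro y hy z hz h
    have h1 := (extChartAt (𝓡 n) q).injOn (hq hy.2) (hq hz.2) h
    exact (extChartAt (𝓡 n) p).symm.injOn hy.1 hz.1 h1
  rw [himg, lintegral_image_eq_lintegral_abs_det_fderiv_mul volume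
    (measurableSet_chart_target_inter_preimage p hB)
    (fun y hy ↦ ((contDiffAt_chartTransition p q hy.1 (hq hy.2)).differentiableAt
      (by simp)).hasFDerivAt.hasFDerivWithinAt) hinj]
  refine setLIntegral_congr_fun (measurableSet_chart_target_inter_preimage p hB) fun y hy ↦ ?_
  rw [volumeDensity_eq_mul p q hy.1 (hq hy.2), ENNReal.ofReal_mul (abs_nonneg _)]

variable [IsManifold (𝓡 n) ∞ M] [SecondCountableTopology M]

/-- The Riemannian volume restricts to `chartVolume p` on the domain of the chart centred at `p`:
the pieces of the chart measures on a countable measurable partition subordinate to the charts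
add up to a measure dominating every chart measure. -/
theorem riemannianVolume_eq_chartVolume (p : M) {B : Set M}
    (hB : MeasurableSet B) (hp : B ⊆ (extChartAt (𝓡 n) p).source) :
    riemannianVolume n M B = chartVolume (n := n) p B := by
  obtain ⟨s, hs, hcov⟩ := TopologicalSpace.countable_cover_nhds
    fun x : M ↦ extChartAt_source_mem_nhds (I := 𝓡 n) x
  have hne : s.Nonempty := by
    rcases s.eq_empty_or_nonempty with rfl | h
    · have : p ∈ (univ : Set M) := mem_univ p
      simp [← hcov] at this
    · exact h
  obtain ⟨c, rfl⟩ := hs.exists_eq_range hne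
  have hcov' : ⋃ i, (extChartAt (𝓡 n) (c i)).source = univ := by
    rw [← hcov]; simp
  set D : ℕ → Set M := disjointed fun i ↦ (extChartAt (𝓡 n) (c i)).source with hD
  have hDm : ∀ i, MeasurableSet (D i) := fun i ↦
    MeasurableSet.disjointed (fun i ↦ measurableSet_chart_source (c i)) i
  have hDs : ∀ i, D i ⊆ (extChartAt (𝓡 n) (c i)).source := fun i ↦ disjointed_subset _ i
  have hDu : ⋃ i, D i = univ := by rw [hD, iUnion_disjointed, hcov']
  have hDd : Pairwise (Function.onFun Disjoint D) := disjoint_disjointed _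
  let ν : Measure M := Measure.sum fun i ↦ (chartVolume (n := n) (c i)).restrict (D i)
  have hν : ∀ A, MeasurableSet A → ν A = ∑' i, chartVolume (n := n) (c i) (A ∩ D i) := by
    intro A hA
    simp only [ν, Measure.sum_apply _ hA, Measure.restrict_apply hA]
  have hsplit : ∀ (μ : Measure M) (A), MeasurableSet A → μ A = ∑' i, μ (A ∩ D i) := by
    intro μ A hA
    rw [← measure_iUnion, ← inter_iUnion, hDu, inter_univ]
    · exact fun i j hij ↦ (hDd hij).mono inter_subset_right inter_subset_right
    · exact fun i ↦ hA.inter (hDm i)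
  refine le_antisymm ?_ (Measure.le_iff'.1 (le_iSup (fun p : M ↦ chartVolume (n := n) p) p) B)
  have hle : riemannianVolume n M ≤ ν := by
    refine iSup_le fun q ↦ Measure.le_iff.2 fun A hA ↦ ?_
    rw [hsplit _ A hA, hν A hA]
    refine ENNReal.tsum_le_tsum fun i ↦ ?_
    rw [← chartVolume_inter_source q (hA.inter (hDm i)), chartVolume_eq_of_subset q (c i)
      ((hA.inter (hDm i)).inter (measurableSet_chart_source q)) inter_subset_right
      (inter_subset_left.trans (inter_subset_right.trans (hDs i)))]
    exact measure_mono inter_subset_left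
  refine (Measure.le_iff'.1 hle B).trans (le_of_eq ?_)
  rw [hν B hB, hsplit _ B hB]
  congr 1
  ext i
  exact chartVolume_eq_of_subset _ _ (hB.inter (hDm i)) (inter_subset_right.trans (hDs i))
    (inter_subset_left.trans hp)

theorem restrict_riemannianVolume_chart_source (p : M) :
    (riemannianVolume n M).restrict (extChartAt (𝓡 n) p).source = chartVolume (n := n) p := by
  ext B hB
  rw [Measure.restrict_apply hB, riemannianVolume_eq_chartVolume p
    (hB.inter (measurableSet_chart_source p)) inter_subset_right, chartVolume_inter_source p hB]

/-- A property which holds almost everywhere in coordinates holds almost everywhere. -/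
theorem ae_mem_chart_source_of_ae (p : M) {P : M → Prop}
    (h : ∀ᵐ y, y ∈ (extChartAt (𝓡 n) p).target → P ((extChartAt (𝓡 n) p).symm y)) :
    ∀ᵐ x ∂(riemannianVolume n M), x ∈ (extChartAt (𝓡 n) p).source → P x := by
  set Z := toMeasurable volume
    {y | ¬ (y ∈ (extChartAt (𝓡 n) p).target → P ((extChartAt (𝓡 n) p).symm y))} with hZ
  have hZ0 : volume Z = 0 := by rw [hZ, measure_toMeasurable]; exact h
  have hZm : MeasurableSet Z := measurableSet_toMeasurable _ _
  rw [ae_iff]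
  refine measure_mono_null (t := (extChartAt (𝓡 n) p).source ∩ extChartAt (𝓡 n) p ⁻¹' Z) ?_ ?_
  · intro x hx
    simp only [mem_ofPred_eq, Classical.not_imp] at hx
    refine ⟨hx.1, subset_toMeasurable _ _ ?_⟩
    simp only [mem_ofPred_eq, Classical.not_imp]
    refine ⟨(extChartAt (𝓡 n) p).map_source hx.1, ?_⟩
    rw [(extChartAt (𝓡 n) p).left_inv hx.1]
    exact hx.2
  · have hm := measurableSet_chart_source_inter_preimage p hZm
    rw [riemannianVolume_eq_chartVolume p hm inter_subset_left, chartVolume_apply p hm]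
    refine setLIntegral_measure_zero _ _ (measure_mono_null ?_ hZ0)
    rintro y ⟨hy, -, hyZ⟩
    rwa [mem_preimage, (extChartAt (𝓡 n) p).right_inv hy] at hyZ

variable [IsContMDiffRiemannianBundle (𝓡 n) ∞ (EuclideanSpace ℝ (Fin n))
  (fun x : M ↦ TangentSpace (𝓡 n) x)]

instance isOpenPosMeasure_riemannianVolume : (riemannianVolume n M).IsOpenPosMeasure := by
  refine ⟨fun U hU ⟨x, hx⟩ h0 ↦ ?_⟩
  set V := U ∩ (extChartAt (𝓡 n) x).source with hV
  have hVo : IsOpen V := hU.inter (isOpen_extChartAt_source x)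
  have h1 : riemannianVolume n M V = 0 := measure_mono_null inter_subset_left h0
  rw [riemannianVolume_eq_chartVolume x hVo.measurableSet inter_subset_right,
    chartVolume_apply x hVo.measurableSet] at h1
  set S := (extChartAt (𝓡 n) x).target ∩ (extChartAt (𝓡 n) x).symm ⁻¹' V with hS
  have hSo : IsOpen S :=
    (continuousOn_extChartAt_symm x).isOpen_inter_preimage (isOpen_extChartAt_target x) hVo
  have hSne : S.Nonempty := ⟨extChartAt (𝓡 n) x x, mem_extChartAt_target x, by
    simp only [mem_preimage, extChartAt_to_inv]; exact ⟨hx, mem_extChartAt_source x⟩⟩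
  have hcont : ContinuousOn (fun y ↦ ENNReal.ofReal (volumeDensity (n := n) x y)) S :=
    ENNReal.continuous_ofReal.comp_continuousOn
      ((contDiffOn_volumeDensity x).continuousOn.mono inter_subset_left)
  rw [lintegral_eq_zero_iff' (hcont.aemeasurable hSo.measurableSet)] at h1
  have h2 : ∀ᵐ y, y ∉ S := by
    filter_upwards [(ae_restrict_iff' hSo.measurableSet).1 h1] with y hy hyS
    have := hy hyS
    simp only [Pi.zero_apply, ENNReal.ofReal_eq_zero] at this
    exact absurd (volumeDensity_pos x hyS.1) this.not_gt
  have h3 : volume S = 0 := by simpa [ae_iff] using h2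
  exact (hSo.measure_pos volume hSne).ne' h3

instance isLocallyFiniteMeasure_riemannianVolume :
    IsLocallyFiniteMeasure (riemannianVolume n M) := by
  refine ⟨fun x ↦ ?_⟩
  obtain ⟨r, hr, hrT⟩ := Metric.nhds_basis_closedBall.mem_iff.1
    (extChartAt_target_mem_nhds (I := 𝓡 n) x)
  obtain ⟨C, hC⟩ := (isCompact_closedBall (extChartAt (𝓡 n) x x) r).exists_bound_of_continuousOn
    ((contDiffOn_volumeDensity (n := n) x).continuousOn.mono hrT)
  set V := (extChartAt (𝓡 n) x).source ∩
    extChartAt (𝓡 n) x ⁻¹' (Metric.ball (extChartAt (𝓡 n) x x) r) with hV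
  have hVo : IsOpen V :=
    (continuousOn_extChartAt x).isOpen_inter_preimage (isOpen_extChartAt_source x)
      Metric.isOpen_ball
  refine ⟨V, hVo.mem_nhds ⟨mem_extChartAt_source x, by simp [hr]⟩, ?_⟩
  rw [riemannianVolume_eq_chartVolume x hVo.measurableSet inter_subset_left,
    chartVolume_apply x hVo.measurableSet]
  have hsub : (extChartAt (𝓡 n) x).target ∩ (extChartAt (𝓡 n) x).symm ⁻¹' V ⊆
      Metric.closedBall (extChartAt (𝓡 n) x x) r := by
    rintro y ⟨hy, -, hyV⟩
    rw [mem_preimage, (extChartAt (𝓡 n) x).right_inv hy] at hyV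
    exact Metric.ball_subset_closedBall hyV
  refine (lintegral_mono_set hsub).trans_lt ?_
  refine (setLIntegral_mono' Metric.isClosed_closedBall.measurableSet
    (g := fun _ ↦ ENNReal.ofReal C) fun y hy ↦
    ENNReal.ofReal_le_ofReal ((le_abs_self _).trans (hC y hy))).trans_lt ?_
  rw [setLIntegral_const]
  exact ENNReal.mul_lt_top ENNReal.ofReal_lt_top (isCompact_closedBall _ _).measure_lt_top

/-- Integrals over a chart domain are computed in coordinates. -/
theorem integral_eq_integral_chart (p : M) {F : M → ℝ}
    (hF : ∀ x ∉ (extChartAt (𝓡 n) p).source, F x = 0)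
    (hFc : ContinuousOn F (extChartAt (𝓡 n) p).source) :
    ∫ x, F x ∂(riemannianVolume n M) =
      ∫ y in (extChartAt (𝓡 n) p).target, volumeDensity p y * F ((extChartAt (𝓡 n) p).symm y) := by
  rw [← setIntegral_eq_integral_of_forall_compl_eq_zero hF]
  have hmeas : AEStronglyMeasurable F (chartVolume (n := n) p) := by
    rw [← restrict_riemannianVolume_chart_source]
    exact hFc.aestronglyMeasurable (measurableSet_chart_source p)
  rw [restrict_riemannianVolume_chart_source]
  unfold chartVolume at hmeas ⊢
  rw [integral_map ((aemeasurable_chart_symm p).mono_ac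
    (withDensity_absolutelyContinuous _ _)) hmeas]
  rw [integral_withDensity_eq_integral_toReal_smul₀]
  · refine setIntegral_congr_fun (measurableSet_chart_target p) fun y hy ↦ ?_
    simp only [smul_eq_mul, ENNReal.toReal_ofReal (volumeDensity_pos p hy).le]
  · exact ((contDiffOn_volumeDensity p).continuousOn.aemeasurable
      (measurableSet_chart_target p)).ennreal_ofReal
  · exact Eventually.of_forall fun _ ↦ ENNReal.ofReal_lt_top

end Volume

/-! ### Functions which are locally Lipschitz in charts -/

section ChartLipschitz

open Filter Topology Set
open scoped NNReal

variable {n : ℕ} {M : Type*} [TopologicalSpace M] [ChartedSpace (EuclideanSpace ℝ (Fin n)) M]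

variable (n) in
/-- `f` is Lipschitz near `x` when read in any chart around `x`, for the Euclidean distance of the
chart. -/
def ChartLipschitzAt (f : M → ℝ) (x : M) : Prop :=
  ∀ p : M, x ∈ (extChartAt (𝓡 n) p).source → ∃ K : ℝ≥0, ∃ t ∈ 𝓝 (extChartAt (𝓡 n) p x),
    LipschitzOnWith K (f ∘ (extChartAt (𝓡 n) p).symm) t

theorem ChartLipschitzAt.congr_of_eventuallyEq {f g : M → ℝ} {x : M} (hf : ChartLipschitzAt n f x)
    (h : g =ᶠ[𝓝 x] f) : ChartLipschitzAt n g x := by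
  intro p hp
  obtain ⟨K, t, ht, hK⟩ := hf p hp
  have hc : ContinuousAt (extChartAt (𝓡 n) p).symm (extChartAt (𝓡 n) p x) :=
    continuousAt_extChartAt_symm' hp
  have h' : ∀ᶠ z in 𝓝 (extChartAt (𝓡 n) p x),
      g ((extChartAt (𝓡 n) p).symm z) = f ((extChartAt (𝓡 n) p).symm z) := by
    refine hc.eventually (p := fun z ↦ g z = f z) ?_
    rwa [(extChartAt (𝓡 n) p).left_inv hp]
  refine ⟨K, _, inter_mem ht h', fun y hy z hz ↦ ?_⟩
  simp only [Function.comp]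
  rw [hy.2, hz.2]
  exact hK hy.1 hz.1

theorem ChartLipschitzAt.continuousAt {f : M → ℝ} {x : M} (hf : ChartLipschitzAt n f x) :
    ContinuousAt f x := by
  obtain ⟨K, t, ht, hK⟩ := hf x (mem_extChartAt_source x)
  have h1 : ContinuousAt (f ∘ (extChartAt (𝓡 n) x).symm) (extChartAt (𝓡 n) x x) :=
    hK.continuousOn.continuousAt ht
  refine (h1.comp (continuousAt_extChartAt (I := 𝓡 n) x)).congr ?_
  filter_upwards [extChartAt_source_mem_nhds (I := 𝓡 n) x] with z hz
  exact congrArg f ((extChartAt (𝓡 n) x).left_inv hz)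

theorem ContMDiffAt.chartLipschitzAt [IsManifold (𝓡 n) ∞ M] {f : M → ℝ} {x : M}
    (hf : ContMDiffAt (𝓡 n) 𝓘(ℝ, ℝ) 1 f x) : ChartLipschitzAt n f x := by
  intro p hp
  have h1 : ContMDiffAt (𝓡 n) (𝓡 n) 1 (extChartAt (𝓡 n) p).symm (extChartAt (𝓡 n) p x) :=
    ((contMDiffOn_extChartAt_symm (n := ∞) p).contMDiffAt ((isOpen_extChartAt_target p).mem_nhds
      ((extChartAt (𝓡 n) p).map_source hp))).of_le (by exact_mod_cast le_top)
  have h2 : ContMDiffAt (𝓡 n) 𝓘(ℝ, ℝ) 1 (f ∘ (extChartAt (𝓡 n) p).symm)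
      (extChartAt (𝓡 n) p x) :=
    ContMDiffAt.comp _ (by rwa [(extChartAt (𝓡 n) p).left_inv hp]) h1
  exact (contMDiffAt_iff_contDiffAt.1 h2).exists_lipschitzOnWith

/-- A continuously differentiable function of two functions Lipschitz in charts is Lipschitz in
charts. -/
theorem ChartLipschitzAt.comp₂ {f g : M → ℝ} {x : M} (hf : ChartLipschitzAt n f x)
    (hg : ChartLipschitzAt n g x) {G : ℝ × ℝ → ℝ} (hG : ContDiffAt ℝ 1 G (f x, g x)) :
    ChartLipschitzAt n (fun z ↦ G (f z, g z)) x := by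
  intro p hp
  obtain ⟨K, t, ht, hK⟩ := hf p hp
  obtain ⟨K', t', ht', hK'⟩ := hg p hp
  obtain ⟨L, s, hs, hL⟩ := hG.exists_lipschitzOnWith
  have hc : ContinuousAt (fun z ↦ (f ((extChartAt (𝓡 n) p).symm z),
      g ((extChartAt (𝓡 n) p).symm z))) (extChartAt (𝓡 n) p x) :=
    (hK.continuousOn.continuousAt ht).prodMk (hK'.continuousOn.continuousAt ht')
  have hs' : s ∈ 𝓝 (f ((extChartAt (𝓡 n) p).symm (extChartAt (𝓡 n) p x)),
      g ((extChartAt (𝓡 n) p).symm (extChartAt (𝓡 n) p x))) := by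
    rwa [(extChartAt (𝓡 n) p).left_inv hp]
  have h2 := (hK.mono inter_subset_left).prodMk (hK'.mono inter_subset_right)
  exact ⟨_, _, inter_mem (inter_mem ht ht') (hc.preimage_mem_nhds hs'),
    hL.comp (h2.mono inter_subset_left) fun z hz ↦ hz.2⟩

theorem ChartLipschitzAt.comp {f : M → ℝ} {x : M} (hf : ChartLipschitzAt n f x)
    {G : ℝ → ℝ} (hG : ContDiffAt ℝ 1 G (f x)) : ChartLipschitzAt n (fun z ↦ G (f z)) x :=
  hf.comp₂ hf (G := fun z ↦ G z.1) (hG.comp (f x, f x) contDiffAt_fst)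

theorem ChartLipschitzAt.mul {f g : M → ℝ} {x : M} (hf : ChartLipschitzAt n f x)
    (hg : ChartLipschitzAt n g x) : ChartLipschitzAt n (fun z ↦ f z * g z) x :=
  hf.comp₂ hg (G := fun z ↦ z.1 * z.2) (contDiffAt_fst.mul contDiffAt_snd)

theorem chartLipschitzAt_of_notMem_tsupport {f : M → ℝ} {x : M} (hx : x ∉ tsupport f) :
    ChartLipschitzAt n f x := by
  have h0 : ChartLipschitzAt n (fun _ : M ↦ (0 : ℝ)) x := fun p _ ↦
    ⟨0, univ, univ_mem, LipschitzWith.const 0 |>.lipschitzOnWith⟩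
  exact h0.congr_of_eventuallyEq (notMem_tsupport_iff_eventuallyEq.1 hx)

end ChartLipschitz

section RiemannianDistance

open Filter Topology Set
open Manifold
open scoped NNReal

variable {n : ℕ} {M : Type*} [EMetricSpace M] [ChartedSpace (EuclideanSpace ℝ (Fin n)) M]
  [IsManifold (𝓡 n) ∞ M] [RiemannianBundle (fun x : M ↦ TangentSpace (𝓡 n) x)]
  [IsContMDiffRiemannianBundle (𝓡 n) ∞ (EuclideanSpace ℝ (Fin n))
    (fun x : M ↦ TangentSpace (𝓡 n) x)]
  [IsRiemannianManifold (𝓡 n) M]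

omit [IsRiemannianManifold (𝓡 n) M] in
/-- The derivative of the inverse of a chart is locally bounded for the Riemannian norm. -/
theorem eventually_metricForm_chartSymmDeriv_le (p : M) {y : EuclideanSpace ℝ (Fin n)}
    (hy : y ∈ (extChartAt (𝓡 n) p).target) :
    ∃ C : ℝ≥0, ∀ᶠ z in 𝓝 y, ∀ v : EuclideanSpace ℝ (Fin n),
      metricForm ((extChartAt (𝓡 n) p).symm z) (chartSymmDeriv p z v) (chartSymmDeriv p z v) ≤
        (C * ‖v‖) ^ 2 := by
  set c : ℝ := ∑ i, ∑ j, (|gramMatrix p y i j| + 1) with hc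
  have hc0 : 0 ≤ c := Finset.sum_nonneg fun i _ ↦ Finset.sum_nonneg fun j _ ↦ by positivity
  refine ⟨(√c).toNNReal, ?_⟩
  have h1 : ∀ i j, ∀ᶠ z in 𝓝 y, |gramMatrix p z i j| < |gramMatrix p y i j| + 1 := fun i j ↦
    (((contDiffOn_gramMatrix p i j).continuousOn.continuousAt
      ((isOpen_extChartAt_target p).mem_nhds hy)).abs).eventually_lt_const (lt_add_one _)
  filter_upwards [eventually_all.2 fun i ↦ eventually_all.2 fun j ↦ h1 i j] with z hz v
  rw [metricForm_sum_sum, mul_pow, Real.coe_toNNReal _ (Real.sqrt_nonneg c), Real.sq_sqrt hc0,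
    hc, Finset.sum_mul]
  refine Finset.sum_le_sum fun i _ ↦ ?_
  rw [Finset.sum_mul]
  refine Finset.sum_le_sum fun j _ ↦ ?_
  rw [← gramMatrix_apply, mul_comm]
  refine (le_abs_self _).trans ?_
  rw [abs_mul, abs_mul]
  have hi := PiLp.norm_apply_le v i
  have hj := PiLp.norm_apply_le v j
  rw [Real.norm_eq_abs] at hi hj
  have := (hz i j).le
  rw [sq]
  gcongr

/-- The inverse of a chart is locally Lipschitz for the Riemannian distance: the image of a segment
on which its derivative is bounded is a short path. -/
theorem exists_lipschitzOnWith_chart_symm (p : M) {y : EuclideanSpace ℝ (Fin n)}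
    (hy : y ∈ (extChartAt (𝓡 n) p).target) :
    ∃ C : ℝ≥0, ∃ t ∈ 𝓝 y, LipschitzOnWith C (extChartAt (𝓡 n) p).symm t := by
  obtain ⟨C, hC⟩ := eventually_metricForm_chartSymmDeriv_le p hy
  obtain ⟨r, hr, hball⟩ := Metric.mem_nhds_iff.1
    (inter_mem ((isOpen_extChartAt_target (I := 𝓡 n) p).mem_nhds hy) hC)
  refine ⟨C, Metric.ball y r, Metric.ball_mem_nhds y hr, fun a ha b hb ↦ ?_⟩
  set e := extChartAt (𝓡 n) p with he
  rw [IsRiemannianManifold.out (I := 𝓡 n) (e.symm a) (e.symm b)]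
  set η : ℝ → EuclideanSpace ℝ (Fin n) := fun t ↦ a + t • (b - a) with hη
  have hηd : ∀ t, HasFDerivAt η (ContinuousLinearMap.toSpanSingleton ℝ (b - a)) t := fun t ↦ by
    have := ((hasDerivAt_id t).smul_const (b - a)).const_add a
    rw [one_smul] at this
    exact this.hasFDerivAt
  have hηs : ContDiff ℝ ∞ η := by fun_prop
  have hmem : ∀ t ∈ Icc (0 : ℝ) 1, η t ∈ Metric.ball y r := fun t ht ↦
    (convex_ball y r).add_smul_sub_mem ha hb ht
  have h0 : η 0 = a := by simp [hη]
  have h1 : η 1 = b := by simp [hη]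
  have hle : riemannianEDist (𝓡 n) (e.symm a) (e.symm b) ≤
      pathELength (𝓡 n) (e.symm ∘ η) 0 1 := by
    refine riemannianEDist_le_pathELength ?_ (by simp [h0]) (by simp [h1]) zero_le_one
    refine ContMDiffOn.comp (t := e.target) ?_ (contMDiff_iff_contDiff.2
      (hηs.of_le (by exact_mod_cast le_top))).contMDiffOn fun t ht ↦ (hball (hmem t ht)).1
    exact (contMDiffOn_extChartAt_symm (n := ∞) p).of_le (by exact_mod_cast le_top)
  refine hle.trans ?_
  rw [pathELength_eq_lintegral_mfderiv_Icc]
  have hpt : ∀ t ∈ Icc (0 : ℝ) 1, ‖mfderiv 𝓘(ℝ, ℝ) (𝓡 n) (e.symm ∘ η) t 1‖ₑ ≤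
      C * edist a b := by
    intro t ht
    have h2 := mfderiv_comp t (mdifferentiableAt_chart_symm p (hball (hmem t ht)).1)
      (hηd t).differentiableAt.mdifferentiableAt
    have h3 : mfderiv 𝓘(ℝ, ℝ) (𝓡 n) η t = fderiv ℝ η t := mfderiv_eq_fderiv
    have h4 : fderiv ℝ η t 1 = b - a := by rw [(hηd t).fderiv]; simp
    have h5 : mfderiv 𝓘(ℝ, ℝ) (𝓡 n) (e.symm ∘ η) t 1 =
        (show TangentSpace (𝓡 n) (e.symm (η t)) from chartSymmDeriv p (η t) (b - a)) := by
      rw [← h4, ← h3]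
      exact congrArg (fun L ↦ L (1 : ℝ)) h2
    have h6 := (hball (hmem t ht)).2 (b - a)
    have h7 : ‖(show TangentSpace (𝓡 n) (e.symm (η t)) from chartSymmDeriv p (η t) (b - a))‖ ≤
        C * ‖b - a‖ := by
      refine abs_le_of_sq_le_sq' ?_ (by positivity) |>.2
      rw [← real_inner_self_eq_norm_sq]
      exact h6
    rw [h5, edist_comm, edist_eq_enorm_sub]
    rw [← ofReal_norm, ← ofReal_norm, ← ENNReal.ofReal_coe_nnreal,
      ← ENNReal.ofReal_mul C.coe_nonneg]
    exact ENNReal.ofReal_le_ofReal h7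
  refine (setLIntegral_mono' measurableSet_Icc hpt).trans ?_
  simp

/-- This is where the distance of `M` has to be the Riemannian one. -/
theorem LipschitzWith.chartLipschitzAt {ρ : M → ℝ} {K : ℝ≥0} (hρ : LipschitzWith K ρ) (x : M) :
    ChartLipschitzAt n ρ x := by
  intro p hp
  obtain ⟨C, t, ht, hC⟩ := exists_lipschitzOnWith_chart_symm p ((extChartAt (𝓡 n) p).map_source hp)
  exact ⟨K * C, t, ht, (hρ.lipschitzOnWith (s := univ)).comp hC (mapsTo_univ _ _)⟩

end RiemannianDistance

/-! ### Calculus of the Riemannian gradient -/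

section Gradient

open Filter Topology Set

variable {n : ℕ} {M : Type*} [TopologicalSpace M] [ChartedSpace (EuclideanSpace ℝ (Fin n)) M]

theorem MDifferentiableAt.comp_hasDerivAt {f : M → ℝ} {x : M} {G : ℝ → ℝ} {G' : ℝ}
    (hf : MDifferentiableAt (𝓡 n) 𝓘(ℝ, ℝ) f x) (hG : HasDerivAt G G' (f x)) :
    MDifferentiableAt (𝓡 n) 𝓘(ℝ, ℝ) (fun z ↦ G (f z)) x :=
  hG.differentiableAt.mdifferentiableAt.comp x hf

variable [RiemannianBundle (fun x : M ↦ TangentSpace (𝓡 n) x)]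

theorem eq_riemannianGradient_of_forall {f : M → ℝ} {x : M} {w : TangentSpace (𝓡 n) x}
    (h : ∀ v, inner ℝ w v = mvfderiv (𝓡 n) f x v) : riemannianGradient (n := n) f x = w := by
  refine ext_inner_right ℝ fun v ↦ ?_
  rw [inner_riemannianGradient, h]

theorem riemannianGradient_congr {f g : M → ℝ} {x : M} (h : f =ᶠ[𝓝 x] g) :
    riemannianGradient (n := n) f x = riemannianGradient (n := n) g x := by
  refine eq_riemannianGradient_of_forall fun v ↦ ?_
  rw [inner_riemannianGradient]
  have h1 := h.mfderiv_eq (I := 𝓡 n) (I' := 𝓘(ℝ, ℝ))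
  exact (congrArg (fun L ↦ L v) h1).symm

theorem riemannianGradient_zero (x : M) : riemannianGradient (n := n) (fun _ : M ↦ (0 : ℝ)) x = 0 :=
  eq_riemannianGradient_of_forall fun v ↦ by
    rw [mvfderiv_const, inner_zero_left]; rfl

theorem riemannianGradient_of_notMem_tsupport {f : M → ℝ} {x : M} (hx : x ∉ tsupport f) :
    riemannianGradient (n := n) f x = 0 := by
  rw [riemannianGradient_congr (g := fun _ ↦ (0 : ℝ)) (notMem_tsupport_iff_eventuallyEq.1 hx),
    riemannianGradient_zero]

theorem riemannianGradient_add {f g : M → ℝ} {x : M}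
    (hf : MDifferentiableAt (𝓡 n) 𝓘(ℝ, ℝ) f x) (hg : MDifferentiableAt (𝓡 n) 𝓘(ℝ, ℝ) g x) :
    riemannianGradient (n := n) (fun z ↦ f z + g z) x =
      riemannianGradient (n := n) f x + riemannianGradient (n := n) g x :=
  eq_riemannianGradient_of_forall fun v ↦ by
    rw [mvfderiv_fun_add hf hg, inner_add_left, inner_riemannianGradient, inner_riemannianGradient]
    rfl

theorem riemannianGradient_sub {f g : M → ℝ} {x : M}
    (hf : MDifferentiableAt (𝓡 n) 𝓘(ℝ, ℝ) f x) (hg : MDifferentiableAt (𝓡 n) 𝓘(ℝ, ℝ) g x) :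
    riemannianGradient (n := n) (fun z ↦ f z - g z) x =
      riemannianGradient (n := n) f x - riemannianGradient (n := n) g x :=
  eq_riemannianGradient_of_forall fun v ↦ by
    rw [mvfderiv_fun_sub hf hg, inner_sub_left, inner_riemannianGradient, inner_riemannianGradient]
    rfl

theorem riemannianGradient_mul {f g : M → ℝ} {x : M}
    (hf : MDifferentiableAt (𝓡 n) 𝓘(ℝ, ℝ) f x) (hg : MDifferentiableAt (𝓡 n) 𝓘(ℝ, ℝ) g x) :
    riemannianGradient (n := n) (fun z ↦ f z * g z) x =
      f x • riemannianGradient (n := n) g x + g x • riemannianGradient (n := n) f x :=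
  eq_riemannianGradient_of_forall fun v ↦ by
    rw [mvfderiv_fun_mul hf hg, inner_add_left, real_inner_smul_left, real_inner_smul_left,
      inner_riemannianGradient, inner_riemannianGradient]
    rfl

theorem riemannianGradient_comp {f : M → ℝ} {x : M} {G : ℝ → ℝ} {G' : ℝ}
    (hf : MDifferentiableAt (𝓡 n) 𝓘(ℝ, ℝ) f x) (hG : HasDerivAt G G' (f x)) :
    riemannianGradient (n := n) (fun z ↦ G (f z)) x = G' • riemannianGradient (n := n) f x :=
  eq_riemannianGradient_of_forall fun v ↦ by
    have h1 := mfderiv_comp x hG.differentiableAt.mdifferentiableAt hf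
    have h2 : mvfderiv (𝓡 n) (fun z ↦ G (f z)) x v =
        fderiv ℝ G (f x) (mvfderiv (𝓡 n) f x v) := by
      have h3 : mfderiv 𝓘(ℝ, ℝ) 𝓘(ℝ, ℝ) G (f x) = fderiv ℝ G (f x) := mfderiv_eq_fderiv
      rw [← h3]
      exact congrArg (fun L ↦ L v) h1
    rw [h2, real_inner_smul_left, inner_riemannianGradient, hG.hasFDerivAt.fderiv]
    simp [mul_comm]

/-- The inner product of the gradients of two `C¹` functions is continuous. -/
theorem continuousOn_inner_riemannianGradient [IsManifold (𝓡 n) ∞ M]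
    [IsContMDiffRiemannianBundle (𝓡 n) ∞ (EuclideanSpace ℝ (Fin n))
      (fun x : M ↦ TangentSpace (𝓡 n) x)] {f h : M → ℝ} {U : Set M} (hU : IsOpen U)
    (hf : ContMDiffOn (𝓡 n) 𝓘(ℝ, ℝ) 1 f U) (hh : ContMDiffOn (𝓡 n) 𝓘(ℝ, ℝ) 1 h U) :
    ContinuousOn (fun x ↦ inner ℝ (riemannianGradient (n := n) f x)
      (riemannianGradient (n := n) h x)) U := by
  intro x hx
  refine ContinuousAt.continuousWithinAt ?_
  set e := extChartAt (𝓡 n) x with he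
  set V := e.target ∩ e.symm ⁻¹' U with hV
  have hVo : IsOpen V :=
    (continuousOn_extChartAt_symm x).isOpen_inter_preimage (isOpen_extChartAt_target x) hU
  have hxV : e x ∈ V := ⟨mem_extChartAt_target x, by
    rw [mem_preimage, e.left_inv (mem_extChartAt_source x)]; exact hx⟩
  have hC1 : ∀ f : M → ℝ, ContMDiffOn (𝓡 n) 𝓘(ℝ, ℝ) 1 f U → ∀ v,
      ContinuousAt (fun y ↦ fderiv ℝ (f ∘ e.symm) y v) (e x) := by
    intro f hf v
    have h1 : ContMDiffOn (𝓡 n) 𝓘(ℝ, ℝ) 1 (f ∘ e.symm) V :=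
      hf.comp (((contMDiffOn_extChartAt_symm (n := ∞) x).of_le (by exact_mod_cast le_top)).mono
        inter_subset_left) fun y hy ↦ hy.2
    exact ((contMDiffOn_iff_contDiffOn.1 h1).continuousOn_fderiv_of_isOpen hVo le_rfl
      |>.continuousAt (hVo.mem_nhds hxV)).clm_apply continuousAt_const
  have h2 : ContinuousAt (fun y ↦ ∑ i, fderiv ℝ (f ∘ e.symm) y (EuclideanSpace.single i 1) *
        ∑ j, (gramMatrix x y)⁻¹ i j *
          fderiv ℝ (h ∘ e.symm) y (EuclideanSpace.single j 1)) (e x) := by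
    refine tendsto_finsetSum _ fun i _ ↦ (hC1 f hf _).mul (tendsto_finsetSum _ fun j _ ↦
      ((contDiffOn_gramMatrix_inv x i j).continuousOn.continuousAt
        ((isOpen_extChartAt_target x).mem_nhds hxV.1)).mul (hC1 h hh _))
  have h3 := h2.comp (continuousAt_extChartAt (I := 𝓡 n) x)
  refine h3.congr ?_
  filter_upwards [extChartAt_source_mem_nhds (I := 𝓡 n) x] with z hz
  have := inner_riemannianGradient_eq_sum x (e.map_source hz) f h
  rw [e.left_inv hz] at this
  exact this.symm

end Gradient

/-! ### Smooth approximation of Lipschitz functions with compact support -/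

section LipschitzExtension

open Filter Topology Set
open scoped NNReal

/-- A locally Lipschitz function is Lipschitz on a ball larger than its support, and between the
support and the complement of that ball its increments are bounded by its supremum. -/
theorem LocallyLipschitz.exists_lipschitzWith_of_hasCompactSupport {E : Type*}
    [NormedAddCommGroup E] [NormedSpace ℝ E] [FiniteDimensional ℝ E] {h : E → ℝ}
    (hh : LocallyLipschitz h) (hc : HasCompactSupport h) : ∃ K, LipschitzWith K h := by
  have : ProperSpace E := FiniteDimensional.proper ℝ E
  obtain ⟨C, hC⟩ := hc.exists_bound_of_continuous hh.continuous
  obtain ⟨r, hr⟩ := hc.isCompact.isBounded.subset_closedBall (0 : E)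
  obtain ⟨K, hK⟩ := (hh.locallyLipschitzOn
    (s := Metric.closedBall (0 : E) (r + 1))).exists_lipschitzOnWith_of_compact
      (isCompact_closedBall _ _)
  have hz : ∀ x, x ∉ Metric.closedBall (0 : E) r → h x = 0 := fun x hx ↦
    image_eq_zero_of_notMem_tsupport fun h' ↦ hx (hr h')
  have hC0 : 0 ≤ C := (norm_nonneg _).trans (hC 0)
  refine ⟨K + C.toNNReal, LipschitzWith.of_dist_le_mul fun x y ↦ ?_⟩
  rw [NNReal.coe_add, Real.coe_toNNReal _ hC0, add_mul]
  -- `z` lies in the support and `w` outside the larger ball: their distance is at least `1`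
  have key : ∀ z w : E, z ∈ Metric.closedBall (0 : E) r → w ∉ Metric.closedBall (0 : E) (r + 1) →
      |h z| ≤ C * dist z w := by
    intro z w hz hw
    have h1 : 1 ≤ dist z w := by
      simp only [Metric.mem_closedBall, not_le] at hz hw
      have := dist_triangle w z 0
      rw [dist_comm w z] at this
      linarith
    exact (hC z).trans (le_mul_of_one_le_right hC0 h1)
  have hKn : 0 ≤ (K : ℝ) * dist x y := by positivity
  have hCn : 0 ≤ C * dist x y := by positivity
  have hsub : Metric.closedBall (0 : E) r ⊆ Metric.closedBall (0 : E) (r + 1) :=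
    Metric.closedBall_subset_closedBall (by linarith)
  by_cases hx : x ∈ Metric.closedBall (0 : E) (r + 1) <;>
    by_cases hy : y ∈ Metric.closedBall (0 : E) (r + 1)
  · have := hK.dist_le_mul x hx y hy
    linarith
  · rw [hz y fun h ↦ hy (hsub h), dist_zero_right, Real.norm_eq_abs]
    by_cases hx' : x ∈ Metric.closedBall (0 : E) r
    · linarith [key x y hx' hy]
    · rw [hz x hx', abs_zero]; linarith
  · rw [hz x fun h ↦ hx (hsub h), dist_zero_left, Real.norm_eq_abs]
    by_cases hy' : y ∈ Metric.closedBall (0 : E) r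
    · have := key y x hy' hx
      rw [dist_comm] at this
      linarith
    · rw [hz y hy', abs_zero]; linarith
  · rw [hz x fun h ↦ hx (hsub h), hz y fun h ↦ hy (hsub h), dist_self]; linarith

end LipschitzExtension

section Approximation

open Filter Topology Set
open scoped NNReal

variable {n : ℕ} {M : Type*} [TopologicalSpace M] [T2Space M]
  [ChartedSpace (EuclideanSpace ℝ (Fin n)) M] [IsManifold (𝓡 n) ∞ M]

variable (n) in
/-- A function with compact support is a finite sum of functions supported in chart domains. -/
theorem exists_finset_chart_decomposition [SecondCountableTopology M] {f : M → ℝ}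
    (hc : HasCompactSupport f) :
    ∃ (t : Finset M) (χ : M → M → ℝ), (∀ p, ContMDiff (𝓡 n) 𝓘(ℝ, ℝ) ∞ (χ p)) ∧
      (∀ p, tsupport (χ p) ⊆ (extChartAt (𝓡 n) p).source) ∧
      ∀ x, f x = ∑ p ∈ t, χ p x * f x := by
  have : LocallyCompactSpace M := ChartedSpace.locallyCompactSpace (EuclideanSpace ℝ (Fin n)) M
  obtain ⟨χ, hχ⟩ := SmoothPartitionOfUnity.exists_isSubordinate_chartAt_source (𝓡 n) M
  have hfin := χ.locallyFinite.finite_nonempty_inter_compact hc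
  refine ⟨hfin.toFinset, fun p ↦ χ p, fun p ↦ (χ p).contMDiff, fun p ↦ by
    simpa using hχ p, fun x ↦ ?_⟩
  by_cases hx : x ∈ tsupport f
  · rw [← Finset.sum_mul]
    have h1 := χ.sum_eq_one (mem_univ x)
    rw [finsum_eq_sum_of_support_subset (s := hfin.toFinset)] at h1
    · rw [h1, one_mul]
    · intro p hp
      simp only [Finite.coe_toFinset, mem_ofPred_eq]
      exact ⟨x, hp, hx⟩
  · simp [image_eq_zero_of_notMem_tsupport hx]

variable [RiemannianBundle (fun x : M ↦ TangentSpace (𝓡 n) x)]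
  [MeasurableSpace M]

variable (n) in
/-- The smooth functions `F j` converge to `f` pointwise and with their gradients almost everywhere,
are bounded by `C` together with their gradients, and vanish outside the compact set `Q`. -/
structure IsSmoothApprox (f : M → ℝ) (F : ℕ → M → ℝ) (Q : Set M) (C : ℝ) : Prop where
  isCompact : IsCompact Q
  contMDiff : ∀ j, ContMDiff (𝓡 n) 𝓘(ℝ, ℝ) ∞ (F j)
  tsupport_subset : ∀ j, tsupport (F j) ⊆ Q
  abs_le : ∀ j x, |F j x| ≤ C
  norm_gradient_le : ∀ j x, ‖riemannianGradient (n := n) (F j) x‖ ≤ C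
  tendsto : ∀ x, Tendsto (fun j ↦ F j x) atTop (𝓝 (f x))
  ae_tendsto_gradient : ∀ᵐ x ∂(riemannianVolume n M), MDifferentiableAt (𝓡 n) 𝓘(ℝ, ℝ) f x ∧
    Tendsto (fun j ↦ riemannianGradient (n := n) (F j) x) atTop
      (𝓝 (riemannianGradient (n := n) f x))

omit [IsManifold (𝓡 n) ∞ M] [T2Space M] in
theorem IsSmoothApprox.add {f g : M → ℝ} {F G : ℕ → M → ℝ} {Q Q' : Set M} {C C' : ℝ}
    (hf : IsSmoothApprox n f F Q C) (hg : IsSmoothApprox n g G Q' C') :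
    IsSmoothApprox n (fun x ↦ f x + g x) (fun j x ↦ F j x + G j x) (Q ∪ Q') (C + C') where
  isCompact := hf.isCompact.union hg.isCompact
  contMDiff j := (hf.contMDiff j).add (hg.contMDiff j)
  tsupport_subset j := (tsupport_add _ _).trans
    (union_subset_union (hf.tsupport_subset j) (hg.tsupport_subset j))
  abs_le j x := (abs_add_le _ _).trans (add_le_add (hf.abs_le j x) (hg.abs_le j x))
  norm_gradient_le j x := by
    rw [riemannianGradient_add ((hf.contMDiff j).mdifferentiable (by simp) x)
      ((hg.contMDiff j).mdifferentiable (by simp) x)]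
    exact (norm_add_le _ _).trans (add_le_add (hf.norm_gradient_le j x) (hg.norm_gradient_le j x))
  tendsto x := (hf.tendsto x).add (hg.tendsto x)
  ae_tendsto_gradient := by
    filter_upwards [hf.ae_tendsto_gradient, hg.ae_tendsto_gradient] with x h1 h2
    refine ⟨h1.1.add h2.1, ?_⟩
    rw [riemannianGradient_add h1.1 h2.1]
    refine (h1.2.add h2.2).congr fun j ↦ ?_
    rw [riemannianGradient_add ((hf.contMDiff j).mdifferentiable (by simp) x)
      ((hg.contMDiff j).mdifferentiable (by simp) x)]

omit [IsManifold (𝓡 n) ∞ M] [T2Space M] in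
theorem IsSmoothApprox.zero :
    IsSmoothApprox n (fun _ : M ↦ (0 : ℝ)) (fun _ _ ↦ 0) ∅ 0 where
  isCompact := isCompact_empty
  contMDiff _ := contMDiff_const
  tsupport_subset _ := by simp [tsupport]
  abs_le _ _ := by simp
  norm_gradient_le _ x := by rw [riemannianGradient_zero]; simp
  tendsto _ := tendsto_const_nhds
  ae_tendsto_gradient := Eventually.of_forall fun _ ↦ ⟨mdifferentiableAt_const, tendsto_const_nhds⟩

variable [BorelSpace M] [SecondCountableTopology M]
  [IsContMDiffRiemannianBundle (𝓡 n) ∞ (EuclideanSpace ℝ (Fin n))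
    (fun x : M ↦ TangentSpace (𝓡 n) x)]

omit [T2Space M] [MeasurableSpace M] [BorelSpace M] [SecondCountableTopology M] in
/-- On a compact subset of a chart, the Riemannian norm of a gradient is controlled by the
Euclidean norm of the derivative in the chart. -/
theorem exists_norm_riemannianGradient_le (p : M) {Q : Set (EuclideanSpace ℝ (Fin n))}
    (hQ : IsCompact Q) (hQT : Q ⊆ (extChartAt (𝓡 n) p).target) :
    ∃ C : ℝ, 0 ≤ C ∧ ∀ (f : M → ℝ), ∀ y ∈ Q,
      ‖riemannianGradient (n := n) f ((extChartAt (𝓡 n) p).symm y)‖ ≤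
        C * ‖fderiv ℝ (f ∘ (extChartAt (𝓡 n) p).symm) y‖ := by
  have h1 : ∀ i j, ∃ c, ∀ y ∈ Q, ‖(gramMatrix p y)⁻¹ i j‖ ≤ c := fun i j ↦
    hQ.exists_bound_of_continuousOn ((contDiffOn_gramMatrix_inv p i j).continuousOn.mono hQT)
  choose c hc using h1
  set c' : ℝ := ∑ i, ∑ j, |c i j| with hc'
  have hc0 : 0 ≤ c' := Finset.sum_nonneg fun i _ ↦ Finset.sum_nonneg fun j _ ↦ abs_nonneg _
  refine ⟨√c', Real.sqrt_nonneg _, fun f y hy ↦ ?_⟩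
  refine (abs_le_of_sq_le_sq' ?_ (by positivity)).2
  rw [← real_inner_self_eq_norm_sq, inner_riemannianGradient_eq_sum p (hQT hy), mul_pow,
    Real.sq_sqrt hc0, hc', Finset.sum_mul]
  refine Finset.sum_le_sum fun i _ ↦ ?_
  rw [Finset.mul_sum, Finset.sum_mul]
  refine Finset.sum_le_sum fun j _ ↦ ?_
  have hd : ∀ i, |fderiv ℝ (f ∘ (extChartAt (𝓡 n) p).symm) y (EuclideanSpace.single i 1)| ≤
      ‖fderiv ℝ (f ∘ (extChartAt (𝓡 n) p).symm) y‖ := fun i ↦ by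
    have := (fderiv ℝ (f ∘ (extChartAt (𝓡 n) p).symm) y).le_opNorm
      (EuclideanSpace.single i (1 : ℝ))
    simpa using this
  have hcc : |(gramMatrix p y)⁻¹ i j| ≤ |c i j| := (hc i j y hy).trans (le_abs_self _)
  refine (le_abs_self _).trans ?_
  rw [abs_mul, abs_mul]
  calc _ ≤ ‖fderiv ℝ (f ∘ (extChartAt (𝓡 n) p).symm) y‖ *
        (|c i j| * ‖fderiv ℝ (f ∘ (extChartAt (𝓡 n) p).symm) y‖) := by
        gcongr <;> apply hd
    _ = _ := by ring

/-- The case of a function supported in the domain of a chart, by mollification in the chart. -/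
theorem exists_isSmoothApprox_of_tsupport_subset_source (p : M) {f : M → ℝ}
    (hf : ∀ x, ChartLipschitzAt n f x) (hc : HasCompactSupport f)
    (hfp : tsupport f ⊆ (extChartAt (𝓡 n) p).source) {W : Set M} (hW : IsOpen W)
    (hfW : tsupport f ⊆ W) : ∃ F Q C, Q ⊆ W ∧ IsSmoothApprox n f F Q C := by
  classical
  set e := extChartAt (𝓡 n) p with he
  have hTo : IsOpen e.target := isOpen_extChartAt_target p
  have hSo : IsOpen e.source := isOpen_extChartAt_source p
  set h : EuclideanSpace ℝ (Fin n) → ℝ := e.target.indicator (f ∘ e.symm) with hh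
  have hhT : ∀ y ∈ e.target, h y = f (e.symm y) := fun y hy ↦ indicator_of_mem hy _
  have hK0 : IsCompact (e '' tsupport f) :=
    hc.isCompact.image_of_continuousOn ((continuousOn_extChartAt p).mono hfp)
  have hK0T : e '' tsupport f ⊆ e.target := by
    rintro _ ⟨x, hx, rfl⟩; exact e.map_source (hfp hx)
  have hhs : tsupport h ⊆ e '' tsupport f := by
    refine closure_minimal (fun y hy ↦ ?_) hK0.isClosed
    have hyT : y ∈ e.target := by
      by_contra hyT; exact hy (indicator_of_notMem hyT _)
    refine ⟨e.symm y, subset_tsupport _ ?_, e.right_inv hyT⟩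
    rw [Function.mem_support, hhT y hyT] at hy
    exact hy
  have hhc : HasCompactSupport h := hK0.of_isClosed_subset (isClosed_tsupport _) hhs
  have hev : ∀ y ∈ e.target, h =ᶠ[𝓝 y] f ∘ e.symm := fun y hy ↦ by
    filter_upwards [hTo.mem_nhds hy] with z hz using hhT z hz
  have hhL : LocallyLipschitz h := by
    intro y
    by_cases hy : y ∈ e.target
    · obtain ⟨K, t, ht, hK⟩ := hf (e.symm y) p (e.map_target hy)
      rw [e.right_inv hy] at ht
      refine ⟨K, _, inter_mem ht (hTo.mem_nhds hy), fun a ha b hb ↦ ?_⟩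
      rw [hhT a ha.2, hhT b hb.2]
      exact hK ha.1 hb.1
    · have hy' : y ∉ tsupport h := fun h' ↦ hy (hK0T (hhs h'))
      refine ⟨0, _, (isClosed_tsupport h).isOpen_compl.mem_nhds hy', fun a ha b hb ↦ ?_⟩
      rw [image_eq_zero_of_notMem_tsupport ha, image_eq_zero_of_notMem_tsupport hb]
      simp
  obtain ⟨K, hK⟩ := hhL.exists_lipschitzWith_of_hasCompactSupport hhc
  have hVo : IsOpen (e.target ∩ e.symm ⁻¹' W) :=
    (continuousOn_extChartAt_symm p).isOpen_inter_preimage hTo hW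
  obtain ⟨Q, H, C, hQ, hQV, hHs, hHQ, hHL, hHC, hHt, hHae⟩ := hK.exists_contDiff_approx hhc hVo (by
    intro y hy
    obtain ⟨x, hx, rfl⟩ := hhs hy
    refine ⟨e.map_source (hfp hx), ?_⟩
    rw [mem_preimage, e.left_inv (hfp hx)]
    exact hfW hx)
  have hQT : Q ⊆ e.target := fun y hy ↦ (hQV hy).1
  set F : ℕ → M → ℝ := fun j ↦ e.source.indicator (H j ∘ e) with hF
  have hFS : ∀ j, ∀ x ∈ e.source, F j x = H j (e x) := fun j x hx ↦ indicator_of_mem hx _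
  have hQc : IsCompact (e.symm '' Q) :=
    hQ.image_of_continuousOn ((continuousOn_extChartAt_symm p).mono hQT)
  have hFs : ∀ j, tsupport (F j) ⊆ e.symm '' Q := by
    intro j
    refine closure_minimal (fun x hx ↦ ?_) hQc.isClosed
    have hxS : x ∈ e.source := by
      by_contra hxS; exact hx (indicator_of_notMem hxS _)
    rw [Function.mem_support, hFS j x hxS] at hx
    exact ⟨e x, hHQ j (subset_tsupport _ hx), e.left_inv hxS⟩
  have hQS : e.symm '' Q ⊆ e.source := by
    rintro _ ⟨y, hy, rfl⟩; exact e.map_target (hQT hy)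
  have hFe : ∀ j, ∀ y ∈ e.target, F j ∘ e.symm =ᶠ[𝓝 y] H j := fun j y hy ↦ by
    filter_upwards [hTo.mem_nhds hy] with z hz
    rw [Function.comp, hFS j _ (e.map_target hz), e.right_inv hz]
  have hFm : ∀ j, ContMDiff (𝓡 n) 𝓘(ℝ, ℝ) ∞ (F j) := by
    intro j x
    by_cases hx : x ∈ e.source
    · have h1 : ContMDiffAt (𝓡 n) 𝓘(ℝ, ℝ) ∞ (H j ∘ e) x :=
        (hHs j).contMDiff.contMDiffAt.comp x ((contMDiffOn_extChartAt (n := ∞)).contMDiffAt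
          ((chartAt _ p).open_source.mem_nhds (by simpa [he] using hx)))
      refine h1.congr_of_eventuallyEq ?_
      filter_upwards [hSo.mem_nhds hx] with z hz using hFS j z hz
    · have hx' : x ∉ tsupport (F j) := fun h' ↦ hx (hQS (hFs j h'))
      exact contMDiffAt_const.congr_of_eventuallyEq (notMem_tsupport_iff_eventuallyEq.1 hx')
  obtain ⟨c, hc0, hcb⟩ := exists_norm_riemannianGradient_le p hQ hQT
  have hC0 : 0 ≤ C := (abs_nonneg _).trans (hHC 0 0)
  refine ⟨F, e.symm '' Q, C + c * K, by rintro _ ⟨y, hy, rfl⟩; exact (hQV hy).2, hQc, hFm, hFs,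
    fun j x ↦ ?_, fun j x ↦ ?_, fun x ↦ ?_, ?_⟩
  · have h1 : |F j x| ≤ C := by
      by_cases hx : x ∈ e.source
      · rw [hFS j x hx]; exact hHC j _
      · simp only [hF]; rw [indicator_of_notMem hx]; simpa using hC0
    have : 0 ≤ c * (K : ℝ) := by positivity
    linarith
  · by_cases hx : x ∈ e.symm '' Q
    · obtain ⟨y, hy, rfl⟩ := hx
      have h1 := hcb (F j) y hy
      rw [(hFe j y (hQT hy)).fderiv_eq] at h1
      have h2 : ‖fderiv ℝ (H j) y‖ ≤ K := norm_fderiv_le_of_lipschitz ℝ (hHL j)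
      have h3 := mul_le_mul_of_nonneg_left h2 hc0
      linarith
    · rw [riemannianGradient_of_notMem_tsupport fun h' ↦ hx (hFs j h'), norm_zero]
      positivity
  · by_cases hx : x ∈ e.source
    · simp_rw [hFS _ x hx]
      have := hHt (e x)
      rwa [hhT _ (e.map_source hx), e.left_inv hx] at this
    · have h1 : f x = 0 := image_eq_zero_of_notMem_tsupport fun h' ↦ hx (hfp h')
      rw [h1]
      refine tendsto_const_nhds.congr fun j ↦ ?_
      simp only [hF]; rw [indicator_of_notMem hx]
  · have hae : ∀ᵐ x ∂(riemannianVolume n M), x ∈ e.source →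
        MDifferentiableAt (𝓡 n) 𝓘(ℝ, ℝ) f x ∧
        Tendsto (fun j ↦ riemannianGradient (n := n) (F j) x) atTop
          (𝓝 (riemannianGradient (n := n) f x)) := by
      refine ae_mem_chart_source_of_ae p ?_
      filter_upwards [hHae] with y hy hyT
      have hd : MDifferentiableAt (𝓡 n) 𝓘(ℝ, ℝ) f (e.symm y) :=
        (mdifferentiableAt_iff_differentiableAt_chart p hyT f).2
          (hy.1.congr_of_eventuallyEq (hev y hyT).symm)
      refine ⟨hd, ?_⟩
      rw [tendsto_iff_norm_sub_tendsto_zero]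
      have hdF : ∀ j, MDifferentiableAt (𝓡 n) 𝓘(ℝ, ℝ) (F j) (e.symm y) := fun j ↦
        (hFm j).mdifferentiable (by simp) _
      have hdiff : ∀ j v, fderiv ℝ ((fun x ↦ F j x - f x) ∘ e.symm) y v =
          fderiv ℝ (H j) y v - fderiv ℝ h y v := by
        intro j v
        have h1 : (fun x ↦ F j x - f x) ∘ e.symm =ᶠ[𝓝 y] fun z ↦ H j z - h z := by
          filter_upwards [hFe j y hyT, hev y hyT] with z hz1 hz2
          simp only [Function.comp] at hz1 hz2 ⊢
          rw [hz1, hz2]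
        rw [h1.fderiv_eq, fderiv_fun_sub ((hHs j).differentiable (by simp) y) hy.1]
        rfl
      have hlim : ∀ v, Tendsto (fun j ↦ fderiv ℝ ((fun x ↦ F j x - f x) ∘ e.symm) y v) atTop
          (𝓝 0) := fun v ↦ by
        simp_rw [hdiff]
        exact tendsto_sub_nhds_zero_iff.2 (hy.2 v)
      have hsq : Tendsto (fun j ↦ ‖riemannianGradient (n := n) (F j) (e.symm y) -
          riemannianGradient (n := n) f (e.symm y)‖ ^ 2) atTop (𝓝 0) := by
        have hexp : ∀ j, ‖riemannianGradient (n := n) (F j) (e.symm y) -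
            riemannianGradient (n := n) f (e.symm y)‖ ^ 2 =
            ∑ i, fderiv ℝ ((fun x ↦ F j x - f x) ∘ e.symm) y (EuclideanSpace.single i 1) *
              ∑ k, (gramMatrix p y)⁻¹ i k *
                fderiv ℝ ((fun x ↦ F j x - f x) ∘ e.symm) y (EuclideanSpace.single k 1) := by
          intro j
          rw [← riemannianGradient_sub (hdF j) hd, ← real_inner_self_eq_norm_sq]
          exact inner_riemannianGradient_eq_sum p hyT _ _
        simp_rw [hexp]
        rw [show (0 : ℝ) = ∑ i : Fin n, 0 * ∑ j : Fin n, (gramMatrix p y)⁻¹ i j * 0 by simp]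
        exact tendsto_finsetSum _ fun i _ ↦ (hlim _).mul (tendsto_finsetSum _ fun j _ ↦
          tendsto_const_nhds.mul (hlim _))
      have := hsq.sqrt
      simp_rw [Real.sqrt_sq (norm_nonneg _), Real.sqrt_zero] at this
      exact this
    filter_upwards [hae] with x hx
    by_cases hxS : x ∈ e.source
    · exact hx hxS
    · have hxf : x ∉ tsupport f := fun h' ↦ hxS (hfp h')
      refine ⟨mdifferentiableAt_const.congr_of_eventuallyEq
        (notMem_tsupport_iff_eventuallyEq.1 hxf), ?_⟩
      rw [riemannianGradient_of_notMem_tsupport hxf]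
      refine tendsto_const_nhds.congr fun j ↦ ?_
      rw [riemannianGradient_of_notMem_tsupport fun h' ↦ hxS (hQS (hFs j h'))]

/-- A function which is Lipschitz in charts and has compact support in an open set is approximated
by smooth functions with supports in a common compact subset. -/
theorem exists_isSmoothApprox {f : M → ℝ}
    (hf : ∀ x, ChartLipschitzAt n f x) (hc : HasCompactSupport f) {W : Set M} (hW : IsOpen W)
    (hfW : tsupport f ⊆ W) : ∃ F Q C, Q ⊆ W ∧ IsSmoothApprox n f F Q C := by
  obtain ⟨t, χ, hχs, hχt, hsum⟩ := exists_finset_chart_decomposition n hc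
  have h1 : ∀ p, ∃ F Q C, Q ⊆ W ∧ IsSmoothApprox n (fun x ↦ χ p x * f x) F Q C := fun p ↦
    exists_isSmoothApprox_of_tsupport_subset_source p
      (fun x ↦ ((hχs p x).of_le (by exact_mod_cast le_top)).chartLipschitzAt.mul (hf x)) hc.mul_left
      ((tsupport_mul_subset_left).trans (hχt p)) hW ((tsupport_mul_subset_right).trans hfW)
  have h2 : ∀ t : Finset M, ∃ F Q C, Q ⊆ W ∧
      IsSmoothApprox n (fun x ↦ ∑ p ∈ t, χ p x * f x) F Q C := by
    classical
    intro t
    induction t using Finset.induction_on with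
    | empty => exact ⟨_, _, _, empty_subset _, by simpa using IsSmoothApprox.zero⟩
    | insert p t hp ih =>
      obtain ⟨F, Q, C, hQ, hF⟩ := h1 p
      obtain ⟨F', Q', C', hQ', hF'⟩ := ih
      simp_rw [Finset.sum_insert hp]
      exact ⟨_, _, _, union_subset hQ hQ', hF.add hF'⟩
  have h3 : f = fun x ↦ ∑ p ∈ t, χ p x * f x := funext hsum
  rw [h3]
  exact h2 t

end Approximation

/-! ### Green's formula for the Laplace--Beltrami operator -/

section Green

open Filter Topology Set

variable {n : ℕ} {M : Type*} [TopologicalSpace M]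
  [ChartedSpace (EuclideanSpace ℝ (Fin n)) M]
  [RiemannianBundle (fun x : M ↦ TangentSpace (𝓡 n) x)]

/-- The component `√g gⁱʲ ∂ⱼu` of the gradient density in the chart centred at `p`. -/
noncomputable def chartFlux (p : M) (u : M → ℝ) (i : Fin n) (y : EuclideanSpace ℝ (Fin n)) : ℝ :=
  volumeDensity p y * ∑ j : Fin n, (gramMatrix p y)⁻¹ i j *
    fderiv ℝ (u ∘ (extChartAt (𝓡 n) p).symm) y (EuclideanSpace.single j 1)

/-- The Laplace--Beltrami operator computed in the chart centred at `p`, at the point with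
coordinates `y`. -/
noncomputable def chartLaplacian (p : M) (u : M → ℝ) (y : EuclideanSpace ℝ (Fin n)) : ℝ :=
  (volumeDensity p y)⁻¹ * ∑ i : Fin n, fderiv ℝ (chartFlux p u i) y (EuclideanSpace.single i 1)

theorem laplaceBeltrami_eq_chartLaplacian (u : M → ℝ) (x : M) :
    laplaceBeltrami (n := n) u x = chartLaplacian x u (extChartAt (𝓡 n) x x) := rfl

variable [IsManifold (𝓡 n) ∞ M] [IsContMDiffRiemannianBundle (𝓡 n) ∞ (EuclideanSpace ℝ (Fin n))
  (fun x : M ↦ TangentSpace (𝓡 n) x)]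

theorem contDiffOn_chartFlux (p : M) {u : M → ℝ} {U : Set M} (hU : IsOpen U)
    (hu : ContMDiffOn (𝓡 n) 𝓘(ℝ, ℝ) 2 u U) (i : Fin n) :
    ContDiffOn ℝ 1 (chartFlux p u i)
      ((extChartAt (𝓡 n) p).target ∩ (extChartAt (𝓡 n) p).symm ⁻¹' U) := by
  have hVo : IsOpen ((extChartAt (𝓡 n) p).target ∩ (extChartAt (𝓡 n) p).symm ⁻¹' U) :=
    (continuousOn_extChartAt_symm p).isOpen_inter_preimage (isOpen_extChartAt_target p) hU
  have h1 : ContMDiffOn (𝓡 n) 𝓘(ℝ, ℝ) 2 (u ∘ (extChartAt (𝓡 n) p).symm)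
      ((extChartAt (𝓡 n) p).target ∩ (extChartAt (𝓡 n) p).symm ⁻¹' U) :=
    hu.comp (((contMDiffOn_extChartAt_symm (n := ∞) p).of_le
      ENat.LEInfty.out).mono inter_subset_left) fun y hy ↦ hy.2
  have h2 := (contMDiffOn_iff_contDiffOn.1 h1).fderiv_of_isOpen hVo (m := 1)
    (by norm_num)
  refine (((contDiffOn_volumeDensity p).of_le (by exact_mod_cast le_top)).mono
    inter_subset_left).mul (ContDiffOn.sum fun j _ ↦ ?_)
  exact (((contDiffOn_gramMatrix_inv p i j).of_le (by exact_mod_cast le_top)).mono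
    inter_subset_left).mul (h2.clm_apply contDiffOn_const)

theorem continuousOn_chartLaplacian (p : M) {u : M → ℝ} {U : Set M} (hU : IsOpen U)
    (hu : ContMDiffOn (𝓡 n) 𝓘(ℝ, ℝ) 2 u U) :
    ContinuousOn (fun x ↦ chartLaplacian p u (extChartAt (𝓡 n) p x))
      ((extChartAt (𝓡 n) p).source ∩ U) := by
  have hVo : IsOpen ((extChartAt (𝓡 n) p).target ∩ (extChartAt (𝓡 n) p).symm ⁻¹' U) :=
    (continuousOn_extChartAt_symm p).isOpen_inter_preimage (isOpen_extChartAt_target p) hU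
  have h1 : ContinuousOn (chartLaplacian p u)
      ((extChartAt (𝓡 n) p).target ∩ (extChartAt (𝓡 n) p).symm ⁻¹' U) := by
    refine (((contDiffOn_volumeDensity p).continuousOn.mono inter_subset_left).inv₀
      fun y hy ↦ (volumeDensity_pos p hy.1).ne').mul (continuousOn_finsetSum _ fun i _ ↦ ?_)
    exact ((contDiffOn_chartFlux p hU hu i).continuousOn_fderiv_of_isOpen hVo le_rfl).clm_apply
      continuousOn_const
  refine h1.comp ((continuousOn_extChartAt p).mono inter_subset_left) fun x hx ↦ ?_
  refine ⟨(extChartAt (𝓡 n) p).map_source hx.1, ?_⟩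
  rw [mem_preimage, (extChartAt (𝓡 n) p).left_inv hx.1]
  exact hx.2

variable [MeasurableSpace M] [BorelSpace M] [SecondCountableTopology M]

/-- Green's formula for a test function supported in a chart, by integration by parts in the
chart. -/
theorem integral_inner_gradient_eq_neg_chartLaplacian (p : M) {u ψ : M → ℝ} {U : Set M}
    (hU : IsOpen U) (hu : ContMDiffOn (𝓡 n) 𝓘(ℝ, ℝ) 2 u U)
    (hψ : ContMDiff (𝓡 n) 𝓘(ℝ, ℝ) ∞ ψ) (hc : HasCompactSupport ψ)
    (hs : tsupport ψ ⊆ (extChartAt (𝓡 n) p).source ∩ U) :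
    ∫ x, inner ℝ (riemannianGradient (n := n) ψ x) (riemannianGradient (n := n) u x)
        ∂(riemannianVolume n M) =
      -∫ x, ψ x * chartLaplacian p u (extChartAt (𝓡 n) p x) ∂(riemannianVolume n M) := by
  set e := extChartAt (𝓡 n) p with he
  set V := e.target ∩ e.symm ⁻¹' U with hV
  have hTo : IsOpen e.target := isOpen_extChartAt_target p
  have hVo : IsOpen V := (continuousOn_extChartAt_symm p).isOpen_inter_preimage hTo hU
  have hSU : IsOpen (e.source ∩ U) := (isOpen_extChartAt_source p).inter hU
  set h : EuclideanSpace ℝ (Fin n) → ℝ := e.target.indicator (ψ ∘ e.symm) with hh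
  have hhT : ∀ y ∈ e.target, h y = ψ (e.symm y) := fun y hy ↦ indicator_of_mem hy _
  have hK0 : IsCompact (e '' tsupport ψ) :=
    hc.isCompact.image_of_continuousOn ((continuousOn_extChartAt p).mono fun x hx ↦ (hs hx).1)
  have hK0V : e '' tsupport ψ ⊆ V := by
    rintro _ ⟨x, hx, rfl⟩
    refine ⟨e.map_source (hs hx).1, ?_⟩
    rw [mem_preimage, e.left_inv (hs hx).1]
    exact (hs hx).2
  have hhs : tsupport h ⊆ e '' tsupport ψ := by
    refine closure_minimal (fun y hy ↦ ?_) hK0.isClosed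
    have hyT : y ∈ e.target := by
      by_contra hyT; exact hy (indicator_of_notMem hyT _)
    refine ⟨e.symm y, subset_tsupport _ ?_, e.right_inv hyT⟩
    rw [Function.mem_support, hhT y hyT] at hy
    exact hy
  have hhV : tsupport h ⊆ V := hhs.trans hK0V
  have hhc : HasCompactSupport h := hK0.of_isClosed_subset (isClosed_tsupport _) hhs
  have hev : ∀ y ∈ e.target, h =ᶠ[𝓝 y] ψ ∘ e.symm := fun y hy ↦ by
    filter_upwards [hTo.mem_nhds hy] with z hz using hhT z hz
  have hhd : ContDiff ℝ ∞ h := by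
    rw [contDiff_iff_contDiffAt]
    intro y
    by_cases hy : y ∈ e.target
    · refine ContDiffAt.congr_of_eventuallyEq ?_ (hev y hy)
      exact contMDiffAt_iff_contDiffAt.1 ((hψ _).comp y ((contMDiffOn_extChartAt_symm p).contMDiffAt
        (hTo.mem_nhds hy)))
    · exact contDiffAt_const.congr_of_eventuallyEq
        (notMem_tsupport_iff_eventuallyEq.1 fun h' ↦ hy (hhV h').1)
  have hh1 : Differentiable ℝ h := hhd.differentiable (by simp)
  have hh' : ∀ i : Fin n, Continuous fun y ↦ fderiv ℝ h y (EuclideanSpace.single i 1) := fun i ↦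
    (hhd.continuous_fderiv (by simp)).clm_apply continuous_const
  have hts : ∀ i : Fin n, tsupport (fun y ↦ fderiv ℝ h y (EuclideanSpace.single i 1)) ⊆ V :=
    fun i ↦ (tsupport_fderiv_apply_subset ℝ _).trans hhV
  have hA : ∀ i, ContinuousOn (chartFlux p u i) V := fun i ↦
    (contDiffOn_chartFlux p hU hu i).continuousOn
  have hA' : ∀ i, ContinuousOn (fun y ↦ fderiv ℝ (chartFlux p u i) y
      (EuclideanSpace.single i 1)) V := fun i ↦
    ((contDiffOn_chartFlux p hU hu i).continuousOn_fderiv_of_isOpen hVo le_rfl).clm_apply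
      continuousOn_const
  have hi1 : ∀ i, Integrable fun y ↦ fderiv ℝ h y (EuclideanSpace.single i 1) * chartFlux p u i y :=
    fun i ↦ Continuous.integrable_of_hasCompactSupport
      (ContinuousOn.continuous_of_tsupport_subset ((hh' i).continuousOn.mul (hA i)) hVo
        ((tsupport_mul_subset_left).trans (hts i)))
      ((hhc.fderiv_apply ℝ _).mul_right)
  have hi2 : ∀ i, Integrable fun y ↦ h y * fderiv ℝ (chartFlux p u i) y
      (EuclideanSpace.single i 1) :=
    fun i ↦ Continuous.integrable_of_hasCompactSupport
      (ContinuousOn.continuous_of_tsupport_subset (hhd.continuous.continuousOn.mul (hA' i)) hVo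
        ((tsupport_mul_subset_left).trans hhV)) hhc.mul_right
  have hi3 : ∀ i, Integrable fun y ↦ h y * chartFlux p u i y :=
    fun i ↦ Continuous.integrable_of_hasCompactSupport
      (ContinuousOn.continuous_of_tsupport_subset (hhd.continuous.continuousOn.mul (hA i)) hVo
        ((tsupport_mul_subset_left).trans hhV)) hhc.mul_right
  have hparts : ∀ i, ∫ y, h y * fderiv ℝ (chartFlux p u i) y (EuclideanSpace.single i 1) =
      -∫ y, fderiv ℝ h y (EuclideanSpace.single i 1) * chartFlux p u i y := fun i ↦
    integral_mul_fderiv_eq_neg_fderiv_mul_of_integrable (hi1 i) (hi2 i) (hi3 i)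
      (fun y _ ↦ hh1 y) fun y hy ↦ ((contDiffOn_chartFlux p hU hu i).contDiffAt
        (hVo.mem_nhds (hhV hy))).differentiableAt (by simp)
  -- both sides in the chart
  have hout1 : ∀ y ∉ e.target,
      ∑ i, fderiv ℝ h y (EuclideanSpace.single i 1) * chartFlux p u i y = 0 := fun y hy ↦
    Finset.sum_eq_zero fun i _ ↦ by
      rw [image_eq_zero_of_notMem_tsupport (f := fun y ↦ fderiv ℝ h y
        (EuclideanSpace.single i 1)) fun h' ↦ hy (hts i h').1, zero_mul]
  have hout2 : ∀ y ∉ e.target,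
      ∑ i, h y * fderiv ℝ (chartFlux p u i) y (EuclideanSpace.single i 1) = 0 := fun y hy ↦
    Finset.sum_eq_zero fun i _ ↦ by
      rw [image_eq_zero_of_notMem_tsupport (f := h) fun h' ↦ hy (hhV h').1, zero_mul]
  have hL : ∫ x, inner ℝ (riemannianGradient (n := n) ψ x) (riemannianGradient (n := n) u x)
        ∂(riemannianVolume n M) =
      ∫ y, ∑ i, fderiv ℝ h y (EuclideanSpace.single i 1) * chartFlux p u i y := by
    rw [integral_eq_integral_chart p]
    · rw [← setIntegral_eq_integral_of_forall_compl_eq_zero hout1]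
      refine setIntegral_congr_fun hTo.measurableSet fun y hy ↦ ?_
      rw [inner_riemannianGradient_eq_sum p hy, (hev y hy).fderiv_eq, Finset.mul_sum]
      refine Finset.sum_congr rfl fun i _ ↦ ?_
      unfold chartFlux
      ring
    · intro x hx
      rw [riemannianGradient_of_notMem_tsupport fun h' ↦ hx (hs h').1, inner_zero_left]
    · refine (ContinuousOn.continuous_of_tsupport_subset (continuousOn_inner_riemannianGradient
        hSU (hψ.of_le (by exact_mod_cast le_top)).contMDiffOn
        ((hu.of_le one_le_two).mono inter_subset_right)) hSU ?_).continuousOn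
      refine (closure_minimal (fun x hx ↦ ?_) (isClosed_tsupport ψ)).trans hs
      by_contra hx'
      exact hx (by simp only [riemannianGradient_of_notMem_tsupport hx', inner_zero_left])
  have hR : ∫ x, ψ x * chartLaplacian p u (e x) ∂(riemannianVolume n M) =
      ∫ y, ∑ i, h y * fderiv ℝ (chartFlux p u i) y (EuclideanSpace.single i 1) := by
    rw [integral_eq_integral_chart p]
    · rw [← setIntegral_eq_integral_of_forall_compl_eq_zero hout2]
      refine setIntegral_congr_fun hTo.measurableSet fun y hy ↦ ?_
      simp only [← he, e.right_inv hy, hhT y hy]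
      rw [chartLaplacian, ← Finset.mul_sum]
      have := (volumeDensity_pos p hy).ne'
      field_simp
    · intro x hx
      rw [image_eq_zero_of_notMem_tsupport (f := ψ) fun h' ↦ hx (hs h').1, zero_mul]
    · exact (ContinuousOn.continuous_of_tsupport_subset
        (hψ.continuous.continuousOn.mul (continuousOn_chartLaplacian p hU hu)) hSU
        ((tsupport_mul_subset_left).trans hs)).continuousOn
  rw [hL, hR, integral_finsetSum _ fun i _ ↦ hi1 i, integral_finsetSum _ fun i _ ↦ hi2 i,
    ← Finset.sum_neg_distrib]
  refine Finset.sum_congr rfl fun i _ ↦ ?_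
  rw [hparts, neg_neg]

variable [T2Space M]

/-- The Laplacian does not depend on the chart: by Green's formula its values in two charts
have the same integrals against test functions, and they are continuous. -/
theorem chartLaplacian_eq (p q : M) {u : M → ℝ} {U : Set M} (hU : IsOpen U)
    (hu : ContMDiffOn (𝓡 n) 𝓘(ℝ, ℝ) 2 u U) {x : M} (hxU : x ∈ U)
    (hp : x ∈ (extChartAt (𝓡 n) p).source) (hq : x ∈ (extChartAt (𝓡 n) q).source) :
    chartLaplacian p u (extChartAt (𝓡 n) p x) = chartLaplacian q u (extChartAt (𝓡 n) q x) := by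
  have : LocallyCompactSpace M := ChartedSpace.locallyCompactSpace (EuclideanSpace ℝ (Fin n)) M
  set O := (extChartAt (𝓡 n) p).source ∩ (extChartAt (𝓡 n) q).source ∩ U with hO
  have hOo : IsOpen O := ((isOpen_extChartAt_source p).inter (isOpen_extChartAt_source q)).inter hU
  have hcp := (continuousOn_chartLaplacian p hU hu).mono
    (show O ⊆ _ from fun x hx ↦ ⟨hx.1.1, hx.2⟩)
  have hcq := (continuousOn_chartLaplacian q hU hu).mono
    (show O ⊆ _ from fun x hx ↦ ⟨hx.1.2, hx.2⟩)
  have hae := hOo.ae_eq_zero_of_integral_contMDiff_smul_eq_zero (𝓡 n)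
    (μ := riemannianVolume n M) ((hcp.sub hcq).locallyIntegrableOn hOo.measurableSet)
    fun g hg hgc hgs ↦ by
      have e1 := integral_inner_gradient_eq_neg_chartLaplacian p hU hu hg hgc
        (hgs.trans fun x hx ↦ ⟨hx.1.1, hx.2⟩)
      have e2 := integral_inner_gradient_eq_neg_chartLaplacian q hU hu hg hgc
        (hgs.trans fun x hx ↦ ⟨hx.1.2, hx.2⟩)
      have hi : ∀ L : M → ℝ, ContinuousOn L O →
          Integrable (fun x ↦ g x * L x) (riemannianVolume n M) := fun L hL ↦
        Continuous.integrable_of_hasCompactSupport (ContinuousOn.continuous_of_tsupport_subset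
          (hg.continuous.continuousOn.mul hL) hOo ((tsupport_mul_subset_left).trans hgs))
          hgc.mul_right
      simp only [smul_eq_mul, Pi.sub_apply, mul_sub]
      rw [integral_sub (hi _ hcp) (hi _ hcq)]
      linarith
  have heq : (fun x ↦ chartLaplacian p u (extChartAt (𝓡 n) p x))
      =ᵐ[(riemannianVolume n M).restrict O] fun x ↦ chartLaplacian q u (extChartAt (𝓡 n) q x) := by
    rw [EventuallyEq, ae_restrict_iff' hOo.measurableSet]
    filter_upwards [hae] with x hx hxO
    exact sub_eq_zero.1 (hx hxO)
  exact Measure.eqOn_open_of_ae_eq heq hOo hcp hcq ⟨⟨hp, hq⟩, hxU⟩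

theorem laplaceBeltrami_eq_chartLaplacian_of_mem (p : M) {u : M → ℝ} {U : Set M} (hU : IsOpen U)
    (hu : ContMDiffOn (𝓡 n) 𝓘(ℝ, ℝ) 2 u U) {x : M} (hxU : x ∈ U)
    (hp : x ∈ (extChartAt (𝓡 n) p).source) :
    laplaceBeltrami (n := n) u x = chartLaplacian p u (extChartAt (𝓡 n) p x) := by
  rw [laplaceBeltrami_eq_chartLaplacian]
  exact chartLaplacian_eq x p hU hu hxU (mem_extChartAt_source x) hp

theorem continuousOn_laplaceBeltrami {u : M → ℝ} {U : Set M} (hU : IsOpen U)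
    (hu : ContMDiffOn (𝓡 n) 𝓘(ℝ, ℝ) 2 u U) : ContinuousOn (laplaceBeltrami (n := n) u) U := by
  intro x hx
  have hSU : IsOpen ((extChartAt (𝓡 n) x).source ∩ U) := (isOpen_extChartAt_source x).inter hU
  have hxS : (extChartAt (𝓡 n) x).source ∩ U ∈ 𝓝 x := hSU.mem_nhds ⟨mem_extChartAt_source x, hx⟩
  refine (((continuousOn_chartLaplacian x hU hu).continuousAt hxS).congr ?_).continuousWithinAt
  filter_upwards [hxS] with z hz
  exact (laplaceBeltrami_eq_chartLaplacian_of_mem x hU hu hz.2 hz.1).symm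

/-- Green's formula for smooth test functions. -/
theorem integral_inner_gradient_eq_neg_of_contMDiff {u ψ : M → ℝ} {U : Set M}
    (hU : IsOpen U) (hu : ContMDiffOn (𝓡 n) 𝓘(ℝ, ℝ) 2 u U)
    (hψ : ContMDiff (𝓡 n) 𝓘(ℝ, ℝ) ∞ ψ) (hc : HasCompactSupport ψ) (hs : tsupport ψ ⊆ U) :
    ∫ x, inner ℝ (riemannianGradient (n := n) ψ x) (riemannianGradient (n := n) u x)
        ∂(riemannianVolume n M) =
      -∫ x, ψ x * laplaceBeltrami (n := n) u x ∂(riemannianVolume n M) := by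
  obtain ⟨t, χ, hχs, hχt, hsum⟩ := exists_finset_chart_decomposition n hc
  have hint1 : ∀ g : M → ℝ, ContMDiff (𝓡 n) 𝓘(ℝ, ℝ) ∞ g → tsupport g ⊆ tsupport ψ →
      Integrable (fun x ↦ inner ℝ (riemannianGradient (n := n) g x)
        (riemannianGradient (n := n) u x)) (riemannianVolume n M) := by
    intro g hg hgs
    have hsub : tsupport (fun x ↦ inner ℝ (riemannianGradient (n := n) g x)
        (riemannianGradient (n := n) u x)) ⊆ tsupport g := by
      refine closure_minimal (fun x hx ↦ ?_) (isClosed_tsupport g)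
      by_contra hx'
      exact hx (by simp only [riemannianGradient_of_notMem_tsupport hx', inner_zero_left])
    refine Continuous.integrable_of_hasCompactSupport (ContinuousOn.continuous_of_tsupport_subset
      (continuousOn_inner_riemannianGradient hU (hg.of_le (by exact_mod_cast le_top)).contMDiffOn
        (hu.of_le one_le_two)) hU (hsub.trans (hgs.trans hs))) ?_
    exact hc.isCompact.of_isClosed_subset (isClosed_tsupport _) (hsub.trans hgs)
  have hint2 : ∀ g : M → ℝ, ContMDiff (𝓡 n) 𝓘(ℝ, ℝ) ∞ g → tsupport g ⊆ tsupport ψ →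
      Integrable (fun x ↦ g x * laplaceBeltrami (n := n) u x) (riemannianVolume n M) := by
    intro g hg hgs
    refine Continuous.integrable_of_hasCompactSupport (ContinuousOn.continuous_of_tsupport_subset
      (hg.continuous.continuousOn.mul (continuousOn_laplaceBeltrami hU hu)) hU
      (tsupport_mul_subset_left.trans (hgs.trans hs))) ?_
    exact HasCompactSupport.mul_right (f := g)
      (hc.isCompact.of_isClosed_subset (isClosed_tsupport _) hgs)
  have key : ∀ t : Finset M, ContMDiff (𝓡 n) 𝓘(ℝ, ℝ) ∞ (fun x ↦ ∑ p ∈ t, χ p x * ψ x) ∧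
      tsupport (fun x ↦ ∑ p ∈ t, χ p x * ψ x) ⊆ tsupport ψ ∧
      ∫ x, inner ℝ (riemannianGradient (n := n) (fun x ↦ ∑ p ∈ t, χ p x * ψ x) x)
        (riemannianGradient (n := n) u x) ∂(riemannianVolume n M) =
      -∫ x, (∑ p ∈ t, χ p x * ψ x) * laplaceBeltrami (n := n) u x ∂(riemannianVolume n M) := by
    classical
    intro t
    induction t using Finset.induction_on with
    | empty =>
      refine ⟨by simpa using contMDiff_const, by simp [tsupport], ?_⟩
      simp [riemannianGradient_zero]
    | insert p t hp ih =>
      obtain ⟨i1, i2, i3⟩ := ih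
      have hm : ContMDiff (𝓡 n) 𝓘(ℝ, ℝ) ∞ (fun x ↦ χ p x * ψ x) := (hχs p).mul hψ
      have hms : tsupport (fun x ↦ χ p x * ψ x) ⊆ tsupport ψ := tsupport_mul_subset_right
      have hp' := integral_inner_gradient_eq_neg_chartLaplacian p hU hu hm hc.mul_left
        (subset_inter (tsupport_mul_subset_left.trans (hχt p)) (hms.trans hs))
      have hlap : ∀ x, (χ p x * ψ x) * chartLaplacian p u (extChartAt (𝓡 n) p x) =
          (χ p x * ψ x) * laplaceBeltrami (n := n) u x := by
        intro x
        by_cases hx : x ∈ tsupport (fun x ↦ χ p x * ψ x)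
        · rw [laplaceBeltrami_eq_chartLaplacian_of_mem p hU hu (hs (hms hx))
            (hχt p (tsupport_mul_subset_left hx))]
        · have := image_eq_zero_of_notMem_tsupport hx
          rw [this, zero_mul, zero_mul]
      simp_rw [hlap] at hp'
      simp_rw [Finset.sum_insert hp]
      refine ⟨hm.add i1, (tsupport_add _ _).trans (union_subset hms i2), ?_⟩
      have hg : ∀ x, riemannianGradient (n := n)
          (fun x ↦ χ p x * ψ x + ∑ q ∈ t, χ q x * ψ x) x =
          riemannianGradient (n := n) (fun x ↦ χ p x * ψ x) x +
            riemannianGradient (n := n) (fun x ↦ ∑ q ∈ t, χ q x * ψ x) x := fun x ↦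
        riemannianGradient_add (hm.mdifferentiable (by simp) x) (i1.mdifferentiable (by simp) x)
      simp_rw [hg, inner_add_left, add_mul]
      rw [integral_add (hint1 _ hm hms) (hint1 _ i1 i2),
        integral_add (hint2 _ hm hms) (hint2 _ i1 i2), hp', i3]
      ring
  simpa only [← hsum] using (key t).2.2

end Green

/-! ### Passing to the limit in Green's formula and in the Sobolev inequality -/

section Limits

open Filter Topology Set

theorem integrable_and_tendsto_integral_of_bounded_on_compact {M : Type*} [TopologicalSpace M]
    [MeasurableSpace M] [OpensMeasurableSpace M] {μ : Measure M} [IsFiniteMeasureOnCompacts μ]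
    [T2Space M] {G : ℕ → M → ℝ} {g : M → ℝ} {Q : Set M} (hQ : IsCompact Q) (B : ℝ)
    (hG : ∀ j, AEStronglyMeasurable (G j) μ) (hb : ∀ j, ∀ x ∈ Q, |G j x| ≤ B)
    (h0 : ∀ j, ∀ x ∉ Q, G j x = 0) (hlim : ∀ᵐ x ∂μ, Tendsto (fun j ↦ G j x) atTop (𝓝 (g x))) :
    Integrable g μ ∧ Tendsto (fun j ↦ ∫ x, G j x ∂μ) atTop (𝓝 (∫ x, g x ∂μ)) := by
  have hB : Integrable (Q.indicator fun _ ↦ B) μ :=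
    (integrable_indicator_iff hQ.isClosed.measurableSet).2
      (integrableOn_const hQ.measure_lt_top.ne)
  have hbd : ∀ j, ∀ᵐ x ∂μ, ‖G j x‖ ≤ Q.indicator (fun _ ↦ B) x := fun j ↦
    Eventually.of_forall fun x ↦ by
      by_cases hx : x ∈ Q
      · rw [indicator_of_mem hx]; exact hb j x hx
      · rw [indicator_of_notMem hx, h0 j x hx, norm_zero]
  exact ⟨⟨aestronglyMeasurable_of_tendsto_ae atTop hG hlim,
    hasFiniteIntegral_of_dominated_convergence hB.2 hbd hlim⟩,
    tendsto_integral_of_dominated_convergence _ hG hB hbd hlim⟩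

/-- A product with a factor of compact support is measurable if the other factor is continuous near
the support. -/
theorem ContinuousOn.aestronglyMeasurable_mul_of_eq_zero {M : Type*} [TopologicalSpace M]
    [MeasurableSpace M] [OpensMeasurableSpace M] {μ : Measure M} {w g : M → ℝ} {U : Set M}
    (hU : IsOpen U) (hw : ContinuousOn w U) (hg : ContinuousOn g U) (h0 : ∀ x ∉ U, g x = 0) :
    AEStronglyMeasurable (fun x ↦ w x * g x) μ := by
  have h1 : (fun x ↦ w x * g x) = U.indicator fun x ↦ w x * g x := by
    ext x
    by_cases hx : x ∈ U
    · rw [indicator_of_mem hx]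
    · rw [indicator_of_notMem hx, h0 x hx, mul_zero]
  rw [h1]
  exact (aestronglyMeasurable_indicator_iff hU.measurableSet).2
    ((hw.mul hg).aestronglyMeasurable hU.measurableSet)

variable {n : ℕ} {M : Type*} [TopologicalSpace M]
  [ChartedSpace (EuclideanSpace ℝ (Fin n)) M]
  [RiemannianBundle (fun x : M ↦ TangentSpace (𝓡 n) x)] [MeasurableSpace M]

theorem IsSmoothApprox.eq_zero {f : M → ℝ} {F : ℕ → M → ℝ} {Q : Set M} {C : ℝ}
    (hF : IsSmoothApprox n f F Q C) (j : ℕ) {x : M} (hx : x ∉ Q) : F j x = 0 :=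
  image_eq_zero_of_notMem_tsupport fun h ↦ hx (hF.tsupport_subset j h)

theorem IsSmoothApprox.gradient_eq_zero {f : M → ℝ} {F : ℕ → M → ℝ} {Q : Set M} {C : ℝ}
    (hF : IsSmoothApprox n f F Q C) (j : ℕ) {x : M} (hx : x ∉ Q) :
    riemannianGradient (n := n) (F j) x = 0 :=
  riemannianGradient_of_notMem_tsupport fun h ↦ hx (hF.tsupport_subset j h)

variable [T2Space M] [IsManifold (𝓡 n) ∞ M]
  [IsContMDiffRiemannianBundle (𝓡 n) ∞ (EuclideanSpace ℝ (Fin n))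
    (fun x : M ↦ TangentSpace (𝓡 n) x)]
  [BorelSpace M] [SecondCountableTopology M]

/-- The norm of the gradient of `f` is measurable as an almost everywhere limit of continuous
functions. -/
theorem integrable_mul_norm_gradient_sq {f w : M → ℝ} {U : Set M} (hU : IsOpen U)
    (hw : ContinuousOn w U) (hf : ∀ x, ChartLipschitzAt n f x) (hc : HasCompactSupport f)
    (hs : tsupport f ⊆ U) :
    Integrable (fun x ↦ w x * ‖riemannianGradient (n := n) f x‖ ^ 2) (riemannianVolume n M) := by
  obtain ⟨F, Q, C, hQU, hF⟩ := exists_isSmoothApprox hf hc hU hs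
  obtain ⟨B, hB⟩ := hF.isCompact.exists_bound_of_continuousOn (hw.mono hQU)
  refine (integrable_and_tendsto_integral_of_bounded_on_compact (G := fun j x ↦
    w x * ‖riemannianGradient (n := n) (F j) x‖ ^ 2) hF.isCompact (B * C ^ 2) (fun j ↦ ?_)
    (fun j x hx ↦ ?_) (fun j x hx ↦ ?_) ?_).1
  · refine hw.aestronglyMeasurable_mul_of_eq_zero hU ?_ fun x hx ↦ by
      rw [hF.gradient_eq_zero j fun h ↦ hx (hQU h)]; simp
    simp_rw [← real_inner_self_eq_norm_sq]
    have h1 := ((hF.contMDiff j).of_le (m := 1) ENat.LEInfty.out).contMDiffOn (s := U)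
    exact continuousOn_inner_riemannianGradient hU h1 h1
  · rw [abs_mul, abs_of_nonneg (sq_nonneg ‖_‖)]
    have := hF.norm_gradient_le j x
    have h2 := hB x hx
    rw [Real.norm_eq_abs] at h2
    have h3 : 0 ≤ B := (abs_nonneg _).trans h2
    gcongr
  · rw [hF.gradient_eq_zero j hx]; simp
  · filter_upwards [hF.ae_tendsto_gradient] with x hx
    exact tendsto_const_nhds.mul (hx.2.norm.pow 2)

/-- Green's formula for test functions which are Lipschitz in charts. -/
theorem integral_inner_gradient_eq_neg {u ψ : M → ℝ} {U : Set M}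
    (hU : IsOpen U) (hu : ContMDiffOn (𝓡 n) 𝓘(ℝ, ℝ) 2 u U)
    (hψ : ∀ x, ChartLipschitzAt n ψ x) (hc : HasCompactSupport ψ) (hs : tsupport ψ ⊆ U) :
    Integrable (fun x ↦ inner ℝ (riemannianGradient (n := n) ψ x) (riemannianGradient (n := n) u x))
        (riemannianVolume n M) ∧
      ∫ x, inner ℝ (riemannianGradient (n := n) ψ x) (riemannianGradient (n := n) u x)
        ∂(riemannianVolume n M) =
      -∫ x, ψ x * laplaceBeltrami (n := n) u x ∂(riemannianVolume n M) := by
  obtain ⟨F, Q, C, hQU, hF⟩ := exists_isSmoothApprox hψ hc hU hs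
  have hu1 : ContMDiffOn (𝓡 n) 𝓘(ℝ, ℝ) 1 u U := hu.of_le one_le_two
  have hFj : ∀ j, ContMDiffOn (𝓡 n) 𝓘(ℝ, ℝ) 1 (F j) U := fun j ↦
    ((hF.contMDiff j).of_le ENat.LEInfty.out).contMDiffOn
  obtain ⟨B, hB⟩ := hF.isCompact.exists_bound_of_continuousOn
    ((continuousOn_inner_riemannianGradient hU hu1 hu1).mono hQU)
  have hB' : ∀ x ∈ Q, ‖riemannianGradient (n := n) u x‖ ≤ √B := fun x hx ↦ by
    refine Real.le_sqrt_of_sq_le ?_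
    have := hB x hx
    rw [real_inner_self_eq_norm_sq] at this
    exact (le_abs_self _).trans this
  obtain ⟨L, hL⟩ := hF.isCompact.exists_bound_of_continuousOn
    ((continuousOn_laplaceBeltrami hU hu).mono hQU)
  have h1 := integrable_and_tendsto_integral_of_bounded_on_compact (μ := riemannianVolume n M)
    (G := fun j x ↦ inner ℝ (riemannianGradient (n := n) (F j) x) (riemannianGradient (n := n) u x))
    (g := fun x ↦ inner ℝ (riemannianGradient (n := n) ψ x) (riemannianGradient (n := n) u x))
    hF.isCompact (C * √B) (fun j ↦ by
      have := ContinuousOn.aestronglyMeasurable_mul_of_eq_zero (μ := riemannianVolume n M)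
        (w := fun _ ↦ 1) hU
        continuousOn_const (continuousOn_inner_riemannianGradient hU (hFj j) hu1) fun x hx ↦ by
          rw [hF.gradient_eq_zero j fun h ↦ hx (hQU h), inner_zero_left]
      simpa only [one_mul] using this)
    (fun j x hx ↦ (abs_real_inner_le_norm _ _).trans (mul_le_mul (hF.norm_gradient_le j x)
      (hB' x hx) (norm_nonneg _) ((norm_nonneg _).trans (hF.norm_gradient_le j x))))
    (fun j x hx ↦ by rw [hF.gradient_eq_zero j hx, inner_zero_left]) (by
      filter_upwards [hF.ae_tendsto_gradient] with x hx
      exact hx.2.inner tendsto_const_nhds)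
  have h2 := integrable_and_tendsto_integral_of_bounded_on_compact (μ := riemannianVolume n M)
    (G := fun j x ↦ F j x * laplaceBeltrami (n := n) u x)
    (g := fun x ↦ ψ x * laplaceBeltrami (n := n) u x)
    hF.isCompact (C * L) (fun j ↦ by
      simp_rw [mul_comm (F j _)]
      exact (continuousOn_laplaceBeltrami hU hu).aestronglyMeasurable_mul_of_eq_zero hU
        (hF.contMDiff j).continuous.continuousOn fun x hx ↦ hF.eq_zero j fun h ↦ hx (hQU h))
    (fun j x hx ↦ by
      rw [abs_mul]
      exact mul_le_mul (hF.abs_le j x) (hL x hx) (abs_nonneg _)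
        ((abs_nonneg _).trans (hF.abs_le j x)))
    (fun j x hx ↦ by rw [hF.eq_zero j hx, zero_mul])
    (Eventually.of_forall fun x ↦ (hF.tendsto x).mul tendsto_const_nhds)
  refine ⟨h1.1, tendsto_nhds_unique h1.2 (h2.2.neg.congr fun j ↦ ?_)⟩
  refine (integral_inner_gradient_eq_neg_of_contMDiff hU hu (hF.contMDiff j)
    (hF.isCompact.of_isClosed_subset (isClosed_tsupport _) (hF.tsupport_subset j))
    ((hF.tsupport_subset j).trans hQU)).symm

end Limits

section Sobolev

open Filter Topology Set

variable {n : ℕ} {M : Type*} [EMetricSpace M]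
  [ChartedSpace (EuclideanSpace ℝ (Fin n)) M] [IsManifold (𝓡 n) ∞ M]
  [RiemannianBundle (fun x : M ↦ TangentSpace (𝓡 n) x)]
  [IsContMDiffRiemannianBundle (𝓡 n) ∞ (EuclideanSpace ℝ (Fin n))
    (fun x : M ↦ TangentSpace (𝓡 n) x)]
  [MeasurableSpace M] [BorelSpace M] [SecondCountableTopology M]

/-- The Sobolev inequality extends to functions which are Lipschitz in charts. -/
theorem SobolevInequality.of_chartLipschitz {ρ σ : M → ℝ} {R₀ A μ : ℝ} (hμ : 1 < μ)
    (hS : SobolevInequality n ρ σ R₀ A μ) (hρ : Continuous ρ) (hσ : Continuous σ) {R : ℝ}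
    (hR : R₀ ≤ R) {f : M → ℝ} (hf : ∀ x, ChartLipschitzAt n f x) (hc : HasCompactSupport f)
    (hs : tsupport f ⊆ sublevel ρ R) :
    ((volumeSublevel n ρ R)⁻¹ * ∫ x, |f x| ^ (2 * μ) ∂(riemannianVolume n M)) ^ (1 / μ) ≤
      A * R ^ 2 * ((volumeSublevel n ρ R)⁻¹ *
        ∫ x, (‖riemannianGradient (n := n) f x‖ ^ 2 + σ x * f x ^ 2) ∂(riemannianVolume n M)) := by
  have hDo : IsOpen (sublevel ρ R) := isOpen_lt hρ continuous_const
  obtain ⟨F, Q, C, hQD, hF⟩ := exists_isSmoothApprox hf hc hDo hs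
  obtain ⟨B, hB⟩ := hF.isCompact.exists_bound_of_continuousOn hσ.continuousOn
  have hμ0 : 0 < μ := by linarith
  have hmain : ∀ j, ((volumeSublevel n ρ R)⁻¹ *
      ∫ x, |F j x| ^ (2 * μ) ∂(riemannianVolume n M)) ^ (1 / μ) ≤
      A * R ^ 2 * ((volumeSublevel n ρ R)⁻¹ * ∫ x, (‖riemannianGradient (n := n) (F j) x‖ ^ 2 +
        σ x * F j x ^ 2) ∂(riemannianVolume n M)) := by
    intro j
    have h1 := hS R hR (F j) (hF.contMDiff j)
      (hF.isCompact.of_isClosed_subset (isClosed_tsupport _) (hF.tsupport_subset j))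
      ((hF.tsupport_subset j).trans hQD)
    rw [setAverage_eq, setAverage_eq, smul_eq_mul, smul_eq_mul,
      setIntegral_eq_integral_of_forall_compl_eq_zero fun x hx ↦ by
        rw [hF.eq_zero j fun h ↦ hx (hQD h), abs_zero, Real.zero_rpow (by positivity)],
      setIntegral_eq_integral_of_forall_compl_eq_zero fun x hx ↦ by
        rw [hF.eq_zero j fun h ↦ hx (hQD h), hF.gradient_eq_zero j fun h ↦ hx (hQD h)]
        simp] at h1
    exact h1
  have hFc : ∀ j, Continuous (F j) := fun j ↦ (hF.contMDiff j).continuous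
  have h1 := (integrable_and_tendsto_integral_of_bounded_on_compact (μ := riemannianVolume n M)
    (G := fun j x ↦ |F j x| ^ (2 * μ)) (g := fun x ↦ |f x| ^ (2 * μ))
    hF.isCompact (C ^ (2 * μ)) (fun j ↦ ((hFc j).abs.rpow_const fun x ↦ Or.inr
      (by positivity)).aestronglyMeasurable)
    (fun j x hx ↦ by
      rw [abs_of_nonneg (by positivity)]
      exact Real.rpow_le_rpow (abs_nonneg _) (hF.abs_le j x) (by positivity))
    (fun j x hx ↦ by rw [hF.eq_zero j hx, abs_zero, Real.zero_rpow (by positivity)])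
    (Eventually.of_forall fun x ↦ (hF.tendsto x).abs.rpow_const (Or.inr (by positivity)))).2
  have h2 := (integrable_and_tendsto_integral_of_bounded_on_compact (μ := riemannianVolume n M)
    (G := fun j x ↦ ‖riemannianGradient (n := n) (F j) x‖ ^ 2 + σ x * F j x ^ 2)
    (g := fun x ↦ ‖riemannianGradient (n := n) f x‖ ^ 2 + σ x * f x ^ 2)
    hF.isCompact (C ^ 2 + B * C ^ 2) (fun j ↦ by
      have h1 := ((hF.contMDiff j).of_le (m := 1) ENat.LEInfty.out).contMDiffOn (s := univ)
      have h3 := continuousOn_inner_riemannianGradient isOpen_univ h1 h1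
      simp_rw [real_inner_self_eq_norm_sq] at h3
      exact ((continuousOn_univ.1 h3).add (hσ.mul ((hFc j).pow 2))).aestronglyMeasurable)
    (fun j x hx ↦ by
      have h2 := hB x hx
      rw [Real.norm_eq_abs] at h2
      have h3 : 0 ≤ B := (abs_nonneg _).trans h2
      have h4 := hF.abs_le j x
      have h5 := hF.norm_gradient_le j x
      refine (abs_add_le _ _).trans ?_
      rw [abs_mul, abs_of_nonneg (sq_nonneg ‖_‖), abs_pow]
      gcongr)
    (fun j x hx ↦ by rw [hF.eq_zero j hx, hF.gradient_eq_zero j hx]; simp) (by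
      filter_upwards [hF.ae_tendsto_gradient] with x hx
      exact (hx.2.norm.pow 2).add (tendsto_const_nhds.mul ((hF.tendsto x).pow 2)))).2
  refine le_of_tendsto_of_tendsto' ((h1.const_mul _).rpow_const (Or.inr (by positivity)))
    ((h2.const_mul _).const_mul _) hmain

end Sobolev

/-! ### The Caccioppoli inequality -/

section Caccioppoli

open Filter Topology Set

variable {n : ℕ} {M : Type*} [TopologicalSpace M] [ChartedSpace (EuclideanSpace ℝ (Fin n)) M]
  [IsManifold (𝓡 n) ∞ M]

theorem chartLipschitzAt_mul_rpow {χ u : M → ℝ} {U : Set M} (hU : IsOpen U)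
    (hu : ContMDiffOn (𝓡 n) 𝓘(ℝ, ℝ) 1 u U) (hpos : ∀ x ∈ U, 0 < u x)
    (hχ : ∀ x, ChartLipschitzAt n χ x) (hs : tsupport χ ⊆ U) (k : ℝ) (x : M) :
    ChartLipschitzAt n (fun x ↦ χ x * u x ^ k) x := by
  by_cases hx : x ∈ tsupport χ
  · exact (hχ x).mul (((hu.contMDiffAt (hU.mem_nhds (hs hx))).chartLipschitzAt).comp
      (Real.contDiffAt_rpow_const_of_ne (hpos x (hs hx)).ne'))
  · exact chartLipschitzAt_of_notMem_tsupport fun h ↦ hx (tsupport_mul_subset_left h)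

end Caccioppoli

section Caccioppoli

open Filter Topology Set

variable {n : ℕ} {M : Type*} [EMetricSpace M]
  [ChartedSpace (EuclideanSpace ℝ (Fin n)) M] [IsManifold (𝓡 n) ∞ M]
  [RiemannianBundle (fun x : M ↦ TangentSpace (𝓡 n) x)]
  [IsContMDiffRiemannianBundle (𝓡 n) ∞ (EuclideanSpace ℝ (Fin n))
    (fun x : M ↦ TangentSpace (𝓡 n) x)]
  [MeasurableSpace M] [BorelSpace M] [SecondCountableTopology M]

/-- For a positive subsolution `u` and a cutoff `χ`, the energy of `χ uᵏ` is controlled by the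
gradient of the cutoff alone. The test function is `χ² u²ᵏ⁻¹`; the terms in `|∇u|²` have the
good sign because `k² - k (2k - 1) ≤ 0`. -/
theorem IsPositiveSubsolutionOn.integral_energy_le {σ u χ : M → ℝ} {U : Set M} (hU : IsOpen U)
    (hu : IsPositiveSubsolutionOn n σ u U) (hσ : Continuous σ) (hσ0 : ∀ x, 0 ≤ σ x)
    (hχ : ∀ x, ChartLipschitzAt n χ x) (hc : HasCompactSupport χ)
    (hs : tsupport χ ⊆ U) {k : ℝ} (hk : 1 ≤ k) :
    ∫ x, (‖riemannianGradient (n := n) (fun x ↦ χ x * u x ^ k) x‖ ^ 2 + σ x * (χ x * u x ^ k) ^ 2)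
        ∂(riemannianVolume n M) ≤
      ∫ x, u x ^ (2 * k) * ‖riemannianGradient (n := n) χ x‖ ^ 2 ∂(riemannianVolume n M) := by
  set f : M → ℝ := fun x ↦ χ x * u x ^ k with hf
  set ψ : M → ℝ := fun x ↦ χ x ^ 2 * u x ^ (2 * k - 1) with hψ
  have hu1 : ContMDiffOn (𝓡 n) 𝓘(ℝ, ℝ) 1 u U := hu.contMDiffOn.of_le one_le_two
  have hχ2 : ∀ x, ChartLipschitzAt n (fun x ↦ χ x ^ 2) x := fun x ↦
    (hχ x).comp (G := fun t ↦ t ^ 2) (by fun_prop)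
  have hs2 : tsupport (fun x ↦ χ x ^ 2) ⊆ tsupport χ :=
    closure_mono fun x hx h ↦ hx (by simp [h])
  have hc2 : HasCompactSupport fun x ↦ χ x ^ 2 :=
    hc.isCompact.of_isClosed_subset (isClosed_tsupport _) hs2
  have hfL : ∀ x, ChartLipschitzAt n f x := chartLipschitzAt_mul_rpow hU hu1 hu.pos hχ hs k
  have hψL : ∀ x, ChartLipschitzAt n ψ x :=
    chartLipschitzAt_mul_rpow hU hu1 hu.pos hχ2 (hs2.trans hs) (2 * k - 1)
  have hfc : HasCompactSupport f := hc.mul_right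
  have hψc : HasCompactSupport ψ := hc2.mul_right
  have hfs : tsupport f ⊆ U := tsupport_mul_subset_left.trans hs
  have hψs : tsupport ψ ⊆ U := tsupport_mul_subset_left.trans (hs2.trans hs)
  have hgreen := integral_inner_gradient_eq_neg hU hu.contMDiffOn hψL hψc hψs
  have hi1 : Integrable (fun x ↦ ‖riemannianGradient (n := n) f x‖ ^ 2) (riemannianVolume n M) := by
    simpa using integrable_mul_norm_gradient_sq (w := fun _ ↦ 1) hU continuousOn_const hfL hfc hfs
  have hi2 : Integrable (fun x ↦ u x ^ (2 * k) * ‖riemannianGradient (n := n) χ x‖ ^ 2)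
      (riemannianVolume n M) :=
    integrable_mul_norm_gradient_sq hU (hu1.continuousOn.rpow_const fun x hx ↦
      Or.inl (hu.pos x hx).ne') hχ hc hs
  have hfcont : Continuous f := continuous_iff_continuousAt.2 fun x ↦ (hfL x).continuousAt
  have hψcont : Continuous ψ := continuous_iff_continuousAt.2 fun x ↦ (hψL x).continuousAt
  have hi3 : Integrable (fun x ↦ σ x * f x ^ 2) (riemannianVolume n M) := by
    refine Continuous.integrable_of_hasCompactSupport (hσ.mul (hfcont.pow 2)) ?_
    refine HasCompactSupport.mul_left (hfc.isCompact.of_isClosed_subset (isClosed_tsupport _)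
      (closure_mono fun x hx h ↦ hx ?_))
    simp [h]
  have hi4 : Integrable (fun x ↦ ψ x * laplaceBeltrami (n := n) u x) (riemannianVolume n M) :=
    Continuous.integrable_of_hasCompactSupport (ContinuousOn.continuous_of_tsupport_subset
      (hψcont.continuousOn.mul (continuousOn_laplaceBeltrami hU hu.contMDiffOn)) hU
      (tsupport_mul_subset_left.trans hψs)) hψc.mul_right
  -- the approximation serves to know that `χ` is differentiable almost everywhere
  obtain ⟨F, Q, C, -, hF⟩ := exists_isSmoothApprox hχ hc hU hs
  have hgrad : ∀ᵐ x ∂(riemannianVolume n M), ‖riemannianGradient (n := n) f x‖ ^ 2 ≤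
      u x ^ (2 * k) * ‖riemannianGradient (n := n) χ x‖ ^ 2 +
        k * inner ℝ (riemannianGradient (n := n) ψ x) (riemannianGradient (n := n) u x) := by
    filter_upwards [hF.ae_tendsto_gradient] with x hx
    by_cases hxs : x ∈ tsupport χ
    · have hxU := hs hxs
      have hv := hu.pos x hxU
      have hud : MDifferentiableAt (𝓡 n) 𝓘(ℝ, ℝ) u x :=
        (hu1.contMDiffAt (hU.mem_nhds hxU)).mdifferentiableAt (by simp)
      set P := u x ^ (k - 1) with hP
      have hp1 : u x ^ k = u x * P := by
        rw [hP, ← Real.rpow_one_add' hv.le (by linarith)]; congr 1; ring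
      have hp2 : u x ^ (2 * k) = (u x * P) ^ 2 := by
        rw [← hp1, ← Real.rpow_natCast, ← Real.rpow_mul hv.le]; congr 1; push_cast; ring
      have hp3 : u x ^ (2 * k - 1 - 1) = P ^ 2 := by
        rw [hP, ← Real.rpow_natCast, ← Real.rpow_mul hv.le]; congr 1; push_cast; ring
      have hp4 : u x ^ (2 * k - 1) = u x * P ^ 2 := by
        rw [← hp3, ← Real.rpow_one_add' hv.le (by linarith)]; congr 1; ring
      have hgk : ∀ l : ℝ, HasDerivAt (fun t : ℝ ↦ t ^ l) (l * u x ^ (l - 1)) (u x) := fun l ↦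
        Real.hasDerivAt_rpow_const (Or.inl hv.ne')
      have hg2 : HasDerivAt (fun t : ℝ ↦ t ^ 2) (2 * χ x) (χ x) := by
        simpa using hasDerivAt_pow 2 (χ x)
      have e1 : riemannianGradient (n := n) f x =
          (χ x * (k * P)) • riemannianGradient (n := n) u x +
          (u x * P) • riemannianGradient (n := n) χ x := by
        rw [hf, riemannianGradient_mul hx.1 (hud.comp_hasDerivAt (hgk k)),
          riemannianGradient_comp hud (hgk k), smul_smul, hp1]
      have e2 : riemannianGradient (n := n) ψ x =
          (χ x ^ 2 * ((2 * k - 1) * P ^ 2)) • riemannianGradient (n := n) u x +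
          (u x * P ^ 2 * (2 * χ x)) • riemannianGradient (n := n) χ x := by
        rw [hψ, riemannianGradient_mul (hx.1.comp_hasDerivAt hg2) (hud.comp_hasDerivAt (hgk _)),
          riemannianGradient_comp hud (hgk _), riemannianGradient_comp hx.1 hg2, smul_smul,
          smul_smul, hp3, hp4]
      rw [e1, e2, hp2, ← real_inner_self_eq_norm_sq]
      simp only [inner_add_left, inner_add_right, real_inner_smul_left, real_inner_smul_right]
      simp only [real_inner_self_eq_norm_sq]
      rw [real_inner_comm (riemannianGradient (n := n) u x) (riemannianGradient (n := n) χ x)]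
      -- the difference of the two sides is `k (k - 1) χ² u²ᵏ⁻² |∇u|²`
      have hkk : 0 ≤ (k * (k - 1)) * (χ x * P * ‖riemannianGradient (n := n) u x‖) ^ 2 :=
        mul_nonneg (mul_nonneg (by linarith) (by linarith)) (sq_nonneg _)
      nlinarith [hkk]
    · rw [riemannianGradient_of_notMem_tsupport fun h ↦ hxs (tsupport_mul_subset_left h),
        riemannianGradient_of_notMem_tsupport hxs,
        riemannianGradient_of_notMem_tsupport fun h ↦ hxs (hs2 (tsupport_mul_subset_left h))]
      simp
  have hle1 := integral_mono_ae hi1 (hi2.add (hgreen.1.const_mul k)) hgrad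
  have hle2 : ∫ x, σ x * f x ^ 2 ∂(riemannianVolume n M) ≤
      ∫ x, ψ x * laplaceBeltrami (n := n) u x ∂(riemannianVolume n M) := by
    refine integral_mono hi3 hi4 fun x ↦ ?_
    by_cases hxs : x ∈ tsupport χ
    · have hxU := hs hxs
      have hv := hu.pos x hxU
      have h1 : f x ^ 2 = ψ x * u x := by
        simp only [hf, hψ]
        rw [mul_pow, mul_assoc, ← Real.rpow_natCast (u x ^ k), ← Real.rpow_mul hv.le,
          ← Real.rpow_add_one' hv.le (by linarith)]
        congr 2; push_cast; ring
      have h2 : 0 ≤ ψ x := mul_nonneg (sq_nonneg _) (Real.rpow_nonneg hv.le _)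
      calc σ x * f x ^ 2 = ψ x * (σ x * u x) := by rw [h1]; ring
        _ ≤ _ := mul_le_mul_of_nonneg_left (hu.le_laplacian x hxU) h2
    · have h1 : χ x = 0 := image_eq_zero_of_notMem_tsupport hxs
      simp [hf, hψ, h1]
  have hsum : ∫ x, (u x ^ (2 * k) * ‖riemannianGradient (n := n) χ x‖ ^ 2 +
        k * inner ℝ (riemannianGradient (n := n) ψ x) (riemannianGradient (n := n) u x))
        ∂(riemannianVolume n M) =
      ∫ x, u x ^ (2 * k) * ‖riemannianGradient (n := n) χ x‖ ^ 2 ∂(riemannianVolume n M) +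
        k * -∫ x, ψ x * laplaceBeltrami (n := n) u x ∂(riemannianVolume n M) := by
    rw [integral_add hi2 (hgreen.1.const_mul k), integral_const_mul, hgreen.2]
  have h0 : 0 ≤ ∫ x, σ x * f x ^ 2 ∂(riemannianVolume n M) :=
    integral_nonneg fun x ↦ mul_nonneg (hσ0 x) (sq_nonneg _)
  rw [integral_add hi1 hi3]
  have h3 := hle1.trans_eq hsum
  nlinarith [h3, hle2, h0, hk]

end Caccioppoli

/-! ### Moser iteration for sequences -/

section Iteration

open Filter Topology

/-- The value in the limit of the recursion `a (j + 1) ≤ (B μ²ʲ a j) ^ μ`: dividing the logarithms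
by `μ ^ j` turns it into a telescoping sum, in which `B` occurs with the total weight
`∑ μ ^ (-j) = ν`. -/
theorem sq_le_of_le_rpow_of_rpow_mul_le {μ ν B v c : ℝ} {a : ℕ → ℝ} (hμ : 1 < μ)
    (hν : 1 / μ + 1 / ν = 1) (hB : 0 < B) (hv : 0 < v) (hc : 0 < c)
    (hlow : ∀ j, c ^ (2 * μ ^ j) * v ≤ a j)
    (hrec : ∀ j, a (j + 1) ≤ (B * μ ^ (2 * j) * a j) ^ μ) :
    c ^ 2 ≤ B ^ ν * Real.exp (2 * Real.log μ * ∑' j : ℕ, j * (μ⁻¹) ^ j) * a 0 := by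
  have hμ0 : 0 < μ := by linarith
  have hr0 : 0 ≤ μ⁻¹ := by positivity
  have hr1 : μ⁻¹ < 1 := inv_lt_one_of_one_lt₀ hμ
  have hνr : (1 - μ⁻¹)⁻¹ = ν := by
    rw [one_div, one_div] at hν
    rw [← inv_inv ν]; congr 1; linarith
  have hpos : ∀ j, 0 < a j := fun j ↦ lt_of_lt_of_le (by positivity) (hlow j)
  set r := μ⁻¹ with hr
  have hstep : ∀ j, Real.log (a (j + 1)) * r ^ (j + 1) ≤
      Real.log (a j) * r ^ j + (Real.log B * r ^ j + 2 * Real.log μ * (j * r ^ j)) := by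
    intro j
    have h1 := Real.log_le_log (hpos (j + 1)) (hrec j)
    have h2 := hpos j
    rw [Real.log_rpow (by positivity), Real.log_mul (by positivity) h2.ne',
      Real.log_mul hB.ne' (by positivity), Real.log_pow] at h1
    push_cast at h1
    have h3 := mul_le_mul_of_nonneg_right h1 (pow_nonneg hr0 (j + 1))
    have h4 : μ * r = 1 := mul_inv_cancel₀ hμ0.ne'
    calc _ ≤ _ := h3
      _ = (μ * r) * ((Real.log B + 2 * j * Real.log μ + Real.log (a j)) * r ^ j) := by ring
      _ = _ := by rw [h4]; ring
  have hsum : ∀ N : ℕ, Real.log (a N) * r ^ N ≤ Real.log (a 0) +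
      (Real.log B * ∑ j ∈ Finset.range N, r ^ j +
        2 * Real.log μ * ∑ j ∈ Finset.range N, (j * r ^ j : ℝ)) := by
    intro N
    induction N with
    | zero => simp
    | succ N ih =>
      rw [Finset.sum_range_succ, Finset.sum_range_succ]
      have := hstep N
      linarith
  have hlow' : ∀ N : ℕ, 2 * Real.log c + Real.log v * r ^ N ≤ Real.log (a N) * r ^ N := by
    intro N
    have h1 := Real.log_le_log (by positivity) (hlow N)
    rw [Real.log_mul (by positivity) hv.ne', Real.log_rpow hc] at h1
    have h3 := mul_le_mul_of_nonneg_right h1 (pow_nonneg hr0 N)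
    have h4 : μ ^ N * r ^ N = 1 := by rw [← mul_pow, mul_inv_cancel₀ hμ0.ne', one_pow]
    calc _ = 2 * (μ ^ N * r ^ N) * Real.log c + Real.log v * r ^ N := by rw [h4]; ring
      _ = (2 * μ ^ N * Real.log c + Real.log v) * r ^ N := by ring
      _ ≤ _ := h3
  have hs1 : Tendsto (fun N ↦ ∑ j ∈ Finset.range N, r ^ j) atTop (𝓝 ν) := by
    rw [← hνr]; exact (hasSum_geometric_of_lt_one hr0 hr1).tendsto_sum_nat
  have hs2 : Tendsto (fun N ↦ ∑ j ∈ Finset.range N, (j * r ^ j : ℝ)) atTop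
      (𝓝 (∑' j : ℕ, j * r ^ j)) :=
    (hasSum_coe_mul_geometric_of_norm_lt_one (by
      rwa [Real.norm_of_nonneg hr0])).summable.hasSum.tendsto_sum_nat
  have hlim := le_of_tendsto_of_tendsto'
    ((tendsto_pow_atTop_nhds_zero_of_lt_one hr0 hr1).const_mul (Real.log v) |>.const_add
      (2 * Real.log c))
    ((hs1.const_mul (Real.log B)).add (hs2.const_mul (2 * Real.log μ)) |>.const_add
      (Real.log (a 0))) fun N ↦ (hlow' N).trans (hsum N)
  rw [mul_zero, add_zero] at hlim
  have h0 := hpos 0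
  have hfin : Real.log (c ^ 2) ≤
      Real.log (B ^ ν * Real.exp (2 * Real.log μ * ∑' j : ℕ, j * r ^ j) * a 0) := by
    rw [Real.log_mul (by positivity) h0.ne', Real.log_mul (by positivity) (by positivity),
      Real.log_rpow hB, Real.log_exp, Real.log_pow]
    push_cast
    linarith
  exact (Real.log_le_log_iff (by positivity) (by positivity)).1 hfin

end Iteration

/-! ### Cutoff functions of `ρ` -/

section Cutoff

open Filter Topology Set

theorem exists_contDiff_cutoff : ∃ (η : ℝ → ℝ) (K : ℝ), 0 < K ∧ ContDiff ℝ 1 η ∧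
    (∀ t, 0 ≤ η t) ∧ (∀ t, η t ≤ 1) ∧ η 0 = 1 ∧ (∀ t, t ∉ Icc (-1) 1 → η t = 0) ∧
    ∀ t, |deriv η t| ≤ K := by
  let b : ContDiffBump (0 : ℝ) := ⟨1 / 2, 1, by norm_num, by norm_num⟩
  have hb : ContDiff ℝ 1 b := b.contDiff
  have hd : HasCompactSupport (deriv b) := b.hasCompactSupport.deriv
  obtain ⟨K, hK⟩ := (hb.continuous_deriv le_rfl).bounded_above_of_compact_support hd
  refine ⟨b, max K 1, by positivity, hb, fun t ↦ b.nonneg, fun t ↦ b.le_one,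
    b.one_of_mem_closedBall (by simp [b]), fun t ht ↦ b.zero_of_le_dist ?_,
    fun t ↦ (hK t).trans (le_max_left _ _)⟩
  rw [mem_Icc, ← abs_le, not_le] at ht
  simpa [b] using ht.le

theorem tsupport_comp_sub_div_subset {M : Type*} [TopologicalSpace M] {ρ : M → ℝ}
    (hρ : Continuous ρ) {η : ℝ → ℝ}
    (hη : ∀ t, t ∉ Icc (-1) 1 → η t = 0) {R s : ℝ} (hs : 0 < s) :
    tsupport (fun x ↦ η ((ρ x - R) / s)) ⊆ ρ ⁻¹' Icc (R - s) (R + s) := by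
  refine closure_minimal (fun x hx ↦ ?_) (isClosed_Icc.preimage hρ)
  have h1 : (ρ x - R) / s ∈ Icc (-1) 1 := by
    by_contra h
    exact hx (hη _ h)
  have h2 := (le_div_iff₀ hs).1 h1.1
  have h3 := (div_le_iff₀ hs).1 h1.2
  exact ⟨by linarith, by linarith⟩

variable {n : ℕ} {M : Type*} [EMetricSpace M] [ChartedSpace (EuclideanSpace ℝ (Fin n)) M]
  [RiemannianBundle (fun x : M ↦ TangentSpace (𝓡 n) x)] [MeasurableSpace M]

theorem IsDistanceLike.isCompact_preimage_Icc {ρ : M → ℝ} {m R₀ : ℝ} (hρ : IsDistanceLike n ρ m R₀)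
    (a b : ℝ) : IsCompact (ρ ⁻¹' Icc a b) :=
  hρ.proper.isCompact_preimage isCompact_Icc

/-- The lower bound for `|∇ρ|` ensures that `ρ` is differentiable at almost every point of the
support of the cutoff. -/
theorem IsDistanceLike.ae_norm_gradient_comp_le {ρ : M → ℝ} {m R₀ : ℝ}
    (hρ : IsDistanceLike n ρ m R₀) {η : ℝ → ℝ} {K : ℝ} (hη : ContDiff ℝ 1 η)
    (hη0 : ∀ t, t ∉ Icc (-1) 1 → η t = 0) (hK : ∀ t, |deriv η t| ≤ K) {R s : ℝ} (hs : 0 < s)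
    (hRs : R₀ ≤ R - s) :
    ∀ᵐ x ∂(riemannianVolume n M),
      ‖riemannianGradient (n := n) (fun x ↦ η ((ρ x - R) / s)) x‖ ≤ K / s := by
  have hK0 : 0 ≤ K := (abs_nonneg _).trans (hK 0)
  filter_upwards [hρ.gradient_bounds] with x hx
  by_cases hxs : x ∈ tsupport fun x ↦ η ((ρ x - R) / s)
  · have h1 := tsupport_comp_sub_div_subset hρ.proper.continuous hη0 hs hxs
    obtain ⟨h2, h3⟩ := hx (hRs.trans h1.1)
    have hd : MDifferentiableAt (𝓡 n) 𝓘(ℝ, ℝ) ρ x := by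
      by_contra hd
      have h4 : riemannianGradient (n := n) ρ x = 0 := by
        refine ext_inner_right ℝ fun v ↦ ?_
        have h5 : mfderiv (𝓡 n) 𝓘(ℝ, ℝ) ρ x = 0 := mfderiv_zero_of_not_mdifferentiableAt hd
        rw [inner_riemannianGradient, inner_zero_left]
        exact congrArg (fun L ↦ L v) h5
      rw [h4, norm_zero] at h2
      linarith
    have hder : HasDerivAt (fun t ↦ η ((t - R) / s)) (deriv η ((ρ x - R) / s) * (1 / s)) (ρ x) :=
      HasDerivAt.comp (h₂ := η) (ρ x) ((hη.differentiable one_ne_zero _).hasDerivAt)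
        (((hasDerivAt_id (ρ x)).sub_const R).div_const s)
    rw [riemannianGradient_comp hd hder, norm_smul, norm_mul, Real.norm_eq_abs, Real.norm_eq_abs,
      abs_of_pos (by positivity : 0 < 1 / s)]
    calc _ ≤ K * (1 / s) * 1 := by
          gcongr
          exact hK _
      _ = K / s := by ring
  · rw [riemannianGradient_of_notMem_tsupport hxs, norm_zero]
    positivity

variable [IsManifold (𝓡 n) ∞ M] [IsContMDiffRiemannianBundle (𝓡 n) ∞ (EuclideanSpace ℝ (Fin n))
    (fun x : M ↦ TangentSpace (𝓡 n) x)] [BorelSpace M] [SecondCountableTopology M]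

theorem IsDistanceLike.measure_sublevel_ne_top {ρ : M → ℝ} {m R₀ : ℝ}
    (hρ : IsDistanceLike n ρ m R₀) (r : ℝ) : riemannianVolume n M (sublevel ρ r) ≠ ⊤ :=
  ((measure_mono (show sublevel ρ r ⊆ ρ ⁻¹' Icc 0 r from
    fun x hx ↦ ⟨(hρ.pos x).le, le_of_lt hx⟩)).trans_lt
      (hρ.isCompact_preimage_Icc 0 r).measure_lt_top).ne

theorem IsDistanceLike.volumeSublevel_pos {ρ : M → ℝ} {m R₀ : ℝ}
    (hρ : IsDistanceLike n ρ m R₀) {r : ℝ} {x : M} (hx : ρ x < r) : 0 < volumeSublevel n ρ r :=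
  ENNReal.toReal_pos ((isOpen_lt hρ.proper.continuous continuous_const).measure_pos
    (riemannianVolume n M) ⟨x, hx⟩).ne' (hρ.measure_sublevel_ne_top r)

end Cutoff

/-! ### Moser iteration for subsolutions -/

section Moser

open Filter Topology Set

variable {n : ℕ} {M : Type*} [EMetricSpace M]
  [ChartedSpace (EuclideanSpace ℝ (Fin n)) M] [IsManifold (𝓡 n) ∞ M]
  [RiemannianBundle (fun x : M ↦ TangentSpace (𝓡 n) x)]
  [IsContMDiffRiemannianBundle (𝓡 n) ∞ (EuclideanSpace ℝ (Fin n))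
    (fun x : M ↦ TangentSpace (𝓡 n) x)]
  [MeasurableSpace M] [BorelSpace M] [SecondCountableTopology M]

/-- One step of the iteration, from the exponent `2k` to the exponent `2kμ`. The Sobolev and
Caccioppoli inequalities are used with the cutoff `φ ^ q`, `q = 2νk - (ν - 1)`, for which
`2qμ = 4νkμ - 2ν` and `2q - 2 = 4νk - 2ν`; both sides are then integrals of
`(φ ^ (2ν) u) ^ (2k) φ ^ (-2ν)`, for the respective values of `k`. -/
theorem IsPositiveSubsolutionOn.integral_rpow_le {ρ σ u φ : M → ℝ} {R₀ A μ ν R L k : ℝ}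
    {U : Set M} (hμ : 1 < μ) (hν : 1 / μ + 1 / ν = 1) (hA : 0 < A)
    (hS : SobolevInequality n ρ σ R₀ A μ) (hρ : Continuous ρ) (hσ : Continuous σ)
    (hσ0 : ∀ x, 0 ≤ σ x) (hR : R₀ ≤ R) (hU : IsOpen U) (hUR : U ⊆ sublevel ρ R)
    (hu : IsPositiveSubsolutionOn n σ u U) (hφ : ∀ x, ChartLipschitzAt n φ x)
    (hφ0 : ∀ x, 0 ≤ φ x) (hc : HasCompactSupport φ) (hs : tsupport φ ⊆ U)
    (hL : ∀ᵐ x ∂(riemannianVolume n M), ‖riemannianGradient (n := n) φ x‖ ≤ L) (hk : 1 ≤ k) :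
    ((volumeSublevel n ρ R)⁻¹ *
      ∫ x, φ x ^ (4 * ν * (k * μ) - 2 * ν) * u x ^ (2 * (k * μ)) ∂(riemannianVolume n M)) ^
        (1 / μ) ≤
      A * R ^ 2 * (2 * ν * k) ^ 2 * L ^ 2 * ((volumeSublevel n ρ R)⁻¹ *
        ∫ x, φ x ^ (4 * ν * k - 2 * ν) * u x ^ (2 * k) ∂(riemannianVolume n M)) := by
  have hμ0 : 0 < μ := by linarith
  have hν0 : ν ≠ 0 := by
    rintro rfl
    rw [div_zero, add_zero, div_eq_one_iff_eq hμ0.ne'] at hν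
    exact hμ.ne hν
  have hνμ : ν + μ = μ * ν := by field_simp at hν; linarith
  have hν1 : 1 < ν := by nlinarith
  set q := 2 * ν * k - (ν - 1) with hq
  have hνk : ν ≤ ν * k := by nlinarith
  have hq1 : 1 ≤ q := by linarith
  have hq2 : q ≤ 2 * ν * k := by linarith
  have hqμ : 4 * ν * (k * μ) - 2 * ν = q * (2 * μ) := by
    rw [hq]; linear_combination (-2) * hνμ
  have hq3 : 4 * ν * k - 2 * ν = (q - 1) * 2 := by rw [hq]; ring
  set χ : M → ℝ := fun x ↦ φ x ^ q with hχ
  have hχφ : tsupport χ ⊆ tsupport φ := closure_mono fun x hx h ↦ hx (by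
    simp [hχ, h, Real.zero_rpow (by linarith : q ≠ 0)])
  have hχL : ∀ x, ChartLipschitzAt n χ x := fun x ↦
    (hφ x).comp (G := fun t ↦ t ^ q)
      (Real.contDiff_rpow_const_of_le (n := 1) (by simpa using hq1)).contDiffAt
  have hχc : HasCompactSupport χ := hc.isCompact.of_isClosed_subset (isClosed_tsupport _) hχφ
  have hχs : tsupport χ ⊆ U := hχφ.trans hs
  have hu1 : ContMDiffOn (𝓡 n) 𝓘(ℝ, ℝ) 1 u U := hu.contMDiffOn.of_le one_le_two
  have hsob := hS.of_chartLipschitz hμ hρ hσ hR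
    (chartLipschitzAt_mul_rpow hU hu1 hu.pos hχL hχs k) hχc.mul_right
    ((tsupport_mul_subset_left.trans hχs).trans hUR)
  have hcac := hu.integral_energy_le hU hσ hσ0 hχL hχc hχs hk
  have hφcont : Continuous φ := continuous_iff_continuousAt.2 fun x ↦ (hφ x).continuousAt
  have hukc : ContinuousOn (fun x ↦ u x ^ (2 * k)) U :=
    hu1.continuousOn.rpow_const fun x hx ↦ Or.inl (hu.pos x hx).ne'
  have hwc : Continuous fun x ↦ φ x ^ (4 * ν * k - 2 * ν) :=
    hφcont.rpow_const fun x ↦ Or.inr (by linarith)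
  have hws : tsupport (fun x ↦ φ x ^ (4 * ν * k - 2 * ν)) ⊆ tsupport φ :=
    closure_mono fun x hx h ↦ hx (by
      simp [h, Real.zero_rpow (by linarith : 4 * ν * k - 2 * ν ≠ 0)])
  have hwi : Integrable (fun x ↦ φ x ^ (4 * ν * k - 2 * ν) * u x ^ (2 * k))
      (riemannianVolume n M) :=
    Continuous.integrable_of_hasCompactSupport (ContinuousOn.continuous_of_tsupport_subset
      (hwc.continuousOn.mul hukc) hU (tsupport_mul_subset_left.trans (hws.trans hs)))
      (HasCompactSupport.mul_right
        (hc.isCompact.of_isClosed_subset (isClosed_tsupport _) hws))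
  -- the approximation serves to know that `φ` is differentiable almost everywhere
  obtain ⟨F, Q, C, -, hF⟩ := exists_isSmoothApprox hφ hc hU hs
  have hle : ∫ x, u x ^ (2 * k) * ‖riemannianGradient (n := n) χ x‖ ^ 2 ∂(riemannianVolume n M) ≤
      (2 * ν * k) ^ 2 * L ^ 2 *
        ∫ x, φ x ^ (4 * ν * k - 2 * ν) * u x ^ (2 * k) ∂(riemannianVolume n M) := by
    rw [← integral_const_mul]
    refine integral_mono_ae (integrable_mul_norm_gradient_sq hU hukc hχL hχc hχs)
      (hwi.const_mul _) ?_
    filter_upwards [hL, hF.ae_tendsto_gradient] with x hx hx'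
    by_cases hxs : x ∈ tsupport φ
    · have hv := hu.pos x (hs hxs)
      have h0 := hφ0 x
      rw [hχ, riemannianGradient_comp hx'.1 (Real.hasDerivAt_rpow_const (Or.inr hq1)), norm_smul,
        Real.norm_of_nonneg (by positivity), hq3, Real.rpow_mul h0, Real.rpow_two]
      calc u x ^ (2 * k) * (q * φ x ^ (q - 1) * ‖riemannianGradient (n := n) φ x‖) ^ 2 ≤
          u x ^ (2 * k) * (2 * ν * k * φ x ^ (q - 1) * L) ^ 2 := by gcongr
        _ = _ := by ring
    · have h0 : φ x = 0 := image_eq_zero_of_notMem_tsupport hxs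
      rw [riemannianGradient_of_notMem_tsupport fun h ↦ hxs (hχφ h), h0,
        Real.zero_rpow (by linarith : 4 * ν * k - 2 * ν ≠ 0)]
      simp
  have heq : ∀ x, |χ x * u x ^ k| ^ (2 * μ) =
      φ x ^ (4 * ν * (k * μ) - 2 * ν) * u x ^ (2 * (k * μ)) := by
    intro x
    by_cases hxs : x ∈ tsupport φ
    · have hv := hu.pos x (hs hxs)
      have h0 := hφ0 x
      rw [abs_of_nonneg (by positivity), Real.mul_rpow (by positivity) (by positivity), hqμ,
        Real.rpow_mul h0, ← Real.rpow_mul hv.le]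
      congr 2; ring
    · have h0 : φ x = 0 := image_eq_zero_of_notMem_tsupport hxs
      rw [hqμ, hχ]
      simp only [h0]
      rw [Real.zero_rpow (by linarith : q ≠ 0), Real.zero_rpow (by positivity), zero_mul, zero_mul,
        abs_zero, Real.zero_rpow (by positivity)]
  simp_rw [heq] at hsob
  have hV : 0 ≤ (volumeSublevel n ρ R)⁻¹ := inv_nonneg.2 measureReal_nonneg
  refine hsob.trans ?_
  calc _ ≤ A * R ^ 2 * ((volumeSublevel n ρ R)⁻¹ * ((2 * ν * k) ^ 2 * L ^ 2 *
        ∫ x, φ x ^ (4 * ν * k - 2 * ν) * u x ^ (2 * k) ∂(riemannianVolume n M))) := by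
        have := hcac.trans hle
        gcongr
    _ = _ := by ring

/-- The weights `φ ^ (2ν)` allow the iteration to end with an `L¹` bound: if `W` is the maximum of
`φ ^ (2ν) u`, the iteration bounds `W²` by a multiple of the integral of `φ ^ (2ν) u²`, which is at
most `W` times the integral of `u`. -/
theorem IsPositiveSubsolutionOn.le_integral {ρ σ u φ : M → ℝ} {R₀ A μ ν R L : ℝ}
    {U : Set M} (hμ : 1 < μ) (hν : 1 / μ + 1 / ν = 1) (hA : 0 < A)
    (hS : SobolevInequality n ρ σ R₀ A μ) (hρ : Continuous ρ) (hσ : Continuous σ)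
    (hσ0 : ∀ x, 0 ≤ σ x) (hR : R₀ ≤ R) (hR0 : 0 < R) (hU : IsOpen U) (hUR : U ⊆ sublevel ρ R)
    (hV : 0 < volumeSublevel n ρ R)
    (hu : IsPositiveSubsolutionOn n σ u U) (hφ : ∀ x, ChartLipschitzAt n φ x)
    (hφ0 : ∀ x, 0 ≤ φ x) (hφ1 : ∀ x, φ x ≤ 1) {S : Set M} (hSc : IsCompact S) (hSU : S ⊆ U)
    (hs : tsupport φ ⊆ S) (hL0 : 0 < L)
    (hL : ∀ᵐ x ∂(riemannianVolume n M), ‖riemannianGradient (n := n) φ x‖ ≤ L)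
    {x₀ : M} (hx₀ : φ x₀ = 1) :
    u x₀ ≤ 4 * ((A * R ^ 2 * (2 * ν) ^ 2 * L ^ 2) ^ ν *
      Real.exp (2 * Real.log μ * ∑' j : ℕ, j * (μ⁻¹) ^ j)) *
        ((volumeSublevel n ρ R)⁻¹ * ∫ x in S, u x ∂(riemannianVolume n M)) := by
  have hμ0 : 0 < μ := by linarith
  have hν0 : ν ≠ 0 := by
    rintro rfl
    rw [div_zero, add_zero, div_eq_one_iff_eq hμ0.ne'] at hν
    exact hμ.ne hν
  have hνμ : ν + μ = μ * ν := by field_simp at hν; linarith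
  have hν1 : 1 < ν := by nlinarith
  have hc : HasCompactSupport φ := hSc.of_isClosed_subset (isClosed_tsupport _) hs
  have hφcont : Continuous φ := continuous_iff_continuousAt.2 fun x ↦ (hφ x).continuousAt
  have huc : ContinuousOn u U := hu.contMDiffOn.continuousOn
  set vol := riemannianVolume n M with hvol
  set V := volumeSublevel n ρ R with hVdef
  have hcs : ∀ {l : ℝ}, l ≠ 0 → tsupport (fun x ↦ φ x ^ l) ⊆ tsupport φ := fun {l} hl ↦
    closure_mono fun x hx h ↦ hx (by
      simp [h, Real.zero_rpow hl])
  have hcont : ∀ {l k : ℝ}, 0 < l → Continuous (fun x ↦ φ x ^ l * u x ^ k) := fun {l k} hl ↦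
    ContinuousOn.continuous_of_tsupport_subset ((hφcont.rpow_const fun x ↦
      Or.inr hl.le).continuousOn.mul (huc.rpow_const fun x hx ↦ Or.inl (hu.pos x hx).ne')) hU
      (tsupport_mul_subset_left.trans ((hcs hl.ne').trans (hs.trans hSU)))
  have hcomp : ∀ {l k : ℝ}, 0 < l → HasCompactSupport (fun x ↦ φ x ^ l * u x ^ k) := fun {l k} hl ↦
    HasCompactSupport.mul_right (hc.isCompact.of_isClosed_subset (isClosed_tsupport _) (hcs hl.ne'))
  have hout : ∀ {x : M}, x ∉ S → φ x = 0 := fun {x} hx ↦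
    image_eq_zero_of_notMem_tsupport fun h ↦ hx (hs h)
  set G : M → ℝ := fun x ↦ φ x ^ (2 * ν) * u x with hG
  have hGc : Continuous G := by simpa using hcont (l := 2 * ν) (k := 1) (by linarith)
  have hGcomp : HasCompactSupport G := by simpa using hcomp (l := 2 * ν) (k := 1) (by linarith)
  obtain ⟨x₁, hx₁⟩ : ∃ x₁, ∀ x, G x ≤ G x₁ := by
    have : Nonempty M := ⟨x₀⟩
    exact hGc.exists_forall_ge_of_hasCompactSupport hGcomp
  set W := G x₁ with hW
  have hx₀S : x₀ ∈ S := by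
    by_contra h
    exact one_ne_zero (hx₀.symm.trans (hout h))
  have hGx₀ : G x₀ = u x₀ := by simp [hG, hx₀]
  have hWu : u x₀ ≤ W := hGx₀ ▸ hx₁ x₀
  have hW0 : 0 < W := (hu.pos x₀ (hSU hx₀S)).trans_le hWu
  -- the level `W / 2` is exceeded on a set of positive volume; this choice costs the factor `4`
  set O : Set M := {x | W / 2 < G x} with hO
  have hOo : IsOpen O := isOpen_lt continuous_const hGc
  have hOS : O ⊆ S := fun x hx ↦ by
    by_contra h
    have : W / 2 < G x := hx
    simp only [hG, hout h] at this
    rw [Real.zero_rpow (by positivity), zero_mul] at this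
    linarith
  have hOfin : vol O ≠ ⊤ := ((measure_mono hOS).trans_lt hSc.measure_lt_top).ne
  have hOpos : 0 < vol.real O :=
    ENNReal.toReal_pos (hOo.measure_pos vol ⟨x₁, half_lt_self hW0⟩).ne'
      hOfin
  set a : ℕ → ℝ := fun j ↦ V⁻¹ *
    ∫ x, φ x ^ (4 * ν * μ ^ j - 2 * ν) * u x ^ (2 * μ ^ j) ∂vol with ha
  have hμj : ∀ j : ℕ, 1 ≤ μ ^ j := fun j ↦ one_le_pow₀ hμ.le
  have hexp : ∀ j : ℕ, 0 < 4 * ν * μ ^ j - 2 * ν := fun j ↦ by nlinarith [hμj j]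
  have hnn : ∀ (l k : ℝ), 0 < l → ∀ x, 0 ≤ φ x ^ l * u x ^ k := fun l k hl x ↦ by
    by_cases hx : x ∈ S
    · have := hφ0 x
      have := hu.pos x (hSU hx)
      positivity
    · rw [hout hx, Real.zero_rpow hl.ne', zero_mul]
  have hlow : ∀ j, (W / 2) ^ (2 * μ ^ j) * (V⁻¹ * vol.real O) ≤ a j := by
    intro j
    have h1 : (W / 2) ^ (2 * μ ^ j) * vol.real O ≤
        ∫ x in O, φ x ^ (4 * ν * μ ^ j - 2 * ν) * u x ^ (2 * μ ^ j) ∂vol := by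
      rw [mul_comm, ← smul_eq_mul, ← setIntegral_const]
      refine setIntegral_mono_on (integrableOn_const hOfin)
        (((hcont (hexp j)).integrable_of_hasCompactSupport (hcomp (hexp j))).integrableOn)
        hOo.measurableSet fun x hx ↦ ?_
      have hv := hu.pos x (hSU (hOS hx))
      have hxW : W / 2 < φ x ^ (2 * ν) * u x := hx
      have hφx : 0 < φ x := by
        rcases (hφ0 x).eq_or_lt with h | h
        · rw [← h, Real.zero_rpow (by positivity), zero_mul] at hxW
          linarith
        · exact h
      calc (W / 2) ^ (2 * μ ^ j) ≤ (φ x ^ (2 * ν) * u x) ^ (2 * μ ^ j) := by gcongr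
        _ = φ x ^ (4 * ν * μ ^ j) * u x ^ (2 * μ ^ j) := by
            rw [Real.mul_rpow (by positivity) hv.le, ← Real.rpow_mul hφx.le]
            congr 2; ring
        _ ≤ φ x ^ (4 * ν * μ ^ j - 2 * ν) * u x ^ (2 * μ ^ j) := by
            gcongr ?_ * _
            exact Real.rpow_le_rpow_of_exponent_ge hφx (hφ1 x) (by linarith)
    have h2 := setIntegral_le_integral (s := O)
      ((hcont (k := 2 * μ ^ j) (hexp j)).integrable_of_hasCompactSupport (hcomp (hexp j))
        (μ := vol))
      (Eventually.of_forall (hnn _ _ (hexp j)))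
    calc _ = V⁻¹ * ((W / 2) ^ (2 * μ ^ j) * vol.real O) := by ring
      _ ≤ _ := mul_le_mul_of_nonneg_left (h1.trans h2) (inv_nonneg.2 hV.le)
  have hrec : ∀ j, a (j + 1) ≤
      (A * R ^ 2 * (2 * ν) ^ 2 * L ^ 2 * μ ^ (2 * j) * a j) ^ μ := by
    intro j
    have h1 := hu.integral_rpow_le hμ hν hA hS hρ hσ hσ0 hR hU hUR hφ hφ0 hc (hs.trans hSU) hL
      (hμj j)
    rw [← pow_succ] at h1
    have h2 : 0 ≤ a (j + 1) := mul_nonneg (inv_nonneg.2 hV.le)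
      (integral_nonneg (hnn _ _ (hexp (j + 1))))
    have h3 := Real.rpow_le_rpow (Real.rpow_nonneg h2 _) h1 hμ0.le
    rw [← Real.rpow_mul h2, one_div_mul_cancel hμ0.ne', Real.rpow_one] at h3
    refine h3.trans_eq ?_
    simp only [ha]
    congr 1
    ring
  have hmain := sq_le_of_le_rpow_of_rpow_mul_le hμ hν (by positivity)
    (by positivity) (by positivity) hlow hrec
  have hui : IntegrableOn u S vol := (huc.mono hSU).integrableOn_compact hSc
  have ha0 : a 0 ≤ W * (V⁻¹ * ∫ x in S, u x ∂vol) := by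
    have h1 : ∫ x, φ x ^ (4 * ν * μ ^ 0 - 2 * ν) * u x ^ (2 * μ ^ 0) ∂vol =
        ∫ x in S, φ x ^ (4 * ν * μ ^ 0 - 2 * ν) * u x ^ (2 * μ ^ 0) ∂vol :=
      (setIntegral_eq_integral_of_forall_compl_eq_zero fun x hx ↦ by
        rw [hout hx, Real.zero_rpow (hexp 0).ne', zero_mul]).symm
    have h2 : ∫ x in S, φ x ^ (4 * ν * μ ^ 0 - 2 * ν) * u x ^ (2 * μ ^ 0) ∂vol ≤
        ∫ x in S, W * u x ∂vol := by
      refine setIntegral_mono_on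
        (((hcont (hexp 0)).integrable_of_hasCompactSupport (hcomp (hexp 0))).integrableOn)
        (hui.const_mul W) hSc.isClosed.measurableSet fun x hx ↦ ?_
      have hv := hu.pos x (hSU hx)
      have h3 : φ x ^ (4 * ν * μ ^ 0 - 2 * ν) * u x ^ (2 * μ ^ 0) = G x * u x := by
        rw [pow_zero, mul_one, mul_one, Real.rpow_two, hG]
        have : 4 * ν - 2 * ν = 2 * ν := by ring
        rw [this]; ring
      rw [h3]
      exact mul_le_mul_of_nonneg_right (hx₁ x) hv.le
    rw [integral_const_mul] at h2
    simp only [ha]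
    rw [h1]
    calc _ ≤ V⁻¹ * (W * ∫ x in S, u x ∂vol) :=
          mul_le_mul_of_nonneg_left h2 (inv_nonneg.2 hV.le)
      _ = _ := by ring
  set B := (A * R ^ 2 * (2 * ν) ^ 2 * L ^ 2) ^ ν *
    Real.exp (2 * Real.log μ * ∑' j : ℕ, j * (μ⁻¹) ^ j) with hB
  have hB0 : 0 < B := by positivity
  have hfin : W * W ≤ W * (4 * B * (V⁻¹ * ∫ x in S, u x ∂vol)) := by
    have := hmain.trans (mul_le_mul_of_nonneg_left ha0 hB0.le)
    linarith
  exact hWu.trans (le_of_mul_le_mul_left hfin hW0)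

end Moser

/-! ### The mean value inequality -/

section MeanValue

open Filter Topology Set

variable {n : ℕ} {M : Type*} [EMetricSpace M] [SecondCountableTopology M]
  [ChartedSpace (EuclideanSpace ℝ (Fin n)) M] [IsManifold (𝓡 n) ∞ M]
  [RiemannianBundle (fun x : M ↦ TangentSpace (𝓡 n) x)]
  [IsContMDiffRiemannianBundle (𝓡 n) ∞ (EuclideanSpace ℝ (Fin n))
    (fun x : M ↦ TangentSpace (𝓡 n) x)]
  [IsRiemannianManifold (𝓡 n) M] [MeasurableSpace M] [BorelSpace M]

/-- The mean value inequality, with the cutoff `η ((ρ - R) / s)` supported in the annulus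
`|ρ - R| ≤ s`, `s = θR / 2`. -/
theorem IsPositiveSubsolutionOn.supOn_levelSet_le {A μ ν : ℝ} (hA : 0 < A) (hμ : 1 < μ)
    (hν : 1 / μ + 1 / ν = 1) {η : ℝ → ℝ} {K : ℝ} (hK : 0 < K) (hη : ContDiff ℝ 1 η)
    (hη0 : ∀ t, 0 ≤ η t) (hη1 : ∀ t, η t ≤ 1) (hη01 : η 0 = 1)
    (hηs : ∀ t, t ∉ Icc (-1) 1 → η t = 0) (hηK : ∀ t, |deriv η t| ≤ K)
    {ρ σ : M → ℝ} {m R₀ : ℝ} (hR₀ : 0 < R₀) (hσ : Continuous σ) (hσ0 : ∀ x, 0 ≤ σ x)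
    (hρ : IsDistanceLike n ρ m R₀) (hS : SobolevInequality n ρ σ R₀ A μ) {θ R : ℝ} (hθ : 0 < θ)
    (hθ1 : θ ≤ 1) (hR : 4 * R₀ ≤ R) {u : M → ℝ}
    (hu : IsPositiveSubsolutionOn n σ u {x | R₀ < ρ x ∧ ρ x < 2 * R}) :
    supOn u (levelSet ρ R) ≤
      ENNReal.ofReal (4 * ((64 * A * ν ^ 2 * K ^ 2) ^ ν *
        Real.exp (2 * Real.log μ * ∑' j : ℕ, j * (μ⁻¹) ^ j)) /
          (θ ^ (2 * ν) * volumeSublevel n ρ (2 * R))) *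
        integralOn n u (sublevel ρ ((1 + θ) * R) \ sublevel ρ (R / 4)) := by
  have hR0 : 0 < R := by linarith
  have hθR : θ * R ≤ R := by nlinarith
  set s := θ * R / 2 with hs
  have hs0 : 0 < s := by positivity
  set S := ρ ⁻¹' Icc (R - s) (R + s) with hSdef
  have hSc : IsCompact S := hρ.isCompact_preimage_Icc _ _
  have hρc := hρ.proper.continuous
  have hU : IsOpen {x | R₀ < ρ x ∧ ρ x < 2 * R} :=
    (isOpen_lt continuous_const hρc).inter (isOpen_lt hρc continuous_const)
  have hSU : S ⊆ {x | R₀ < ρ x ∧ ρ x < 2 * R} := fun x hx ↦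
    ⟨by linarith [hx.1], by linarith [hx.2]⟩
  obtain ⟨Kρ, hKρ⟩ := hρ.lipschitz
  have hφ : ∀ x, ChartLipschitzAt n (fun x ↦ η ((ρ x - R) / s)) x := fun x ↦
    (hKρ.chartLipschitzAt x).comp (G := fun t ↦ η ((t - R) / s))
      (hη.comp (by fun_prop)).contDiffAt
  have hν0 : ν ≠ 0 := by
    rintro rfl
    rw [div_zero, add_zero, div_eq_one_iff_eq (by linarith)] at hν
    exact hμ.ne hν
  refine iSup₂_le fun x hx ↦ ?_
  have hx' : ρ x = R := hx
  have hV : 0 < volumeSublevel n ρ (2 * R) := hρ.volumeSublevel_pos (x := x) (by linarith)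
  have hmain := hu.le_integral hμ hν hA hS hρc hσ hσ0 (by linarith) (by linarith) hU
    (fun x hx ↦ hx.2) hV hφ (fun x ↦ hη0 _) (fun x ↦ hη1 _) hSc hSU
    (tsupport_comp_sub_div_subset hρc hηs hs0) (div_pos hK hs0)
    (hρ.ae_norm_gradient_comp_le hη hηs hηK hs0 (by linarith)) (x₀ := x) (by simp [hx', hη01])
  -- `64 = 2² · 2² · 2²`: from the radius `2R`, the exponent `2ν`, and `s = θR / 2`
  have hB : (A * (2 * R) ^ 2 * (2 * ν) ^ 2 * (K / s) ^ 2) ^ ν =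
      (64 * A * ν ^ 2 * K ^ 2) ^ ν / θ ^ (2 * ν) := by
    rw [Real.rpow_mul hθ.le, ← Real.div_rpow (by positivity) (by positivity), Real.rpow_two]
    congr 1
    rw [hs]
    field_simp
    ring
  have hui : IntegrableOn u S (riemannianVolume n M) :=
    (hu.contMDiffOn.continuousOn.mono hSU).integrableOn_compact hSc
  rw [hB] at hmain
  have hSD : S ⊆ sublevel ρ ((1 + θ) * R) \ sublevel ρ (R / 4) := fun y hy ↦
    ⟨show ρ y < (1 + θ) * R by linarith [hy.2], show ¬ ρ y < R / 4 by linarith [hy.1]⟩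
  calc ENNReal.ofReal (u x) ≤ ENNReal.ofReal (4 * ((64 * A * ν ^ 2 * K ^ 2) ^ ν *
        Real.exp (2 * Real.log μ * ∑' j : ℕ, j * (μ⁻¹) ^ j)) /
          (θ ^ (2 * ν) * volumeSublevel n ρ (2 * R)) *
            ∫ y in S, u y ∂(riemannianVolume n M)) := by
        refine ENNReal.ofReal_le_ofReal (hmain.trans_eq ?_)
        field_simp
    _ = _ := ENNReal.ofReal_mul (by positivity)
    _ ≤ _ := by
        gcongr
        rw [ofReal_integral_eq_lintegral_ofReal hui
          (ae_restrict_of_forall_mem hSc.isClosed.measurableSet fun y hy ↦ (hu.pos y (hSU hy)).le)]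
        exact lintegral_mono_set hSD

end MeanValue

theorem mainTheorem10 (A μ ν : ℝ) (hA : 0 < A) (hμ : 1 < μ) (hν : 1 / μ + 1 / ν = 1) :
    ∃ C : ℝ, 0 < C ∧
      ∀ (n : ℕ) (M : Type*) [EMetricSpace M] [SecondCountableTopology M]
        [ChartedSpace (EuclideanSpace ℝ (Fin n)) M] [IsManifold (𝓡 n) ∞ M]
        [RiemannianBundle (fun x : M ↦ TangentSpace (𝓡 n) x)]
        [IsContMDiffRiemannianBundle (𝓡 n) ∞ (EuclideanSpace ℝ (Fin n))
          (fun x : M ↦ TangentSpace (𝓡 n) x)]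
        [IsRiemannianManifold (𝓡 n) M] [MeasurableSpace M] [BorelSpace M]
        (ρ σ : M → ℝ) (m R₀ : ℝ),
        0 < m → 0 < R₀ → Continuous σ → (∀ x, 0 ≤ σ x) →
        IsDistanceLike n ρ m R₀ → SobolevInequality n ρ σ R₀ A μ →
        (∀ θ R : ℝ, 0 < θ → θ ≤ 1 → 4 * R₀ ≤ R → ∀ u : M → ℝ,
          IsPositiveSubsolutionOn n σ u {x | R₀ < ρ x ∧ ρ x < 2 * R} →
          supOn u (levelSet ρ R) ≤
            ENNReal.ofReal (C / (θ ^ (2 * ν) * volumeSublevel n ρ (2 * R))) *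
              integralOn n u (sublevel ρ ((1 + θ) * R) \ sublevel ρ (R / 4))) ∧
        MeanValueProperty n ρ σ R₀ := by
  obtain ⟨η, K, hK, hη, hη0, hη1, hη01, hηs, hηK⟩ := exists_contDiff_cutoff
  have hμ0 : 0 < μ := by linarith
  have hν0 : ν ≠ 0 := by
    rintro rfl
    rw [div_zero, add_zero, div_eq_one_iff_eq hμ0.ne'] at hν
    exact hμ.ne hν
  have hν1 : 1 < ν := by
    have h1 : ν + μ = μ * ν := by field_simp at hν; linarith
    nlinarith
  set C := 4 * ((64 * A * ν ^ 2 * K ^ 2) ^ ν *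
    Real.exp (2 * Real.log μ * ∑' j : ℕ, j * (μ⁻¹) ^ j)) with hC
  have hC0 : 0 < C := by positivity
  refine ⟨C, hC0, ?_⟩
  intro n M _ _ _ _ _ _ _ _ _ ρ σ m R₀ _ hR₀ hσ hσ0 hρ hS
  have hmain : ∀ θ R : ℝ, 0 < θ → θ ≤ 1 → 4 * R₀ ≤ R → ∀ u : M → ℝ,
      IsPositiveSubsolutionOn n σ u {x | R₀ < ρ x ∧ ρ x < 2 * R} →
      supOn u (levelSet ρ R) ≤
        ENNReal.ofReal (C / (θ ^ (2 * ν) * volumeSublevel n ρ (2 * R))) *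
          integralOn n u (sublevel ρ ((1 + θ) * R) \ sublevel ρ (R / 4)) :=
    fun θ R hθ hθ1 hR u hu ↦
      hu.supOn_levelSet_le hA hμ hν hK hη hη0 hη1 hη01 hηs hηK hR₀ hσ hσ0 hρ hS hθ hθ1 hR
  refine ⟨hmain, C, ν, hC0, hν1, fun θ R hθ hθ1 hR u hu ↦ ?_⟩
  -- a point of `Σ(R)` ensures that `V((1 + θ)R)` is not zero
  rcases (levelSet ρ R).eq_empty_or_nonempty with hempty | ⟨x, hx⟩
  · simp [supOn, hempty]
  have hx' : ρ x = R := hx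
  have hR0 : 0 < R := by linarith
  have hV : 0 < volumeSublevel n ρ ((1 + θ) * R) :=
    hρ.volumeSublevel_pos (x := x) (by nlinarith)
  have hVV : volumeSublevel n ρ ((1 + θ) * R) ≤ volumeSublevel n ρ (2 * R) :=
    measureReal_mono (fun y (hy : ρ y < (1 + θ) * R) ↦ show ρ y < 2 * R by nlinarith)
      (hρ.measure_sublevel_ne_top _)
  refine (hmain θ R hθ hθ1 hR u hu).trans (mul_le_mul' (ENNReal.ofReal_le_ofReal ?_)
    (lintegral_mono_set (Set.sdiff_subset_sdiff_right fun y (hy : ρ y < R₀) ↦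
      show ρ y < R / 4 by linarith)))
  rw [← div_div, mul_one_div]
  gcongr
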